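/- Let $N\ge 1$ and consider the infinite star graph consisting of one vertex with $N$ edges $(0,\infty)$, with Hilbert space $L^2(0,\infty)^N$ of functions $u=(u_j)_{j=1}^N$ (where $x$ is the distance from the vertex along edge $j$). Let $H=-d^2/dx^2$ be the self-adjoint operator whose domain consists of the $u$ with all $u_j\in H^2(0,\infty)$ that satisfy one of the following conditions at the vertex: (S) Exner–Šeba, $\alpha>0$: $u_j(0)=u(0)$ for all $j$ and $\sum_j u_j'(0)=\alpha u(0)$; (K) Kirchhoff: $u_j(0)=u(0)$ for all $j$ and $\sum_j u_j'(0)=0$; (D) Dirichlet: $u_j(0)=0$ for all $j$. A spectral density of $H$ is a matrix-valued function $\sigma_j{}^l(\omega,x,y)$, $1\le j,l\le N$, continuous on $\omega,x,y\ge 0$, such that for every $\Lambda\ge 0$ the spectral projection $P([0,\Lambda])$ of $H$ has the integral kernel $\int_0^{\sqrt\Lambda}\sigma(\omega,x,y)\,d\omega$, that is, $(P([0,\Lambda])f)_j(x)=\sum_l\int_0^\infty\bigl(\int_0^{\sqrt\Lambda}\sigma_j{}^l(\omega,x,y)\,d\omega\bigr)f_l(y)\,dy$ for almost every $x>0$,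 for every $j$ and every $f\in L^2(0,\infty)^N$ that vanishes outside a bounded set. Then for each of the conditions (S), (K), (D) a spectral density exists, and for every spectral density $\sigma_S$, $\sigma_K$, $\sigma_D$ of the respective operators, all $j$ and all $\omega,x\ge 0$, the following holds. 1. For every $\alpha>0$, $$\sigma_{S\,j}{}^{j}(\omega,x,x)=\frac1\pi+\frac1\pi\Bigl(\frac2N-1\Bigr)\cos(2\omega x)+\frac{2\alpha/\pi}{\alpha^2+N^2\omega^2}\Bigl[\omega\sin(2\omega x)-\frac{\alpha}{N}\cos(2\omega x)\Bigr].$$ The first term is the Weyl term, the second the Kirchhoff term and the third the Exner–Šeba correction. 2. $\displaystyle\sigma_{K\,j}{}^{j}(\omega,x,x)=\frac1\pi+\frac1\pi\Bigl(\frac2N-1\Bigr)\cos(2\omega x)$. 3. $\displaystyle\sigma_{D\,j}{}^{j}(\omega,x,x)=\frac1\pi\bigl(1-\cos(2\omega x)\bigr)$, and $\sigma_{S\,j}{}^{j}(\omega,x,x)\to\sigma_{D\,j}{}^{j}(\omega,x,x)$ as $\alpha\to+\infty$ with $\omega,x$ fixed. -/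

import Mathlib

open MeasureTheory Set Filter Topology

noncomputable section

/-! ### Spectral resolution of an unbounded operator -/

/-- A projection-valued measure on the Borel sets of `ℝ`, with values in the orthogonal
projections of a complex Hilbert space `E`, countably additive in the strong sense. -/
structure ProjValuedMeasure (E : Type*) [NormedAddCommGroup E] [InnerProductSpace ℂ E]
    [CompleteSpace E] where
  proj : Set ℝ → E →L[ℂ] E
  isStarProjection : ∀ A, MeasurableSet A → IsStarProjection (proj A)
  proj_univ : proj univ = 1
  proj_inter : ∀ A B, MeasurableSet A → MeasurableSet B → proj (A ∩ B) = proj A * proj B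
  hasSum_iUnion : ∀ A : ℕ → Set ℝ, (∀ n, MeasurableSet (A n)) →
    Pairwise (Function.onFun Disjoint A) →
    ∀ u : E, HasSum (fun n => proj (A n) u) (proj (⋃ n, A n) u)

namespace ProjValuedMeasure

variable {E : Type*} [NormedAddCommGroup E] [InnerProductSpace ℂ E] [CompleteSpace E]

theorem norm_sq_proj (P : ProjValuedMeasure E) (u : E) {A : Set ℝ} (hA : MeasurableSet A) :
    ‖P.proj A u‖ ^ 2 = (inner ℂ u (P.proj A u)).re := by
  have h := P.isStarProjection A hA
  have h1 : ContinuousLinearMap.adjoint (P.proj A) = P.proj A := h.isSelfAdjoint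
  have h2 : P.proj A (P.proj A u) = P.proj A u := by
    have := congrArg (fun T : E →L[ℂ] E => T u) h.isIdempotentElem.eq
    simpa using this
  rw [← inner_self_eq_norm_sq (𝕜 := ℂ) (P.proj A u)]
  conv_lhs => rw [← ContinuousLinearMap.adjoint_inner_right, h1, h2]
  rfl

theorem hasSum_norm_sq (P : ProjValuedMeasure E) (u : E) (A : ℕ → Set ℝ)
    (hA : ∀ n, MeasurableSet (A n)) (hd : Pairwise (Function.onFun Disjoint A)) :
    HasSum (fun n => ‖P.proj (A n) u‖ ^ 2) (‖P.proj (⋃ n, A n) u‖ ^ 2) := by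
  have h := P.hasSum_iUnion A hA hd u
  have h2 := (h.mapL (innerSL ℂ u)).mapL Complex.reCLM
  simpa [norm_sq_proj, hA, MeasurableSet.iUnion hA] using h2

theorem proj_empty (P : ProjValuedMeasure E) : P.proj ∅ = 0 := by
  ext u
  have h := P.hasSum_iUnion (fun _ => ∅) (fun _ => MeasurableSet.empty)
    (fun _ _ _ => by simp [Function.onFun]) u
  simpa using (summable_const_iff (β := ℕ) _).1 h.summable

/-- The scalar spectral measure `A ↦ ‖P(A)u‖² = ⟨u, P(A)u⟩` of a vector `u`. -/
def scalarMeasure (P : ProjValuedMeasure E) (u : E) : Measure ℝ :=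
  Measure.ofMeasurable (fun A _ => ENNReal.ofReal (‖P.proj A u‖ ^ 2))
    (by simp [proj_empty])
    (fun A hA hd => by
      have h := P.hasSum_norm_sq u A hA hd
      rw [← h.tsum_eq, ENNReal.ofReal_tsum_of_nonneg (fun n => by positivity) h.summable])

theorem scalarMeasure_apply (P : ProjValuedMeasure E) (u : E) {A : Set ℝ}
    (hA : MeasurableSet A) :
    P.scalarMeasure u A = ENNReal.ofReal (‖P.proj A u‖ ^ 2) :=
  Measure.ofMeasurable_apply A hA

/-- `P` is the spectral resolution of the operator `H`, i.e. `H = ∫ lam dP(lam)`: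
the domain of `H` consists of the `u` with `∫ lam² d⟨u, P(lam)u⟩ < ∞`, and
`⟨u, H u⟩ = ∫ lam d⟨u, P(lam)u⟩` for these `u` (which by polarization determines `H u`). -/
structure IsSpectralResolution (P : ProjValuedMeasure E) (H : E →ₗ.[ℂ] E) : Prop where
  mem_domain_iff : ∀ u : E, u ∈ H.domain ↔
    ∫⁻ lam, ENNReal.ofReal (lam ^ 2) ∂(P.scalarMeasure u) < ⊤
  inner_apply : ∀ u : H.domain,
    inner ℂ (u : E) (H u) = ((∫ lam, lam ∂(P.scalarMeasure (u : E)) : ℝ) : ℂ)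

end ProjValuedMeasure

/-! ### The Laplacian on the infinite star graph -/

namespace StarGraph

/-- The space `L²(0,∞)^N`; `u j` is the component on the edge `j`, as a function of the
distance from the vertex. -/
abbrev HilbertSpace (N : ℕ) : Type :=
  PiLp 2 (fun _ : Fin N => Lp ℂ 2 (volume.restrict (Ioi (0 : ℝ))))

/-- The boundary conditions at the vertex. -/
inductive VertexCondition : Type
  | dirichlet : VertexCondition
  | kirchhoff : VertexCondition
  | exnerSeba (α : ℝ) : VertexCondition

/-- The boundary condition, for `a j = u_j(0)` and `b j = u_j'(0)`. -/
def VertexCondition.Holds {N : ℕ} : VertexCondition → (Fin N → ℂ) → (Fin N → ℂ) → Prop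
  | .dirichlet, a, _ => ∀ j, a j = 0
  | .kirchhoff, a, b => ∃ c : ℂ, (∀ j, a j = c) ∧ ∑ j, b j = 0
  | .exnerSeba α, a, b => ∃ c : ℂ, (∀ j, a j = c) ∧ ∑ j, b j = (α : ℂ) * c

/-- `u` lies in the Sobolev space `H²` of every edge and `-u'' = w`: the component `u_j` is
represented on `[0,∞)` by the differentiable function `g j`, whose derivative `g' j` is absolutely
continuous with `(g' j)' = -w_j`. -/
structure IsRepresentedBy {N : ℕ} (u w : HilbertSpace N) (g g' : Fin N → ℝ → ℂ) : Prop where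
  ae_eq : ∀ j, (u j : ℝ → ℂ) =ᵐ[volume.restrict (Ioi (0 : ℝ))] g j
  hasDeriv : ∀ j, ∀ x, 0 ≤ x → HasDerivWithinAt (g j) (g' j x) (Ici 0) x
  deriv_eq : ∀ j, ∀ x, 0 ≤ x → g' j x = g' j 0 - ∫ t in (0 : ℝ)..x, (w j : ℝ → ℂ) t

theorem intervalIntegrable_coe (f : Lp ℂ 2 (volume.restrict (Ioi (0 : ℝ)))) {x : ℝ}
    (hx : 0 ≤ x) : IntervalIntegrable (f : ℝ → ℂ) volume 0 x := by
  rw [intervalIntegrable_iff_integrableOn_Ioc_of_le hx]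
  have h1 : MemLp (f : ℝ → ℂ) 2 (volume.restrict (Ioc 0 x)) :=
    (Lp.memLp f).mono_measure (Measure.restrict_mono Ioc_subset_Ioi_self le_rfl)
  exact h1.integrable (by norm_num)

theorem IsRepresentedBy.add {N : ℕ} {u w v z : HilbertSpace N} {g g' h h' : Fin N → ℝ → ℂ}
    (h1 : IsRepresentedBy u w g g') (h2 : IsRepresentedBy v z h h') :
    IsRepresentedBy (u + v) (w + z) (g + h) (g' + h') where
  ae_eq j := by
    filter_upwards [Lp.coeFn_add (u j) (v j), h1.ae_eq j, h2.ae_eq j] with x e1 e2 e3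
    rw [PiLp.add_apply, e1, Pi.add_apply, e2, e3]
    rfl
  hasDeriv j x hx := (h1.hasDeriv j x hx).add (h2.hasDeriv j x hx)
  deriv_eq j x hx := by
    have e : ∫ t in (0 : ℝ)..x, ((w + z) j : ℝ → ℂ) t
        = ∫ t in (0 : ℝ)..x, ((w j : ℝ → ℂ) t + (z j : ℝ → ℂ) t) := by
      rw [intervalIntegral.integral_of_le hx, intervalIntegral.integral_of_le hx]
      apply integral_congr_ae
      have := ae_restrict_of_ae_restrict_of_subset
        (Ioc_subset_Ioi_self : Ioc 0 x ⊆ Ioi (0 : ℝ)) (Lp.coeFn_add (w j) (z j))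
      filter_upwards [this] with t ht
      simpa [PiLp.add_apply] using ht
    rw [e, intervalIntegral.integral_add (intervalIntegrable_coe _ hx)
      (intervalIntegrable_coe _ hx)]
    simp only [Pi.add_apply, h1.deriv_eq j x hx, h2.deriv_eq j x hx]
    ring

theorem IsRepresentedBy.smul {N : ℕ} {u w : HilbertSpace N} {g g' : Fin N → ℝ → ℂ} (c : ℂ)
    (h1 : IsRepresentedBy u w g g') :
    IsRepresentedBy (c • u) (c • w) (c • g) (c • g') where
  ae_eq j := by
    filter_upwards [Lp.coeFn_smul c (u j), h1.ae_eq j] with x e1 e2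
    simp [PiLp.smul_apply, e1, e2]
  hasDeriv j x hx := (h1.hasDeriv j x hx).const_smul c
  deriv_eq j x hx := by
    have e : ∫ t in (0 : ℝ)..x, ((c • w) j : ℝ → ℂ) t
        = ∫ t in (0 : ℝ)..x, c * (w j : ℝ → ℂ) t := by
      rw [intervalIntegral.integral_of_le hx, intervalIntegral.integral_of_le hx]
      apply integral_congr_ae
      have := ae_restrict_of_ae_restrict_of_subset
        (Ioc_subset_Ioi_self : Ioc 0 x ⊆ Ioi (0 : ℝ)) (Lp.coeFn_smul c (w j))
      filter_upwards [this] with t ht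
      simpa [PiLp.smul_apply] using ht
    rw [e, intervalIntegral.integral_const_mul]
    simp only [Pi.smul_apply, h1.deriv_eq j x hx, smul_eq_mul]
    ring

theorem IsRepresentedBy.zero {N : ℕ} :
    IsRepresentedBy (0 : HilbertSpace N) 0 (fun _ _ => 0) (fun _ _ => 0) where
  ae_eq j := Lp.coeFn_zero ℂ 2 (volume.restrict (Ioi (0 : ℝ)))
  hasDeriv j x _ := hasDerivWithinAt_const x (Ici 0) (0 : ℂ)
  deriv_eq j x hx := by
    have e : ∫ t in (0 : ℝ)..x, ((0 : HilbertSpace N) j : ℝ → ℂ) t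
        = ∫ t in (0 : ℝ)..x, (0 : ℂ) := by
      rw [intervalIntegral.integral_of_le hx, intervalIntegral.integral_of_le hx]
      apply integral_congr_ae
      exact ae_restrict_of_ae_restrict_of_subset
        (Ioc_subset_Ioi_self : Ioc 0 x ⊆ Ioi (0 : ℝ)) (Lp.coeFn_zero ℂ 2 (volume.restrict (Ioi (0 : ℝ))))
    rw [e]
    simp

/-- `-u''` is determined by `u`. -/
theorem IsRepresentedBy.eq_zero {N : ℕ} {u w : HilbertSpace N} {g g' : Fin N → ℝ → ℂ}
    (h : IsRepresentedBy u w g g') (hu : u = 0) : w = 0 := by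
  ext1 j
  have hc : ContinuousOn (g j) (Ici 0) := fun x hx => (h.hasDeriv j x hx).continuousWithinAt
  have hg : ∀ x ∈ Ici (0 : ℝ), g j x = 0 := by
    have h0 : g j =ᵐ[volume.restrict (Ioi (0 : ℝ))] fun _ => (0 : ℂ) := by
      have := Lp.coeFn_zero ℂ 2 (volume.restrict (Ioi (0 : ℝ)))
      refine (h.ae_eq j).symm.trans ?_
      subst hu
      exact this
    have h1 : EqOn (g j) (fun _ => 0) (Ioi 0) :=
      Measure.eqOn_open_of_ae_eq h0 isOpen_Ioi (hc.mono Ioi_subset_Ici_self)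
        continuousOn_const
    have h2 : EqOn (g j) (fun _ => 0) (Ici 0) :=
      h1.of_subset_closure hc continuousOn_const Ioi_subset_Ici_self (by simp)
    exact h2
  have hg' : ∀ x, 0 ≤ x → g' j x = 0 := by
    intro x hx
    have h1 : HasDerivWithinAt (g j) 0 (Ici 0) x :=
      (hasDerivWithinAt_const x (Ici 0) (0 : ℂ)).congr hg (hg x hx)
    exact (uniqueDiffOn_Ici 0 x hx).eq_deriv _ (h.hasDeriv j x hx) h1
  have hint : ∀ x, 0 ≤ x → ∫ t in (0 : ℝ)..x, (w j : ℝ → ℂ) t = 0 := by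
    intro x hx
    have := h.deriv_eq j x hx
    rw [hg' x hx, hg' 0 le_rfl] at this
    simpa using this
  set f : ℝ → ℂ := (Ioi (0 : ℝ)).indicator (w j : ℝ → ℂ) with hf
  have hf0 : ∀ x, 0 ≤ x → ∫ t in (0 : ℝ)..x, f t = 0 := by
    intro x hx
    rw [← hint x hx, intervalIntegral.integral_of_le hx, intervalIntegral.integral_of_le hx]
    exact setIntegral_congr_fun measurableSet_Ioc (fun t ht => indicator_of_mem (show
      t ∈ Ioi (0 : ℝ) from ht.1) _)
  have hf1 : ∀ x, ∫ t in (0 : ℝ)..x, f t = 0 := by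
    intro x
    rcases le_total 0 x with hx | hx
    · exact hf0 x hx
    · rw [intervalIntegral.integral_symm, intervalIntegral.integral_of_le hx]
      rw [setIntegral_congr_fun (g := fun _ => (0 : ℂ)) measurableSet_Ioc (fun t ht =>
        indicator_of_notMem (show t ∉ Ioi (0 : ℝ) from not_lt.2 ht.2) _)]
      simp
  have hm : MemLp f 2 volume := (memLp_indicator_iff_restrict measurableSet_Ioi).2
    (Lp.memLp (w j))
  have hl : LocallyIntegrable f volume := hm.locallyIntegrable (by norm_num)
  have hz : ∀ᵐ x : ℝ, f x = 0 := by
    filter_upwards [LocallyIntegrable.ae_hasDerivAt_integral hl] with x hx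
    have h1 := hx 0
    simp only [hf1] at h1
    exact h1.unique (hasDerivAt_const x 0)
  refine Lp.ext ?_
  have h3 := Lp.coeFn_zero ℂ 2 (volume.restrict (Ioi (0 : ℝ)))
  have h4 : ∀ᵐ x ∂(volume.restrict (Ioi (0 : ℝ))), f x = 0 := ae_restrict_of_ae hz
  have h5 : ∀ᵐ x ∂(volume.restrict (Ioi (0 : ℝ))), x ∈ Ioi (0 : ℝ) :=
    ae_restrict_mem measurableSet_Ioi
  refine EventuallyEq.trans ?_ h3.symm
  filter_upwards [h4, h5] with x e1 e2
  rw [hf, indicator_of_mem e2] at e1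
  simpa using e1

/-- The graph of `H = -d²/dx²` with the boundary condition `bc`. -/
def laplacianGraph (N : ℕ) (bc : VertexCondition) :
    Submodule ℂ (HilbertSpace N × HilbertSpace N) where
  carrier := {p | ∃ g g' : Fin N → ℝ → ℂ, IsRepresentedBy p.1 p.2 g g' ∧
    bc.Holds (fun j => g j 0) (fun j => g' j 0)}
  add_mem' := by
    rintro p q ⟨g, g', h1, h2⟩ ⟨k, k', h3, h4⟩
    refine ⟨g + k, g' + k', h1.add h3, ?_⟩
    cases bc with
    | dirichlet => exact fun j => by simp [h2 j, h4 j]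
    | kirchhoff =>
      obtain ⟨c, hc, hs⟩ := h2
      obtain ⟨d, hd, ht⟩ := h4
      exact ⟨c + d, fun j => by simp [hc j, hd j], by simp [Finset.sum_add_distrib, hs, ht]⟩
    | exnerSeba α =>
      obtain ⟨c, hc, hs⟩ := h2
      obtain ⟨d, hd, ht⟩ := h4
      exact ⟨c + d, fun j => by simp [hc j, hd j],
        by simp [Finset.sum_add_distrib, hs, ht, mul_add]⟩
  zero_mem' := by
    refine ⟨fun _ _ => 0, fun _ _ => 0, IsRepresentedBy.zero, ?_⟩
    cases bc with
    | dirichlet => exact fun j => rfl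
    | kirchhoff => exact ⟨0, fun j => rfl, by simp⟩
    | exnerSeba α => exact ⟨0, fun j => rfl, by simp⟩
  smul_mem' := by
    rintro a p ⟨g, g', h1, h2⟩
    refine ⟨a • g, a • g', h1.smul a, ?_⟩
    cases bc with
    | dirichlet => exact fun j => by simp [h2 j]
    | kirchhoff =>
      obtain ⟨c, hc, hs⟩ := h2
      exact ⟨a * c, fun j => by simp [hc j], by simp [← Finset.mul_sum, hs]⟩
    | exnerSeba α =>
      obtain ⟨c, hc, hs⟩ := h2
      exact ⟨a * c, fun j => by simp [hc j], by simp [← Finset.mul_sum, hs]; ring⟩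

/-- The operator `H = -d²/dx²` in `L²(0,∞)^N` with the boundary condition `bc`. -/
def laplacian (N : ℕ) (bc : VertexCondition) : HilbertSpace N →ₗ.[ℂ] HilbertSpace N :=
  (laplacianGraph N bc).toLinearPMap

theorem laplacian_graph (N : ℕ) (bc : VertexCondition) :
    (laplacian N bc).graph = laplacianGraph N bc := by
  refine Submodule.toLinearPMap_graph_eq _ ?_
  rintro p ⟨g, g', h, -⟩ hp
  exact h.eq_zero hp

/-! ### The spectral density kernel -/

/-- The operator `T` on `L²(0,∞)^N` has the continuous matrix-valued integral kernel `K`: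
`(T f)_j(x) = ∑_l ∫_0^∞ K_{jl}(x,y) f_l(y) dy` for almost every `x`, for all square-integrable `f`
that vanish outside a bounded set. (These `f` are dense, and the integrals converge absolutely.) -/
def HasIntegralKernel {N : ℕ} (T : HilbertSpace N →L[ℂ] HilbertSpace N)
    (K : ℝ → ℝ → Matrix (Fin N) (Fin N) ℂ) : Prop :=
  ∀ (f : HilbertSpace N) (R : ℝ),
    (∀ l, ∀ᵐ y ∂(volume.restrict (Ioi (0 : ℝ))), R < y → (f l : ℝ → ℂ) y = 0) →
    ∀ j, ∀ᵐ x ∂(volume.restrict (Ioi (0 : ℝ))),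
      (T f j : ℝ → ℂ) x = ∑ l, ∫ y in Ioi (0 : ℝ), K x y j l * (f l : ℝ → ℂ) y

/-- `σ`, with entries `σ ω x y j l`, is the spectral density of `H`, the Laplacian with the
boundary condition `bc`: it is continuous, and for every `Λ ≥ 0` the spectral projection `P([0,Λ])`
of `H` has the integral kernel `∫_0^{√Λ} σ(ω,x,y) dω`. -/
structure IsSpectralDensity (N : ℕ) (bc : VertexCondition)
    (σ : ℝ → ℝ → ℝ → Matrix (Fin N) (Fin N) ℂ) : Prop where
  continuousOn : ∀ j l, ContinuousOn (fun p : ℝ × ℝ × ℝ => σ p.1 p.2.1 p.2.2 j l)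
    (Ici 0 ×ˢ Ici 0 ×ˢ Ici 0)
  kernel : ∃ P : ProjValuedMeasure (HilbertSpace N), P.IsSpectralResolution (laplacian N bc) ∧
    ∀ Λ : ℝ, 0 ≤ Λ → HasIntegralKernel (P.proj (Icc 0 Λ))
      (fun x y => Matrix.of fun j l => ∫ ω in (0 : ℝ)..√Λ, σ ω x y j l)

end StarGraph

end

noncomputable section

open scoped FourierTransform ENNReal

local notation "μ₊" => volume.restrict (Ioi (0 : ℝ))
local notation "ℋ" => Lp ℂ 2 (volume.restrict (Ioi (0 : ℝ)))

namespace StarGraph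

/-! ### Plancherel's theorem for integrable square-integrable functions -/

/-! Split `L²(0,∞)^N` orthogonally into the functions that are equal on all edges and the functions
whose mean over the edges vanishes. The vertex condition decouples: the mean-zero part sees the
Dirichlet condition, while the symmetric part sees a scalar condition on the half-line, namely
`u'(0) = a u(0)` with `a = α/N` (with `a = 0` for Kirchhoff) or Dirichlet. The sine transform
diagonalizes the Dirichlet half-line. The Robin half-line with `a ≥ 0` is diagonalized by the waves
`(ω cos ωx + a sin ωx)/√(ω² + a²)`, without a bound state. So `H` becomes multiplication by `ω²`,
its projection to `[0,Λ]` becomes the cut-off `ω ≤ √Λ`, and the density is `δ_jl D + (τ - D)/N`,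
where `D` is the Dirichlet density and `τ` that of the symmetric part. The diagonal formulas are
then trigonometry.

Unitarity. Plancherel on the line gives isometry of the cosine and sine transforms
(`IsFourierKernel.lintegral_kernelTransform`); being self-adjoint they are involutions. The adjoint
of the Robin transform is isometric because its cross term is the integral of a derivative
(`re_inner_cosT_sinT`). The Robin transform is injective because a vector in its kernel would be a
multiple of `exp (a x)`, which is not square-integrable (`eq_zero_of_robinT_eq_zero`).

Diagonalization. The graph of `H` is identified through `H + 1`: the pairs with transforms
`Z/(1+ω²)` and `ω²Z/(1+ω²)` lie in the graph (`IsAdapted.mem_laplacianGraph_of_res`), and there are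
no others because `-1` is not an eigenvalue (`eq_zero_of_neg_mem_laplacianGraph`).

Uniqueness. An arbitrary spectral density comes with its own projection-valued measure `P`, so
`P([0,Λ])` has to be determined by `H` alone. If `P` and `Q` both resolve `H` and `A`, `B` lie in
separated intervals, then `H` is close to different constants on the ranges of `P(A)` and `Q(B)`,
and comparing the two forces `P(A) Q(B) = 0` (`proj_mul_proj_eq_zero`). Exhausting the complement of
`[a,b]` by compact intervals gives `P([a,b]) = Q([a,b])` (`proj_Icc_eq`). A continuous kernel is
determined by its operator, and the density is recovered from its primitives in `ω`. -/

/-- Against a smooth compactly supported test function, both the `L²` transform and the integral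
transform can be moved onto the test function, the first by its compatibility with tempered
distributions, the second by Fubini. -/
theorem fourier_toLp_ae_eq {g : ℝ → ℂ} (h1 : Integrable g) (h2 : MemLp g 2) :
    ((𝓕 (h2.toLp g) : Lp ℂ 2 (volume : Measure ℝ)) : ℝ → ℂ) =ᵐ[volume] 𝓕 g := by
  have hc : Continuous (𝓕 g) :=
    VectorFourier.fourierIntegral_continuous Real.continuous_fourierChar
      (by exact continuous_inner) h1
  refine ae_eq_of_integral_contDiff_smul_eq
    ((Lp.memLp _).locallyIntegrable (by norm_num)) hc.locallyIntegrable ?_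
  intro φ hφ hφc
  have hg₁ : HasCompactSupport (Complex.ofRealCLM ∘ φ) := hφc.comp_left rfl
  have hg₂ : ContDiff ℝ (⊤ : ℕ∞) (Complex.ofRealCLM ∘ φ) := by fun_prop
  set Φ := hg₁.toSchwartzMap hg₂
  have e1 : ∀ x, Φ x = (φ x : ℂ) := fun x => by simp [Φ]
  have key := DFunLike.congr_fun (Lp.fourier_toTemperedDistribution_eq (h2.toLp g)) Φ
  simp only [TemperedDistribution.fourier_apply] at key
  rw [Lp.toTemperedDistribution_apply, Lp.toTemperedDistribution_apply] at key
  have e2 : ∫ x, φ x • ((𝓕 (h2.toLp g) : Lp ℂ 2 (volume : Measure ℝ)) : ℝ → ℂ) x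
      = ∫ x, Φ x • ((𝓕 (h2.toLp g) : Lp ℂ 2 (volume : Measure ℝ)) : ℝ → ℂ) x := by
    simp [e1]
  rw [e2, ← key]
  have e3 : ∫ x, (𝓕 Φ) x • (h2.toLp g : ℝ → ℂ) x = ∫ x, (𝓕 (Φ : ℝ → ℂ)) x • g x := by
    apply integral_congr_ae
    filter_upwards [h2.coeFn_toLp] with x hx
    rw [hx, SchwartzMap.fourier_coe]
  rw [e3]
  have := VectorFourier.integral_fourierIntegral_smul_eq_flip (L := innerₗ ℝ)
      Real.continuous_fourierChar continuous_inner (Φ.integrable (μ := volume)) h1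
  refine Eq.trans (by simpa using! this) ?_
  simp only [e1]
  rfl

theorem eLpNorm_fourier_eq {g : ℝ → ℂ} (h1 : Integrable g) (h2 : MemLp g 2) :
    eLpNorm (𝓕 g) 2 volume = eLpNorm g 2 volume := by
  rw [← eLpNorm_congr_ae (fourier_toLp_ae_eq h1 h2), ← eLpNorm_congr_ae h2.coeFn_toLp]
  have := Lp.norm_fourier_eq (h2.toLp g)
  rw [Lp.norm_def, Lp.norm_def] at this
  exact (ENNReal.toReal_eq_toReal_iff' (Lp.memLp _).2.ne (Lp.memLp _).2.ne).1 this

/-! ### Cosine and sine transforms -/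

/-- The integral transform on the half-line with the kernel `√(2/π) k(ωx)`. -/
def kernelTransform (k : ℝ → ℝ) (f : ℝ → ℂ) (ω : ℝ) : ℂ :=
  (√(2 / Real.pi) : ℝ) * ∫ x in Ioi (0 : ℝ), (k (ω * x) : ℂ) * f x

theorem lintegral_eq_two_mul_of_even {h : ℝ → ℝ≥0∞} (hh : ∀ x, h (-x) = h x) :
    ∫⁻ x, h x = 2 * ∫⁻ x in Ioi (0 : ℝ), h x := by
  have e : ∫⁻ x in Iio (0 : ℝ), h x = ∫⁻ x in Ioi (0 : ℝ), h x := by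
    have := (Measure.measurePreserving_neg (volume : Measure ℝ)).setLIntegral_comp_preimage_emb
      (MeasurableEquiv.neg ℝ).measurableEmbedding h (Iio 0)
    rw [← this]
    simp [hh]
  rw [← setLIntegral_univ, ← Iic_union_Ioi (a := (0 : ℝ)),
    lintegral_union measurableSet_Ioi (by simp), setLIntegral_congr Iio_ae_eq_Iic.symm, e, two_mul]

theorem lintegral_Ioi_comp_mul_left (h : ℝ → ℝ≥0∞) {b : ℝ} (hb : 0 < b) :
    ∫⁻ x in Ioi (0 : ℝ), h (b * x) = ENNReal.ofReal b⁻¹ * ∫⁻ x in Ioi (0 : ℝ), h x := by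
  have h1 := Real.smul_map_volume_mul_left hb.ne'
  have e : (volume : Measure ℝ).map (b * ·) = ENNReal.ofReal b⁻¹ • volume := by
    conv_rhs => rw [← h1]
    rw [smul_smul, abs_of_pos hb, ← ENNReal.ofReal_mul (by positivity), inv_mul_cancel₀ hb.ne']
    simp
  have hm := (Homeomorph.mulLeft₀ b hb.ne').measurableEmbedding
  have e3 : (⇑(Homeomorph.mulLeft₀ b hb.ne')) = (b * ·) := rfl
  rw [e3] at hm
  have e4 : (b * ·) ⁻¹' (Ioi (0 : ℝ)) = Ioi 0 := by
    ext x; simp [hb]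
  have h2 := hm.lintegral_map (μ := volume.restrict (Ioi 0)) h
  rw [← h2]
  nth_rewrite 1 [← e4]
  rw [← hm.restrict_map, e, Measure.restrict_smul, lintegral_smul_measure, smul_eq_mul]

theorem memLp_two_iff_lintegral {μ : Measure ℝ} {f : ℝ → ℂ} (hf : AEStronglyMeasurable f μ) :
    MemLp f 2 μ ↔ ∫⁻ x, ‖f x‖ₑ ^ 2 ∂μ < ⊤ := by
  have := eLpNorm_nnreal_pow_eq_lintegral (μ := μ) (f := f) (p := 2) (by norm_num)
  simp only [NNReal.coe_ofNat, ENNReal.coe_ofNat, ENNReal.rpow_ofNat] at this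
  rw [← this]
  constructor
  · intro h
    exact ENNReal.pow_lt_top h.2
  · intro h
    refine ⟨hf, ?_⟩
    by_contra hc
    simp only [not_lt, top_le_iff] at hc
    simp [hc] at h

theorem eLpNorm_sq_eq_lintegral (μ : Measure ℝ) (f : ℝ → ℂ) :
    eLpNorm f 2 μ ^ 2 = ∫⁻ x, ‖f x‖ₑ ^ 2 ∂μ := by
  have := eLpNorm_nnreal_pow_eq_lintegral (μ := μ) (f := f) (p := 2) (by norm_num)
  simpa only [NNReal.coe_ofNat, ENNReal.coe_ofNat, ENNReal.rpow_ofNat] using this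

/-- A kernel function that gives rise to an isometric integral transform of the half-line,
and that can be computed by a Fourier transform. -/
structure IsFourierKernel (k : ℝ → ℝ) : Prop where
  continuous : Continuous k
  abs_le_one : ∀ x, |k x| ≤ 1
  neg : ∃ δ : ℝ, |δ| = 1 ∧ ∀ x, k (-x) = δ * k x
  exp : ∃ ε c : ℂ, ‖ε‖ = 1 ∧ ‖c‖ = 2 ∧
    ∀ x : ℝ, Complex.exp (-(x * Complex.I)) + ε * Complex.exp (x * Complex.I) = c * k x

theorem isFourierKernel_cos : IsFourierKernel Real.cos where
  continuous := Real.continuous_cos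
  abs_le_one := Real.abs_cos_le_one
  neg := ⟨1, by simp⟩
  exp := ⟨1, 2, by simp, by simp, fun x => by
    rw [Complex.ofReal_cos, Complex.cos]
    ring_nf⟩

theorem isFourierKernel_sin : IsFourierKernel Real.sin where
  continuous := Real.continuous_sin
  abs_le_one := Real.abs_sin_le_one
  neg := ⟨-1, by simp⟩
  exp := ⟨-1, -2 * Complex.I, by simp, by simp, fun x => by
    rw [Complex.ofReal_sin, Complex.sin]
    ring_nf
    rw [Complex.I_sq]
    ring⟩

namespace IsFourierKernel

variable {k : ℝ → ℝ}

theorem integrable_mul (hk : IsFourierKernel k) {f : ℝ → ℂ} (hf : Integrable f μ₊) (ω : ℝ) :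
    Integrable (fun x => (k (ω * x) : ℂ) * f x) μ₊ := by
  refine hf.bdd_mul (c := 1) ?_ ?_
  · have := hk.continuous
    exact Continuous.aestronglyMeasurable (by fun_prop)
  · exact Eventually.of_forall fun x => by simpa using hk.abs_le_one _

theorem continuous_kernelTransform (hk : IsFourierKernel k) {f : ℝ → ℂ} (hf : Integrable f μ₊) :
    Continuous (kernelTransform k f) := by
  refine continuous_const.mul ?_
  refine continuous_of_dominated (bound := fun x => ‖f x‖) ?_ ?_ hf.norm ?_
  · exact fun ω => (hk.integrable_mul hf ω).aestronglyMeasurable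
  · intro ω
    refine Eventually.of_forall fun x => ?_
    rw [norm_mul]
    refine mul_le_of_le_one_left (norm_nonneg _) ?_
    simpa using hk.abs_le_one _
  · have := hk.continuous
    refine Eventually.of_forall fun x => ?_
    fun_prop

/-- Plancherel on the line for the extension `f₀ x + ε f₀ (-x)`, whose Fourier transform at `ξ` is
`c` times the integral of `f` against `k (2πξx)`. Both squared moduli are even, so the identity
halves to the half-line, and the substitution `ω = 2πξ` gives the normalization `√(2/π)`. -/
theorem lintegral_kernelTransform (hk : IsFourierKernel k) {f : ℝ → ℂ} (h1 : Integrable f μ₊) (h2 : MemLp f 2 μ₊) :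
    ∫⁻ ω, ‖kernelTransform k f ω‖ₑ ^ 2 ∂μ₊ = ∫⁻ x, ‖f x‖ₑ ^ 2 ∂μ₊ := by
  obtain ⟨ε, c, hε, hc, hexp⟩ := hk.exp
  set f₀ : ℝ → ℂ := (Ioi (0 : ℝ)).indicator f with hf₀
  have i1 : Integrable f₀ := (integrable_indicator_iff measurableSet_Ioi).2 h1
  have i2 : MemLp f₀ 2 := (memLp_indicator_iff_restrict measurableSet_Ioi).2 h2
  set g : ℝ → ℂ := fun x => f₀ x + ε * f₀ (-x) with hg
  have mp := Measure.measurePreserving_neg (volume : Measure ℝ)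
  have g1 : Integrable g := i1.add ((i1.comp_neg).const_mul ε)
  have g2 : MemLp g 2 := i2.add ((i2.comp_measurePreserving mp).const_mul ε)
  -- At every `x` at most one of `f₀ x` and `f₀ (-x)` is nonzero, so the norm is additive here.
  have gnorm : ∀ x, ‖g x‖ₑ = ‖f₀ x‖ₑ + ‖f₀ (-x)‖ₑ := by
    have hε' : ‖ε‖ₑ = 1 := by rw [← ofReal_norm, hε]; simp
    intro x
    simp only [hg, hf₀]
    by_cases hx : 0 < x
    · simp [indicator, hx, not_lt.2 hx.le]
    · simp only [indicator, mem_Ioi, hx, if_false, zero_add, enorm_mul, hε', one_mul, enorm_zero]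
  have gpl := congrArg (fun t => t ^ 2) (eLpNorm_fourier_eq g1 g2)
  simp only [eLpNorm_sq_eq_lintegral] at gpl
  have F : ∀ ξ, 𝓕 g ξ = c * ∫ x in Ioi (0 : ℝ), (k (2 * Real.pi * ξ * x) : ℂ) * f x := by
    intro ξ
    have b1 : Integrable (fun x : ℝ => Complex.exp (-(2 * Real.pi * ξ * x : ℝ) * Complex.I) * f₀ x) := by
      refine i1.bdd_mul (c := 1) (Continuous.aestronglyMeasurable (by fun_prop)) ?_
      refine Eventually.of_forall fun x => ?_
      rw [← Complex.ofReal_neg, Complex.norm_exp_ofReal_mul_I]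
    have b2 : Integrable (fun x : ℝ => Complex.exp ((2 * Real.pi * ξ * x : ℝ) * Complex.I) * f₀ x) := by
      refine i1.bdd_mul (c := 1) (Continuous.aestronglyMeasurable (by fun_prop)) ?_
      refine Eventually.of_forall fun x => ?_
      rw [Complex.norm_exp_ofReal_mul_I]
    have b3 : Integrable (fun x : ℝ => Complex.exp (-(2 * Real.pi * ξ * x : ℝ) * Complex.I) * f₀ (-x)) := by
      have := b2.comp_neg
      refine this.congr (Eventually.of_forall fun x => ?_)
      simp
    rw [Real.fourier_real_eq_integral_exp_smul]
    calc _ = ∫ x : ℝ, (Complex.exp (-(2 * Real.pi * ξ * x : ℝ) * Complex.I) * f₀ x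
          + ε * (Complex.exp (-(2 * Real.pi * ξ * x : ℝ) * Complex.I) * f₀ (-x))) := by
          congr 1; ext x; simp only [hg, smul_eq_mul]
          rw [show (((-2 * Real.pi * x * ξ : ℝ) : ℂ)) = -((2 * Real.pi * ξ * x : ℝ) : ℂ) by push_cast; ring]
          ring
      _ = (∫ x : ℝ, Complex.exp (-(2 * Real.pi * ξ * x : ℝ) * Complex.I) * f₀ x) + ε *
          ∫ x : ℝ, Complex.exp ((2 * Real.pi * ξ * x : ℝ) * Complex.I) * f₀ x := by
          rw [integral_add b1 (b3.const_mul ε), integral_const_mul]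
          congr 2
          rw [← integral_neg_eq_self (fun x : ℝ => Complex.exp (((2 * Real.pi * ξ * x : ℝ) : ℂ) * Complex.I) * f₀ x)]
          simp
      _ = ∫ x : ℝ, (Ioi (0:ℝ)).indicator (fun x => c * ((k (2 * Real.pi * ξ * x) : ℂ) * f x)) x := by
          rw [← integral_const_mul, ← integral_add b1 (b2.const_mul ε)]
          congr 1; ext x
          by_cases hx : x ∈ Ioi (0:ℝ)
          · simp only [hf₀, indicator_of_mem hx]
            have := hexp (2 * Real.pi * ξ * x)
            rw [← mul_assoc c, ← this, neg_mul]
            ring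
          · simp [hf₀, indicator_of_notMem hx]
      _ = _ := by
          rw [integral_indicator measurableSet_Ioi, integral_const_mul]
  have evenF : ∀ ξ, ‖𝓕 g (-ξ)‖ₑ ^ 2 = ‖𝓕 g ξ‖ₑ ^ 2 := by
    intro ξ
    obtain ⟨δ, hδ, hδk⟩ := hk.neg
    have hδ' : ‖(δ : ℂ)‖ₑ = 1 := by rw [← ofReal_norm, Complex.norm_real, Real.norm_eq_abs, hδ]; simp
    have e : 𝓕 g (-ξ) = δ * 𝓕 g ξ := by
      rw [F, F, mul_left_comm, ← integral_const_mul (δ : ℂ)]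
      refine congrArg (fun t : ℂ => c * t) (integral_congr_ae (Eventually.of_forall fun x => ?_))
      beta_reduce
      rw [show 2 * Real.pi * (-ξ) * x = -(2 * Real.pi * ξ * x) by ring, hδk]
      push_cast; ring
    rw [e, enorm_mul, hδ', one_mul]
  have eveng : ∀ x, ‖g (-x)‖ₑ ^ 2 = ‖g x‖ₑ ^ 2 := by
    intro x; rw [gnorm, gnorm, neg_neg, add_comm]
  rw [lintegral_eq_two_mul_of_even evenF, lintegral_eq_two_mul_of_even eveng] at gpl
  have gpl' := (ENNReal.mul_right_inj (by norm_num) (by norm_num)).1 gpl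
  have e1 : ∫⁻ x in Ioi (0 : ℝ), ‖g x‖ₑ ^ 2 = ∫⁻ x in Ioi (0 : ℝ), ‖f x‖ₑ ^ 2 := by
    refine setLIntegral_congr_fun measurableSet_Ioi fun x hx => ?_
    have hx' : (0 : ℝ) < x := hx
    simp only [gnorm, hf₀]
    simp [indicator, hx', not_lt.2 hx'.le]
  rw [← e1, ← gpl']
  -- The constants match because `‖c‖² = 4 = 2π · (2/π)`.
  have e2 : ∀ ξ, ‖𝓕 g ξ‖ₑ ^ 2 = ENNReal.ofReal (2 * Real.pi) *
      ‖kernelTransform k f (2 * Real.pi * ξ)‖ₑ ^ 2 := by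
    intro ξ
    rw [F, kernelTransform, enorm_mul, enorm_mul, mul_pow, mul_pow, ← mul_assoc]
    congr 1
    rw [← ofReal_norm, ← ofReal_norm, hc, Complex.norm_real, Real.norm_of_nonneg (Real.sqrt_nonneg _),
      ← ENNReal.ofReal_pow (by norm_num), ← ENNReal.ofReal_pow (Real.sqrt_nonneg _),
      ← ENNReal.ofReal_mul (by positivity), Real.sq_sqrt (by positivity)]
    congr 1
    field_simp
  simp only [e2]
  rw [lintegral_const_mul' _ _ ENNReal.ofReal_ne_top,
    lintegral_Ioi_comp_mul_left (fun ω => ‖kernelTransform k f ω‖ₑ ^ 2) (by positivity), ← mul_assoc,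
    ← ENNReal.ofReal_mul (by positivity), mul_inv_cancel₀ (by positivity)]
  simp

theorem memLp_kernelTransform (hk : IsFourierKernel k) {f : ℝ → ℂ} (h1 : Integrable f μ₊)
    (h2 : MemLp f 2 μ₊) : MemLp (kernelTransform k f) 2 μ₊ := by
  rw [memLp_two_iff_lintegral (hk.continuous_kernelTransform h1).aestronglyMeasurable,
    hk.lintegral_kernelTransform h1 h2]
  exact (memLp_two_iff_lintegral h2.1).1 h2

/-- The integrable elements of `L²(0,∞)`. -/
def _root_.StarGraph.integrableSubmodule : Submodule ℂ ℋ where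
  carrier := {f | Integrable (f : ℝ → ℂ) (volume.restrict (Ioi (0 : ℝ)))}
  add_mem' {f g} hf hg := (hf.add hg).congr (Lp.coeFn_add f g).symm
  zero_mem' := (integrable_zero ℝ ℂ μ₊).congr (Lp.coeFn_zero ℂ 2 μ₊).symm
  smul_mem' c f hf := (Integrable.smul (f := (f : ℝ → ℂ)) c hf).congr (Lp.coeFn_smul c f).symm

/-- Simple functions in `L²` have supports of finite measure, so they are integrable, and they are
already dense. -/
theorem _root_.StarGraph.denseRange_integrableSubmodule :
    DenseRange integrableSubmodule.subtype := by
  have h := Lp.simpleFunc.denseRange (E := ℂ) (p := 2) (μ := μ₊) (by norm_num)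
  refine h.mono ?_
  rintro _ ⟨f, rfl⟩
  refine ⟨⟨f, ?_⟩, rfl⟩
  have hi := (SimpleFunc.memLp_iff_integrable (by norm_num) (by norm_num)).1 (Lp.simpleFunc.memLp f)
  exact hi.congr (Lp.simpleFunc.toSimpleFunc_eq_toFun f)

/-- The integral transform on the integrable elements of `L²(0,∞)`. -/
def transformAux (hk : IsFourierKernel k) : integrableSubmodule →ₗ[ℂ] ℋ where
  toFun f := (hk.memLp_kernelTransform f.2 (Lp.memLp (f : ℋ))).toLp
  map_add' f g := by
    rw [← MemLp.toLp_add]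
    congr 1; ext ω
    simp only [kernelTransform, Pi.add_apply]
    rw [← mul_add, ← integral_add (hk.integrable_mul f.2 ω) (hk.integrable_mul g.2 ω)]
    congr 1
    refine integral_congr_ae ?_
    filter_upwards [Lp.coeFn_add (f : ℋ) (g : ℋ)] with x hx
    rw [Submodule.coe_add, hx, Pi.add_apply, mul_add]
  map_smul' c f := by
    rw [RingHom.id_apply, ← MemLp.toLp_const_smul]
    congr 1; ext ω
    simp only [kernelTransform, Pi.smul_apply, smul_eq_mul]
    rw [mul_left_comm, ← integral_const_mul c]
    congr 1
    refine integral_congr_ae ?_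
    filter_upwards [Lp.coeFn_smul c (f : ℋ)] with x hx
    rw [Submodule.coe_smul, hx, Pi.smul_apply, smul_eq_mul, mul_left_comm]

theorem norm_transformAux (hk : IsFourierKernel k) (f : integrableSubmodule) :
    ‖hk.transformAux f‖ = ‖integrableSubmodule.subtype f‖ := by
  have h := hk.lintegral_kernelTransform f.2 (Lp.memLp (f : ℋ))
  rw [← eLpNorm_sq_eq_lintegral, ← eLpNorm_sq_eq_lintegral] at h
  have h' := (ENNReal.pow_right_strictMono two_ne_zero).injective h
  simp only [transformAux, LinearMap.coe_mk, AddHom.coe_mk, Lp.norm_toLp, h',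
    Submodule.subtype_apply]
  rfl

/-- The integral transform with the kernel `√(2/π) k(ωx)`, as an operator on `L²(0,∞)`. -/
def transform (hk : IsFourierKernel k) : ℋ →L[ℂ] ℋ :=
  hk.transformAux.extendOfNorm integrableSubmodule.subtype

theorem transform_coe (hk : IsFourierKernel k) (f : integrableSubmodule) :
    hk.transform f = hk.transformAux f :=
  LinearMap.extendOfNorm_eq denseRange_integrableSubmodule
    ⟨1, fun x => by rw [one_mul, hk.norm_transformAux]⟩ f

theorem transform_ae_eq (hk : IsFourierKernel k) {f : ℋ} (hf : Integrable (f : ℝ → ℂ) μ₊) :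
    (hk.transform f : ℝ → ℂ) =ᵐ[μ₊] kernelTransform k f := by
  have := hk.transform_coe ⟨f, hf⟩
  simp only at this
  rw [this]
  exact (hk.memLp_kernelTransform hf (Lp.memLp f)).coeFn_toLp

theorem norm_transform (hk : IsFourierKernel k) (f : ℋ) : ‖hk.transform f‖ = ‖f‖ := by
  refine denseRange_integrableSubmodule.induction_on (p := fun f => ‖hk.transform f‖ = ‖f‖) f
    (isClosed_eq (by fun_prop) (by fun_prop)) fun f => ?_
  simp only [Submodule.subtype_apply]
  rw [hk.transform_coe, hk.norm_transformAux]
  rfl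

/-- Fubini for the symmetric kernel `k (ω * x)`. As `k` is real, conjugating one factor turns this
into self-adjointness of the transform. -/
theorem integral_kernelTransform_mul (hk : IsFourierKernel k) {f g : ℝ → ℂ}
    (hf : Integrable f μ₊) (hg : Integrable g μ₊) :
    ∫ ω in Ioi (0 : ℝ), kernelTransform k f ω * g ω
      = ∫ x in Ioi (0 : ℝ), f x * kernelTransform k g x := by
  simp only [kernelTransform, mul_assoc]
  have hi : Integrable (fun p : ℝ × ℝ => (k (p.1 * p.2) : ℂ) * (g p.1 * f p.2)) (μ₊.prod μ₊) := by
    refine (hg.mul_prod hf).bdd_mul (c := 1) ?_ ?_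
    · have := hk.continuous
      exact Continuous.aestronglyMeasurable (by fun_prop)
    · exact Eventually.of_forall fun x => by simpa using hk.abs_le_one _
  have e := integral_integral_swap (f := fun ω x : ℝ => (k (ω * x) : ℂ) * (g ω * f x)) hi
  simp only [mul_left_comm _ ((√(2 / Real.pi) : ℝ) : ℂ), integral_const_mul]
  congr 1
  calc _ = ∫ ω in Ioi (0 : ℝ), ∫ x in Ioi (0 : ℝ), (k (ω * x) : ℂ) * (g ω * f x) := by
        congr 1; ext ω
        rw [← integral_mul_const]
        congr 1; ext x; ring
    _ = _ := by
        rw [e]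
        congr 1; ext x
        rw [← integral_const_mul]
        congr 1; ext ω
        rw [mul_comm x ω]; ring

theorem kernelTransform_star (f : ℝ → ℂ) (ω : ℝ) :
    kernelTransform k (fun x => star (f x)) ω = star (kernelTransform k f ω) := by
  simp only [kernelTransform, star_mul', RCLike.star_def, Complex.conj_ofReal, ← integral_conj,
    map_mul]

theorem inner_transform_left (hk : IsFourierKernel k) (f g : ℋ) :
    inner ℂ (hk.transform f) g = inner ℂ f (hk.transform g) := by
  refine denseRange_integrableSubmodule.induction_on₂
    (p := fun f g => inner ℂ (hk.transform f) g = inner ℂ f (hk.transform g))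
    (isClosed_eq (by fun_prop) (by fun_prop)) (fun f g => ?_) f g
  simp only [Submodule.subtype_apply, L2.inner_def, RCLike.inner_apply]
  have e1 := hk.transform_ae_eq f.2
  have e2 := hk.transform_ae_eq g.2
  have hf : Integrable (fun x => star ((f : ℋ) x)) μ₊ :=
    Complex.conjLIE.toContinuousLinearEquiv.toContinuousLinearMap.integrable_comp f.2
  have := hk.integral_kernelTransform_mul hf g.2
  calc _ = ∫ ω in Ioi (0 : ℝ), kernelTransform k (fun x => star ((f : ℋ) x)) ω * (g : ℋ) ω := by
        refine integral_congr_ae ?_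
        filter_upwards [e1] with ω h
        rw [h, kernelTransform_star, mul_comm]
        rfl
    _ = _ := by
        rw [this]
        refine integral_congr_ae ?_
        filter_upwards [e2] with ω h
        rw [h, mul_comm]
        rfl

theorem adjoint_transform (hk : IsFourierKernel k) :
    ContinuousLinearMap.adjoint hk.transform = hk.transform :=
  ((ContinuousLinearMap.eq_adjoint_iff _ _).2 fun f g => hk.inner_transform_left f g).symm

/-- An isometry `T` satisfies `T* T = 1`, and here `T* = T`. -/
theorem transform_mul_transform (hk : IsFourierKernel k) :
    hk.transform * hk.transform = 1 := by
  have := (ContinuousLinearMap.norm_map_iff_adjoint_comp_self hk.transform).1 hk.norm_transform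
  rwa [hk.adjoint_transform] at this

theorem transform_transform (hk : IsFourierKernel k) (f : ℋ) :
    hk.transform (hk.transform f) = f :=
  congrArg (fun T : ℋ →L[ℂ] ℋ => T f) hk.transform_mul_transform

end IsFourierKernel
/-- The cosine transform of `L²(0,∞)`. -/
abbrev cosT : ℋ →L[ℂ] ℋ := isFourierKernel_cos.transform

/-- The sine transform of `L²(0,∞)`. -/
abbrev sinT : ℋ →L[ℂ] ℋ := isFourierKernel_sin.transform

/-! ### Multiplication operators -/

/-- The functions that give rise to bounded multiplication operators. -/
def IsMultiplier (m : ℝ → ℝ) : Prop := Measurable m ∧ ∃ C, ∀ x, |m x| ≤ C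

namespace IsMultiplier

variable {m : ℝ → ℝ}

theorem memLp (hm : IsMultiplier m) (f : ℋ) :
    MemLp (fun x => (m x : ℂ) * (f : ℝ → ℂ) x) 2 μ₊ := by
  obtain ⟨hm, C, hC⟩ := hm
  refine MemLp.of_le_mul (c := C) (Lp.memLp f) ?_ (Eventually.of_forall fun x => ?_)
  · exact (Complex.measurable_ofReal.comp hm).aestronglyMeasurable.mul (Lp.aestronglyMeasurable f)
  · rw [norm_mul, Complex.norm_real]
    exact mul_le_mul_of_nonneg_right (hC x) (norm_nonneg _)

/-- Multiplication by `m`, as an operator on `L²(0,∞)`. -/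
def mulOp (hm : IsMultiplier m) : ℋ →L[ℂ] ℋ :=
  LinearMap.mkContinuous
    { toFun := fun f => (hm.memLp f).toLp
      map_add' := fun f g => by
        rw [← MemLp.toLp_add]
        refine MemLp.toLp_congr _ _ ?_
        filter_upwards [Lp.coeFn_add f g] with x hx
        rw [hx, Pi.add_apply, Pi.add_apply, mul_add]
      map_smul' := fun c f => by
        rw [RingHom.id_apply, ← MemLp.toLp_const_smul]
        refine MemLp.toLp_congr _ _ ?_
        filter_upwards [Lp.coeFn_smul c f] with x hx
        rw [hx, Pi.smul_apply, Pi.smul_apply, smul_eq_mul, smul_eq_mul, mul_left_comm] }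
    hm.2.choose fun f => by
      refine Lp.norm_le_mul_norm_of_ae_le_mul ?_
      filter_upwards [(hm.memLp f).coeFn_toLp] with x hx
      simp only [LinearMap.coe_mk, AddHom.coe_mk]
      rw [hx, norm_mul, Complex.norm_real]
      exact mul_le_mul_of_nonneg_right (hm.2.choose_spec x) (norm_nonneg _)

theorem coeFn_mulOp (hm : IsMultiplier m) (f : ℋ) :
    (hm.mulOp f : ℝ → ℂ) =ᵐ[μ₊] fun x => (m x : ℂ) * (f : ℝ → ℂ) x :=
  (hm.memLp f).coeFn_toLp

theorem mulOp_eq_iff (hm : IsMultiplier m) {f g : ℋ} :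
    hm.mulOp f = g ↔ (g : ℝ → ℂ) =ᵐ[μ₊] fun x => (m x : ℂ) * (f : ℝ → ℂ) x := by
  constructor
  · rintro rfl
    exact hm.coeFn_mulOp f
  · intro h
    exact Lp.ext ((hm.coeFn_mulOp f).trans h.symm)

theorem adjoint_mulOp (hm : IsMultiplier m) :
    ContinuousLinearMap.adjoint hm.mulOp = hm.mulOp := by
  refine ((ContinuousLinearMap.eq_adjoint_iff _ _).2 fun f g => ?_).symm
  rw [L2.inner_def, L2.inner_def]
  refine integral_congr_ae ?_
  filter_upwards [hm.coeFn_mulOp f, hm.coeFn_mulOp g] with x h1 h2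
  rw [h1, h2, RCLike.inner_apply, RCLike.inner_apply]
  simp only [map_mul, Complex.conj_ofReal]
  ring

end IsMultiplier

/-! ### Primitives of cosine and sine transforms -/

theorem setIntegral_Ioi_eq_of_Ioc (f : ℝ → ℂ) {x : ℝ} (hx : 0 ≤ x) :
    ∫ t in Ioc 0 x, f t ∂μ₊ = ∫ t in (0 : ℝ)..x, f t := by
  rw [intervalIntegral.integral_of_le hx, Measure.restrict_restrict measurableSet_Ioc,
    inter_eq_left.2 Ioc_subset_Ioi_self]

theorem measure_Ioc_ne_top (x : ℝ) : μ₊ (Ioc 0 x) ≠ ⊤ :=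
  (measure_Ioc_lt_top (μ := μ₊)).ne

/-- The indicator function of `(0,x]`. -/
def box (x : ℝ) : ℋ := indicatorConstLp 2 measurableSet_Ioc (measure_Ioc_ne_top x) (1 : ℂ)

theorem coeFn_box (x : ℝ) : (box x : ℝ → ℂ) =ᵐ[μ₊] (Ioc 0 x).indicator fun _ => (1 : ℂ) :=
  indicatorConstLp_coeFn

theorem integrable_box (x : ℝ) : Integrable (box x : ℝ → ℂ) μ₊ :=
  integrable_indicatorConstLp measurableSet_Ioc (measure_Ioc_ne_top x) 1

theorem kernelTransform_box (k : ℝ → ℝ) (ω : ℝ) {x : ℝ} (hx : 0 ≤ x) :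
    kernelTransform k (box x) ω = ((√(2 / Real.pi) * ∫ t in (0 : ℝ)..x, k (ω * t) : ℝ) : ℂ) := by
  rw [kernelTransform, Complex.ofReal_mul]
  congr 1
  rw [← intervalIntegral.integral_ofReal, ← setIntegral_Ioi_eq_of_Ioc _ hx,
    ← integral_indicator measurableSet_Ioc]
  refine integral_congr_ae ?_
  filter_upwards [coeFn_box x] with t ht
  rw [ht]
  by_cases h : t ∈ Ioc 0 x <;> simp [h]

/-- A primitive is an inner product with `box x`, and self-adjointness moves the transform onto the
box, where it is an explicit integral. Thus `G` need not be integrable. -/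
theorem IsFourierKernel.integral_transform {k : ℝ → ℝ} (hk : IsFourierKernel k) (G : ℋ) {x : ℝ}
    (hx : 0 ≤ x) :
    ∫ t in (0 : ℝ)..x, (hk.transform G : ℝ → ℂ) t = √(2 / Real.pi) *
      ∫ ω in Ioi (0 : ℝ), ((∫ t in (0 : ℝ)..x, k (ω * t) : ℝ) : ℂ) * (G : ℝ → ℂ) ω := by
  rw [← setIntegral_Ioi_eq_of_Ioc _ hx,
    ← L2.inner_indicatorConstLp_one (𝕜 := ℂ) measurableSet_Ioc (measure_Ioc_ne_top x)]
  change inner ℂ (box x) (hk.transform G) = _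
  rw [← hk.inner_transform_left, L2.inner_def, ← integral_const_mul]
  refine integral_congr_ae ?_
  filter_upwards [hk.transform_ae_eq (integrable_box x)] with ω hω
  rw [hω, kernelTransform_box k ω hx, RCLike.inner_apply, Complex.conj_ofReal]
  push_cast
  ring

/-- The primitive `sin (ωx) / ω` of the kernel cancels the factor `ω` in `v`. This integrated form
of differentiation is available even when `v` is merely square-integrable. -/
theorem integral_cosT {u v : ℋ} (huv : (v : ℝ → ℂ) =ᵐ[μ₊] fun ω => (ω : ℂ) * (u : ℝ → ℂ) ω)
    {x : ℝ} (hx : 0 ≤ x) :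
    ∫ t in (0 : ℝ)..x, (cosT v : ℝ → ℂ) t = kernelTransform Real.sin u x := by
  rw [cosT, isFourierKernel_cos.integral_transform v hx, kernelTransform]
  congr 1
  refine integral_congr_ae ?_
  filter_upwards [huv, ae_restrict_mem measurableSet_Ioi] with ω hω hω0
  have h0 : ω ≠ 0 := ne_of_gt hω0
  have h0' : (ω : ℂ) ≠ 0 := by exact_mod_cast h0
  rw [hω, intervalIntegral.integral_comp_mul_left (fun t => Real.cos t) h0, integral_cos]
  simp only [mul_zero, Real.sin_zero, sub_zero, smul_eq_mul, mul_comm x ω]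
  push_cast
  field_simp

/-- Cauchy–Schwarz with the weight `1 + ω²`, in the pointwise form `n ≤ (1 + ω²) n² + (1 + ω²)⁻¹`.
-/
theorem integrable_of_mul_self {u v : ℋ}
    (huv : (v : ℝ → ℂ) =ᵐ[μ₊] fun ω => (ω : ℂ) * (u : ℝ → ℂ) ω) : Integrable (u : ℝ → ℂ) μ₊ := by
  have h1 := (memLp_two_iff_integrable_sq_norm (Lp.aestronglyMeasurable u)).1 (Lp.memLp u)
  have h2 := (memLp_two_iff_integrable_sq_norm (Lp.aestronglyMeasurable v)).1 (Lp.memLp v)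
  have h3 : Integrable (fun x : ℝ => (1 + x ^ 2)⁻¹) μ₊ := integrable_inv_one_add_sq.restrict
  refine ((h1.add h2).add h3).mono' (Lp.aestronglyMeasurable u) ?_
  filter_upwards [huv] with ω hω
  have hp : 0 < 1 + ω ^ 2 := by positivity
  simp only [Pi.add_apply, hω, norm_mul, Complex.norm_real, Real.norm_eq_abs, mul_pow, sq_abs]
  set n := ‖(u : ℝ → ℂ) ω‖
  have hn : 0 ≤ n := norm_nonneg _
  -- Completing the square in `n` uses up `1/4` of the term `(1 + ω²)⁻¹` and leaves `3/4` of it.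
  have e : n ^ 2 + ω ^ 2 * n ^ 2 + (1 + ω ^ 2)⁻¹ - n
      = ((1 + ω ^ 2) * n - 1 / 2) ^ 2 / (1 + ω ^ 2) + 3 / 4 * (1 + ω ^ 2)⁻¹ := by
    field_simp
    ring
  have : 0 ≤ ((1 + ω ^ 2) * n - 1 / 2) ^ 2 / (1 + ω ^ 2) + 3 / 4 * (1 + ω ^ 2)⁻¹ := by positivity
  linarith

theorem integral_sinT {u v : ℋ} (huv : (v : ℝ → ℂ) =ᵐ[μ₊] fun ω => (ω : ℂ) * (u : ℝ → ℂ) ω)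
    {x : ℝ} (hx : 0 ≤ x) :
    ∫ t in (0 : ℝ)..x, (sinT v : ℝ → ℂ) t =
      kernelTransform Real.cos u 0 - kernelTransform Real.cos u x := by
  have hu := integrable_of_mul_self huv
  rw [sinT, isFourierKernel_sin.integral_transform v hx, kernelTransform, kernelTransform,
    ← mul_sub, ← integral_sub (isFourierKernel_cos.integrable_mul hu _)
      (isFourierKernel_cos.integrable_mul hu _)]
  congr 1
  refine integral_congr_ae ?_
  filter_upwards [huv, ae_restrict_mem measurableSet_Ioi] with ω hω hω0
  have h0 : ω ≠ 0 := ne_of_gt hω0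
  have h0' : (ω : ℂ) ≠ 0 := by exact_mod_cast h0
  rw [hω, intervalIntegral.integral_comp_mul_left (fun t => Real.sin t) h0, integral_sin]
  simp only [mul_zero, zero_mul, Real.cos_zero, smul_eq_mul, mul_comm x ω]
  push_cast
  field_simp

/-- Differentiation under the integral with majorant `‖v‖`. The factor `s` carries the sign by which
`cos' = -sin` differs from `sin' = cos`. -/
theorem hasDerivAt_kernelTransform {k k' : ℝ → ℝ} (hk : IsFourierKernel k) (hk' : IsFourierKernel k')
    {s : ℝ} (hs : |s| ≤ 1) (hd : ∀ x, HasDerivAt k (s * k' x) x) {u v : ℝ → ℂ}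
    (hu : Integrable u μ₊) (hv : Integrable v μ₊) (huv : v =ᵐ[μ₊] fun ω => (ω : ℂ) * u ω) (x : ℝ) :
    HasDerivAt (kernelTransform k u) (s * kernelTransform k' v x) x := by
  have h := hasDerivAt_integral_of_dominated_loc_of_deriv_le (μ := μ₊)
    (F := fun x ω => (k (x * ω) : ℂ) * u ω)
    (F' := fun x ω => (s * k' (x * ω) : ℝ) * ((ω : ℂ) * u ω)) (x₀ := x) (s := univ)
    (bound := fun ω => ‖v ω‖) univ_mem
    (Eventually.of_forall fun y => (hk.integrable_mul hu y).aestronglyMeasurable)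
    (hk.integrable_mul hu x)
    ?_ ?_ hv.norm ?_
  · have h2 := h.2.const_mul ((√(2 / Real.pi) : ℝ) : ℂ)
    refine h2.congr_deriv ?_
    rw [kernelTransform, mul_left_comm, ← integral_const_mul (s : ℂ)]
    congr 1
    refine integral_congr_ae ?_
    filter_upwards [huv] with ω hω
    rw [hω]
    push_cast
    ring
  · have e := (hk'.integrable_mul hv x).const_mul (s : ℂ)
    refine (e.congr ?_).aestronglyMeasurable
    filter_upwards [huv] with ω hω
    rw [hω]
    push_cast
    ring
  · filter_upwards [huv] with ω hω y _
    rw [← hω, norm_mul, Complex.norm_real, Real.norm_eq_abs, abs_mul]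
    exact mul_le_of_le_one_left (norm_nonneg _)
      (mul_le_one₀ hs (abs_nonneg _) (hk'.abs_le_one _))
  · refine Eventually.of_forall fun ω y _ => ?_
    have h1 : HasDerivAt (fun y : ℝ => k (y * ω)) (s * k' (y * ω) * ω) y := by
      exact ((hd (y * ω)).comp y ((hasDerivAt_id y).mul_const ω)).congr_deriv (by rw [one_mul])
    have h2 := (h1.ofReal_comp).mul_const (u ω)
    refine h2.congr_deriv ?_
    push_cast
    ring

theorem hasDerivAt_cosTransform {u v : ℝ → ℂ} (hu : Integrable u μ₊) (hv : Integrable v μ₊)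
    (huv : v =ᵐ[μ₊] fun ω => (ω : ℂ) * u ω) (x : ℝ) :
    HasDerivAt (kernelTransform Real.cos u) (-kernelTransform Real.sin v x) x := by
  have := hasDerivAt_kernelTransform isFourierKernel_cos isFourierKernel_sin (s := -1) (by simp)
    (fun x => by simpa using Real.hasDerivAt_cos x) hu hv huv x
  simpa using this

theorem hasDerivAt_sinTransform {u v : ℝ → ℂ} (hu : Integrable u μ₊) (hv : Integrable v μ₊)
    (huv : v =ᵐ[μ₊] fun ω => (ω : ℂ) * u ω) (x : ℝ) :
    HasDerivAt (kernelTransform Real.sin u) (kernelTransform Real.cos v x) x := by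
  have := hasDerivAt_kernelTransform isFourierKernel_sin isFourierKernel_cos (s := 1) (by simp)
    (fun x => by simpa using Real.hasDerivAt_sin x) hu hv huv x
  simpa using this

/-! ### Exponentials -/

theorem eq_mul_exp_of_hasDerivWithinAt {F : ℝ → ℂ} {a : ℝ}
    (hF : ∀ x, 0 ≤ x → HasDerivWithinAt F (a * F x) (Ici 0) x) {x : ℝ} (hx : 0 ≤ x) :
    F x = F 0 * Real.exp (a * x) := by
  have hd : ∀ y, 0 ≤ y → HasDerivWithinAt (fun t => F t * (Real.exp (-(a * t)) : ℝ)) 0 (Ici 0) y := by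
    intro y hy
    have h1 : HasDerivAt (fun t : ℝ => Real.exp (-(a * t))) (Real.exp (-(a * y)) * -(a * 1)) y :=
      (((hasDerivAt_id y).const_mul a).neg).exp
    refine ((hF y hy).mul h1.ofReal_comp.hasDerivWithinAt).congr_deriv ?_
    push_cast
    ring
  have h := constant_of_has_deriv_right_zero (a := 0) (b := x)
    (fun y hy => ((hd y hy.1).continuousWithinAt).mono Icc_subset_Ici_self)
    (fun y hy => (hd y hy.1).mono (Ici_subset_Ici.2 hy.1)) x ⟨hx, le_rfl⟩
  simp only [mul_zero, neg_zero, Real.exp_zero, Complex.ofReal_one, mul_one] at h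
  rw [← h, mul_assoc, ← Complex.ofReal_mul, ← Real.exp_add]
  simp

/-- On the half-line `exp (a x) ≥ 1`, so the constant `A` would be square-integrable on a set of
infinite measure. For the Robin condition, this is where `a ≥ 0` rules out a bound state. -/
theorem eq_zero_of_memLp_mul_exp {A : ℂ} {a : ℝ} (ha : 0 ≤ a)
    (h : MemLp (fun x : ℝ => A * Real.exp (a * x)) 2 μ₊) : A = 0 := by
  have h1 : MemLp (fun _ : ℝ => A) 2 μ₊ := by
    refine h.mono aestronglyMeasurable_const ?_
    filter_upwards [ae_restrict_mem measurableSet_Ioi] with x hx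
    have hx' : (0 : ℝ) < x := hx
    rw [norm_mul, Complex.norm_real, Real.norm_of_nonneg (Real.exp_pos _).le]
    exact le_mul_of_one_le_right (norm_nonneg _) (Real.one_le_exp (by positivity))
  simpa [memLp_const_iff] using h1

/-! ### The transform for the Robin condition -/

theorem abs_div_sqrt_le {t r : ℝ} (h : t ^ 2 ≤ r) : |t / √r| ≤ 1 := by
  rw [abs_div, abs_of_nonneg (Real.sqrt_nonneg r)]
  exact div_le_one_of_le₀ (Real.abs_le_sqrt h) (Real.sqrt_nonneg r)

theorem isMultiplier_robinCos (a : ℝ) : IsMultiplier fun ω => ω / √(ω ^ 2 + a ^ 2) :=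
  ⟨by fun_prop, 1, fun ω => abs_div_sqrt_le (by nlinarith [sq_nonneg a])⟩

theorem isMultiplier_robinSin (a : ℝ) : IsMultiplier fun ω => a / √(ω ^ 2 + a ^ 2) :=
  ⟨by fun_prop, 1, fun ω => abs_div_sqrt_le (by nlinarith [sq_nonneg ω])⟩

/-- Expansion in the functions `(ω cos(ωx) + a sin(ωx)) / √(ω² + a²)`. -/
def robinT (a : ℝ) : ℋ →L[ℂ] ℋ :=
  (isMultiplier_robinCos a).mulOp * cosT + (isMultiplier_robinSin a).mulOp * sinT

theorem adjoint_robinT (a : ℝ) : ContinuousLinearMap.adjoint (robinT a) =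
    cosT * (isMultiplier_robinCos a).mulOp + sinT * (isMultiplier_robinSin a).mulOp := by
  simp only [← ContinuousLinearMap.star_eq_adjoint, robinT, star_add, star_mul]
  simp only [ContinuousLinearMap.star_eq_adjoint, IsMultiplier.adjoint_mulOp,
    IsFourierKernel.adjoint_transform]

theorem isMultiplier_resolvent : IsMultiplier fun ω => (1 + ω ^ 2)⁻¹ :=
  ⟨by fun_prop, 1, fun ω => by
    rw [abs_of_nonneg (by positivity)]
    exact inv_le_one_of_one_le₀ (by nlinarith [sq_nonneg ω])⟩

theorem isMultiplier_id_mul_resolvent : IsMultiplier fun ω => ω * (1 + ω ^ 2)⁻¹ :=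
  ⟨by fun_prop, 1, fun ω => by
    rw [abs_mul, abs_of_nonneg (a := (1 + ω ^ 2)⁻¹) (by positivity), ← div_eq_mul_inv]
    refine div_le_one_of_le₀ (abs_le.2 ⟨?_, ?_⟩) (by positivity) <;> nlinarith [sq_nonneg (ω - 1), sq_nonneg (ω + 1)]⟩

/-- The operator is self-adjoint, so the orthogonal complement of its range is its kernel, which is
trivial because the multiplier never vanishes. -/
theorem denseRange_resolvent : DenseRange isMultiplier_resolvent.mulOp := by
  have h : (LinearMap.range isMultiplier_resolvent.mulOp.toLinearMap).topologicalClosure = ⊤ := by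
    rw [Submodule.topologicalClosure_eq_top_iff]
    have := ContinuousLinearMap.orthogonal_range isMultiplier_resolvent.mulOp
    rw [this, IsMultiplier.adjoint_mulOp, LinearMap.ker_eq_bot']
    intro f hf
    rw [ContinuousLinearMap.coe_coe, IsMultiplier.mulOp_eq_iff] at hf
    refine Lp.ext ?_
    filter_upwards [hf, Lp.coeFn_zero ℂ 2 μ₊] with x h1 h2
    rw [h2] at h1 ⊢
    have h3 : (((1 + x ^ 2)⁻¹ : ℝ) : ℂ) ≠ 0 := by
      exact_mod_cast (by positivity : (1 + x ^ 2)⁻¹ ≠ 0)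
    exact (mul_eq_zero.1 h1.symm).resolve_left h3
  rw [DenseRange, dense_iff_closure_eq]
  exact congrArg (fun S : Submodule ℂ ℋ => (S : Set ℋ)) h

/-- The integrand is half the derivative of `‖h‖²`, which vanishes at `0`, and at infinity because
it is integrable together with its derivative. -/
theorem integral_inner_deriv_eq_zero {h h' : ℝ → ℂ} (hd : ∀ x, HasDerivAt h (h' x) x)
    (h2 : MemLp h 2 μ₊) (h2' : MemLp h' 2 μ₊) (h0 : h 0 = 0) :
    ∫ x in Ioi (0 : ℝ), inner ℝ (h x) (h' x) = 0 := by
  have hφ : ∀ x, HasDerivAt (fun x => ‖h x‖ ^ 2) (2 * inner ℝ (h x) (h' x)) x :=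
    fun x => (hd x).norm_sq
  have i1 : Integrable (fun x => ‖h x‖ ^ 2) μ₊ := (memLp_two_iff_integrable_sq_norm h2.1).1 h2
  have i2 : Integrable (fun x => 2 * inner ℝ (h x) (h' x)) μ₊ := by
    refine Integrable.const_mul ?_ 2
    have := (h2'.re.integrable_mul h2.re).add (h2'.im.integrable_mul h2.im)
    refine this.congr (Eventually.of_forall fun x => ?_)
    simp [Complex.inner, mul_comm]
  have ht := tendsto_zero_of_hasDerivAt_of_integrableOn_Ioi (a := 0) (fun x _ => hφ x) i2 i1
  have := integral_Ioi_of_hasDerivAt_of_tendsto' (a := 0) (fun x _ => hφ x) i2 ht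
  rw [integral_const_mul, h0] at this
  simpa using this

/-- The function `cosT v` is the derivative of `sinT u`, which vanishes at the vertex. The vector
`w` serves to make `v` integrable, so that this derivative is classical. -/
theorem re_inner_cosT_sinT_eq_zero {u v w : ℋ}
    (huv : (v : ℝ → ℂ) =ᵐ[μ₊] fun ω => (ω : ℂ) * (u : ℝ → ℂ) ω)
    (hvw : (w : ℝ → ℂ) =ᵐ[μ₊] fun ω => (ω : ℂ) * (v : ℝ → ℂ) ω) :
    (inner ℂ (cosT v) (sinT u)).re = 0 := by
  have iu := integrable_of_mul_self huv
  have iv := integrable_of_mul_self hvw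
  have key := integral_inner_deriv_eq_zero (fun x => hasDerivAt_sinTransform iu iv huv x)
    (isFourierKernel_sin.memLp_kernelTransform iu (Lp.memLp u))
    (isFourierKernel_cos.memLp_kernelTransform iv (Lp.memLp v)) (by simp [kernelTransform])
  rw [L2.inner_def, ← RCLike.re_eq_complex_re, ← integral_re (L2.integrable_inner _ _)]
  refine Eq.trans ?_ key
  refine integral_congr_ae ?_
  filter_upwards [isFourierKernel_cos.transform_ae_eq iv, isFourierKernel_sin.transform_ae_eq iu]
    with x h1 h2
  rw [h1, h2, Complex.inner, RCLike.inner_apply]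
  simp [mul_comm]

/-- The two multipliers are `ω` and `a` times one function, so up to the factor `a` this is the
pairing of a derivative with its primitive. Restricting to the dense range of `1/(1+ω²)` provides
the decay needed to differentiate. -/
theorem re_inner_cosT_sinT {a : ℝ} (ha : 0 < a) (G : ℋ) :
    (inner ℂ (cosT ((isMultiplier_robinCos a).mulOp G))
      (sinT ((isMultiplier_robinSin a).mulOp G))).re = 0 := by
  refine denseRange_resolvent.induction_on (p := fun G => (inner ℂ
    (cosT ((isMultiplier_robinCos a).mulOp G)) (sinT ((isMultiplier_robinSin a).mulOp G))).re = 0) G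
    (isClosed_eq (Complex.continuous_re.comp (by fun_prop)) continuous_const) fun g => ?_
  have hG := isMultiplier_resolvent.coeFn_mulOp g
  generalize isMultiplier_resolvent.mulOp g = G at hG
  have hs := (isMultiplier_robinSin a).coeFn_mulOp G
  generalize (isMultiplier_robinSin a).mulOp G = s at hs
  have hv := (isMultiplier_robinCos a).coeFn_mulOp G
  generalize (isMultiplier_robinCos a).mulOp G = v at hv
  -- Dividing by `a` leaves `u = G / √(ω² + a²)`, for which `v = ω u` exactly.
  have hu := Lp.coeFn_smul ((a⁻¹ : ℝ) : ℂ) s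
  have hsu : s = (a : ℂ) • (((a⁻¹ : ℝ) : ℂ) • s) := by
    simp only [smul_smul, ← Complex.ofReal_mul, mul_inv_cancel₀ ha.ne', Complex.ofReal_one,
      one_smul]
  generalize ((a⁻¹ : ℝ) : ℂ) • s = u at hu hsu
  rw [hsu, map_smul, inner_smul_right, Complex.re_ofReal_mul]
  refine mul_eq_zero_of_right _ ?_
  refine re_inner_cosT_sinT_eq_zero (u := u) (v := v)
    (w := isMultiplier_id_mul_resolvent.mulOp ((isMultiplier_robinCos a).mulOp g)) ?_ ?_
  · filter_upwards [hv, hs, hu] with ω h1 h2 h3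
    have : (a : ℂ) ≠ 0 := by exact_mod_cast ha.ne'
    rw [h3, Pi.smul_apply, h2, h1, smul_eq_mul]
    push_cast
    field_simp
  · filter_upwards [isMultiplier_id_mul_resolvent.coeFn_mulOp ((isMultiplier_robinCos a).mulOp g),
      hv, hG, (isMultiplier_robinCos a).coeFn_mulOp g] with ω h1 h2 h3 h4
    rw [h1, h2, h3, h4]
    push_cast
    ring

theorem norm_sq_eq_integral (f : ℋ) : ‖f‖ ^ 2 = ∫ x in Ioi (0 : ℝ), ‖(f : ℝ → ℂ) x‖ ^ 2 := by
  rw [← inner_self_eq_norm_sq (𝕜 := ℂ), L2.inner_def, ← integral_re (L2.integrable_inner _ _)]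
  congr 1; ext x
  rw [inner_self_eq_norm_sq]

theorem robinCos_sq_add_robinSin_sq (a : ℝ) {ω : ℝ} (hω : 0 < ω) :
    (ω / √(ω ^ 2 + a ^ 2)) ^ 2 + (a / √(ω ^ 2 + a ^ 2)) ^ 2 = 1 := by
  have : 0 < ω ^ 2 + a ^ 2 := by positivity
  rw [div_pow, div_pow, Real.sq_sqrt this.le]
  field_simp

/-- Without the cross term only the two diagonal terms remain, and the squares of the multipliers
add up to `1`. The case `a = 0` is separate because the cross term was treated by dividing by `a`.
-/
theorem norm_adjoint_robinT {a : ℝ} (ha : 0 ≤ a) (G : ℋ) :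
    ‖ContinuousLinearMap.adjoint (robinT a) G‖ = ‖G‖ := by
  have hre : (inner ℂ (cosT ((isMultiplier_robinCos a).mulOp G))
      (sinT ((isMultiplier_robinSin a).mulOp G))).re = 0 := by
    rcases ha.eq_or_lt with rfl | ha
    · have : (isMultiplier_robinSin 0).mulOp G = 0 := by
        rw [IsMultiplier.mulOp_eq_iff]
        filter_upwards [Lp.coeFn_zero ℂ 2 μ₊] with x h
        rw [h]; simp
      rw [this, map_zero, inner_zero_right, Complex.zero_re]
    · exact re_inner_cosT_sinT ha G
  rw [adjoint_robinT]
  change ‖cosT ((isMultiplier_robinCos a).mulOp G) + sinT ((isMultiplier_robinSin a).mulOp G)‖ = _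
  refine (pow_left_inj₀ (norm_nonneg _) (norm_nonneg _) two_ne_zero).1 ?_
  rw [norm_add_sq (𝕜 := ℂ), RCLike.re_eq_complex_re, hre, isFourierKernel_cos.norm_transform, isFourierKernel_sin.norm_transform,
    norm_sq_eq_integral, norm_sq_eq_integral, norm_sq_eq_integral, mul_zero, add_zero,
    ← integral_add]
  · refine integral_congr_ae ?_
    filter_upwards [(isMultiplier_robinCos a).coeFn_mulOp G,
      (isMultiplier_robinSin a).coeFn_mulOp G, ae_restrict_mem measurableSet_Ioi] with ω h1 h2 h3
    rw [h1, h2, norm_mul, norm_mul, Complex.norm_real, Complex.norm_real, mul_pow, mul_pow,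
      Real.norm_eq_abs, Real.norm_eq_abs, sq_abs, sq_abs, ← add_mul,
      robinCos_sq_add_robinSin_sq a h3, one_mul]
  · exact (memLp_two_iff_integrable_sq_norm (Lp.aestronglyMeasurable _)).1 (Lp.memLp _)
  · exact (memLp_two_iff_integrable_sq_norm (Lp.aestronglyMeasurable _)).1 (Lp.memLp _)

theorem robinT_mul_adjoint {a : ℝ} (ha : 0 ≤ a) :
    robinT a * ContinuousLinearMap.adjoint (robinT a) = 1 := by
  have := (ContinuousLinearMap.norm_map_iff_adjoint_comp_self _).1 (norm_adjoint_robinT ha)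
  rwa [ContinuousLinearMap.adjoint_adjoint] at this

/-- The equation says `ω (C f) = -a (S f)` for the cosine and sine transforms. Hence `f = C (C f)`
has derivative `-S (ω C f) = a S (S f) = a f`, so `f` is a multiple of `exp (a x)`, which is
square-integrable only if it vanishes. -/
theorem eq_zero_of_robinT_eq_zero {a : ℝ} (ha : 0 ≤ a) {f : ℋ} (hf : robinT a f = 0) : f = 0 := by
  set u := cosT f
  set v := (-(a : ℂ)) • sinT f
  have huv : (v : ℝ → ℂ) =ᵐ[μ₊] fun ω => (ω : ℂ) * (u : ℝ → ℂ) ω := by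
    change (isMultiplier_robinCos a).mulOp (cosT f) + (isMultiplier_robinSin a).mulOp (sinT f) = 0 at hf
    have h0 := Lp.coeFn_add ((isMultiplier_robinCos a).mulOp (cosT f))
      ((isMultiplier_robinSin a).mulOp (sinT f))
    rw [hf] at h0
    filter_upwards [h0, Lp.coeFn_zero ℂ 2 μ₊, (isMultiplier_robinCos a).coeFn_mulOp (cosT f),
      (isMultiplier_robinSin a).coeFn_mulOp (sinT f), Lp.coeFn_smul (-(a : ℂ)) (sinT f),
      ae_restrict_mem measurableSet_Ioi] with ω h1 h2 h3 h4 h5 h6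
    rw [h5]
    rw [h2, Pi.add_apply, h3, h4] at h1
    have h6' : (0 : ℝ) < ω := h6
    have h7 : √(ω ^ 2 + a ^ 2) ≠ 0 := by positivity
    have h8 : ((√(ω ^ 2 + a ^ 2) : ℝ) : ℂ) ≠ 0 := by exact_mod_cast h7
    rw [Pi.zero_apply] at h1
    push_cast at h1
    field_simp at h1
    rw [Pi.smul_apply, smul_eq_mul]
    linear_combination h1
  have iu := integrable_of_mul_self huv
  set F := kernelTransform Real.cos u with hF
  have hFc : Continuous F := isFourierKernel_cos.continuous_kernelTransform iu
  have hfF : (f : ℝ → ℂ) =ᵐ[μ₊] F := by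
    have h1 : cosT u = f := isFourierKernel_cos.transform_transform f
    rw [← h1]
    exact isFourierKernel_cos.transform_ae_eq iu
  have hsv : sinT v = (-(a : ℂ)) • f := by
    simp only [v, map_smul]
    rw [isFourierKernel_sin.transform_transform]
  -- The differential equation is first obtained in integrated form, since `v` need not be
  -- integrable; continuity of `F` then makes it classical.
  have hint : ∀ x, 0 ≤ x → F x = F 0 + a * ∫ t in (0 : ℝ)..x, F t := by
    intro x hx
    have h1 := integral_sinT huv hx
    have h2 : ∫ t in (0 : ℝ)..x, (sinT v : ℝ → ℂ) t = -(a : ℂ) * ∫ t in (0 : ℝ)..x, F t := by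
      rw [hsv, ← intervalIntegral.integral_const_mul, intervalIntegral.integral_of_le hx,
        intervalIntegral.integral_of_le hx]
      refine integral_congr_ae (ae_restrict_of_ae_restrict_of_subset Ioc_subset_Ioi_self ?_)
      filter_upwards [hfF, Lp.coeFn_smul (-(a : ℂ)) f] with t e1 e2
      rw [e2, Pi.smul_apply, e1, smul_eq_mul]
    rw [h2] at h1
    linear_combination h1
  have hexp : ∀ x, 0 ≤ x → F x = F 0 * Real.exp (a * x) := by
    intro x hx
    refine eq_mul_exp_of_hasDerivWithinAt (fun y hy => ?_) hx
    have h1 : HasDerivAt (fun x => F 0 + a * ∫ t in (0 : ℝ)..x, F t) (a * F y) y :=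
      ((intervalIntegral.integral_hasDerivAt_right (hFc.intervalIntegrable _ _)
        (hFc.stronglyMeasurableAtFilter _ _) hFc.continuousAt).const_mul (a : ℂ)).const_add _
    exact h1.hasDerivWithinAt.congr hint (hint y hy)
  have hfe : (f : ℝ → ℂ) =ᵐ[μ₊] fun x => F 0 * Real.exp (a * x) := by
    filter_upwards [hfF, ae_restrict_mem measurableSet_Ioi] with x e1 e2
    rw [e1, hexp x (le_of_lt e2)]
  have hF0 : F 0 = 0 := eq_zero_of_memLp_mul_exp ha ((memLp_congr_ae hfe).1 (Lp.memLp f))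
  refine Lp.ext ?_
  filter_upwards [hfe, Lp.coeFn_zero ℂ 2 μ₊] with x e1 e2
  rw [e1, e2, hF0]
  simp

/-- From `R R* = 1` one gets `R (R* R f - f) = 0`, and `R` is injective. -/
theorem adjoint_mul_robinT {a : ℝ} (ha : 0 ≤ a) :
    ContinuousLinearMap.adjoint (robinT a) * robinT a = 1 := by
  ext1 f
  have h : robinT a (ContinuousLinearMap.adjoint (robinT a) (robinT a f) - f) = 0 := by
    have := congrArg (fun T : ℋ →L[ℂ] ℋ => T (robinT a f)) (robinT_mul_adjoint ha)
    rw [map_sub, sub_eq_zero]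
    exact this
  exact sub_eq_zero.1 (eq_zero_of_robinT_eq_zero ha h)

/-! ### Permutation invariant operators on the star graph -/

/-- The average of a function over the edges. -/
def edgeMean (N : ℕ) : HilbertSpace N →L[ℂ] ℋ :=
  (N : ℂ)⁻¹ • ∑ l : Fin N, PiLp.proj (𝕜 := ℂ) 2 (fun _ : Fin N => ℋ) l

theorem edgeMean_apply {N : ℕ} (f : HilbertSpace N) : edgeMean N f = (N : ℂ)⁻¹ • ∑ l, f l := by
  simp [edgeMean]

/-- The operator that acts as `T` on the functions that are equal on all edges, and as `S` on
those with mean zero. -/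
def starOp (N : ℕ) (S T : ℋ →L[ℂ] ℋ) : HilbertSpace N →L[ℂ] HilbertSpace N :=
  (PiLp.continuousLinearEquiv 2 ℂ (fun _ : Fin N => ℋ)).symm.toContinuousLinearMap ∘L
    ContinuousLinearMap.pi fun j =>
      S ∘L PiLp.proj (𝕜 := ℂ) 2 (fun _ : Fin N => ℋ) j + (T - S) ∘L edgeMean N

theorem starOp_apply {N : ℕ} (S T : ℋ →L[ℂ] ℋ) (f : HilbertSpace N) (j : Fin N) :
    starOp N S T f j = S (f j) + (T (edgeMean N f) - S (edgeMean N f)) := rfl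

theorem starOp_one (N : ℕ) : starOp N 1 1 = 1 := by
  ext1 f; ext1 j
  rw [starOp_apply]
  simp

theorem starOp_self_apply {N : ℕ} (S : ℋ →L[ℂ] ℋ) (f : HilbertSpace N) (j : Fin N) :
    starOp N S S f j = S (f j) := by
  rw [starOp_apply, sub_self, add_zero]

theorem edgeMean_starOp {N : ℕ} (hN : 1 ≤ N) (S T : ℋ →L[ℂ] ℋ) (f : HilbertSpace N) :
    edgeMean N (starOp N S T f) = T (edgeMean N f) := by
  have hN' : (N : ℂ) ≠ 0 := by exact_mod_cast (by omega : N ≠ 0)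
  rw [edgeMean_apply (starOp N S T f)]
  simp only [starOp_apply, Finset.sum_add_distrib, Finset.sum_const, Finset.card_univ,
    Fintype.card_fin, smul_add, ← map_sum, ← map_smul]
  rw [← edgeMean_apply, ← Nat.cast_smul_eq_nsmul ℂ, smul_smul, inv_mul_cancel₀ hN', one_smul]
  abel

/-- Both the symmetric and the mean-zero functions are invariant, so such operators compose
separately on the two parts. -/
theorem starOp_mul {N : ℕ} (hN : 1 ≤ N) (S T S' T' : ℋ →L[ℂ] ℋ) :
    starOp N S T * starOp N S' T' = starOp N (S * S') (T * T') := by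
  ext1 f; ext1 j
  change starOp N S T (starOp N S' T' f) j = _
  rw [starOp_apply, edgeMean_starOp hN, starOp_apply, starOp_apply]
  simp only [map_add, map_sub]
  change _ = S (S' (f j)) + (T (T' (edgeMean N f)) - S (S' (edgeMean N f)))
  abel

/-- The symmetric and the mean-zero functions are orthogonal complements; in coordinates, the mixed
terms depend on `f` and `g` only through their means. -/
theorem adjoint_starOp {N : ℕ} (hN : 1 ≤ N) (S T : ℋ →L[ℂ] ℋ) :
    ContinuousLinearMap.adjoint (starOp N S T) =
      starOp N (ContinuousLinearMap.adjoint S) (ContinuousLinearMap.adjoint T) := by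
  have hN' : (N : ℂ) ≠ 0 := by exact_mod_cast (by omega : N ≠ 0)
  have hsum : ∀ f : HilbertSpace N, ∑ l, f l = (N : ℂ) • edgeMean N f := fun f => by
    rw [edgeMean_apply, smul_smul, mul_inv_cancel₀ hN', one_smul]
  refine ((ContinuousLinearMap.eq_adjoint_iff _ _).2 fun f g => ?_).symm
  simp only [PiLp.inner_apply, starOp_apply, inner_add_left, inner_add_right,
    Finset.sum_add_distrib, ← sum_inner, ← inner_sum, hsum, ContinuousLinearMap.adjoint_inner_left]
  congr 1
  simp only [inner_smul_left, inner_smul_right, inner_sub_left, inner_sub_right,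
    ContinuousLinearMap.adjoint_inner_left, map_natCast, mul_sub]

/-! ### Transforms adapted to the vertex condition -/

/-- The transform `c(ω) C + s(ω) S`, where `C` and `S` are the cosine and sine transforms. -/
def edgeTransform {c s : ℝ → ℝ} (hc : IsMultiplier c) (hs : IsMultiplier s) : ℋ →L[ℂ] ℋ :=
  hc.mulOp * cosT + hs.mulOp * sinT

theorem adjoint_edgeTransform {c s : ℝ → ℝ} (hc : IsMultiplier c) (hs : IsMultiplier s) :
    ContinuousLinearMap.adjoint (edgeTransform hc hs) = cosT * hc.mulOp + sinT * hs.mulOp := by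
  simp only [← ContinuousLinearMap.star_eq_adjoint, edgeTransform, star_add, star_mul]
  simp only [ContinuousLinearMap.star_eq_adjoint, IsMultiplier.adjoint_mulOp,
    IsFourierKernel.adjoint_transform]

/-- The functions `c` and `s` are such that `c(ω) cos(ωx) + s(ω) sin(ωx)` are the generalized
eigenfunctions of the vertex condition that are equal on all edges. -/
structure IsAdapted (N : ℕ) (bc : VertexCondition) (c s : ℝ → ℝ) : Prop where
  one_le : 1 ≤ N
  cos : IsMultiplier c
  sin : IsMultiplier s
  adjoint_mul : ContinuousLinearMap.adjoint (edgeTransform cos sin) * edgeTransform cos sin = 1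
  mul_adjoint : edgeTransform cos sin * ContinuousLinearMap.adjoint (edgeTransform cos sin) = 1
  -- The integrals are the vertex value and derivative of a superposition of symmetric waves with
  -- amplitude `g`. A mean-zero part has vertex value `0` and contributes only derivatives `d` with
  -- sum zero.
  holds : ∀ (g : ℝ → ℂ) (d : Fin N → ℂ), ∑ j, d j = 0 →
    bc.Holds (fun _ => ∫ ω in Ioi (0 : ℝ), c ω * g ω)
      (fun j => (∫ ω in Ioi (0 : ℝ), (ω * s ω : ℝ) * g ω) + d j)
  -- The data `(B, -B)` belong to the decaying solutions `B_j exp (-x)` of `u'' = u`, so this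
  -- excludes the eigenvalue `-1`.
  eq_zero_of_holds : ∀ B : Fin N → ℂ, bc.Holds B (-B) → B = 0

/-- For symmetric functions the condition reads `N u'(0) = α u(0)`, the Robin condition with
constant `α / N`. It holds wave by wave because `ω s(ω) = (α/N) c(ω)`. Allowing `α = 0` covers
Kirchhoff. -/
theorem isAdapted_exnerSeba {N : ℕ} (hN : 1 ≤ N) {α : ℝ} (hα : 0 ≤ α) :
    IsAdapted N (.exnerSeba α) (fun ω => ω / √(ω ^ 2 + (α / N) ^ 2))
      (fun ω => (α / N) / √(ω ^ 2 + (α / N) ^ 2)) where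
  one_le := hN
  cos := isMultiplier_robinCos _
  sin := isMultiplier_robinSin _
  adjoint_mul := adjoint_mul_robinT (by positivity)
  mul_adjoint := robinT_mul_adjoint (by positivity)
  holds g d hd := by
    refine ⟨_, fun _ => rfl, ?_⟩
    have hN' : (N : ℂ) ≠ 0 := by exact_mod_cast (by omega : N ≠ 0)
    rw [Finset.sum_add_distrib, hd, add_zero, Finset.sum_const, Finset.card_univ, Fintype.card_fin,
      nsmul_eq_mul, ← integral_const_mul, ← integral_const_mul]
    congr 1; ext ω
    push_cast
    field_simp
  eq_zero_of_holds B hB := by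
    obtain ⟨b, hb, hs⟩ := hB
    simp only [Pi.neg_apply, hb, Finset.sum_const, Finset.card_univ, Fintype.card_fin,
      nsmul_eq_mul] at hs
    have h1 : ((N + α : ℝ) : ℂ) * b = 0 := by push_cast; linear_combination -hs
    have h2 : (N : ℝ) + α ≠ 0 := by
      have : (1 : ℝ) ≤ N := by exact_mod_cast hN
      positivity
    have h3 : b = 0 := (mul_eq_zero.1 h1).resolve_left (by exact_mod_cast h2)
    ext j
    rw [hb j, h3, Pi.zero_apply]

theorem holds_kirchhoff_iff {N : ℕ} (a b : Fin N → ℂ) :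
    VertexCondition.kirchhoff.Holds a b ↔ (VertexCondition.exnerSeba 0).Holds a b := by
  simp [VertexCondition.Holds]

theorem isAdapted_kirchhoff {N : ℕ} (hN : 1 ≤ N) :
    IsAdapted N .kirchhoff (fun ω => ω / √(ω ^ 2 + ((0 : ℝ) / N) ^ 2))
      (fun ω => ((0 : ℝ) / N) / √(ω ^ 2 + ((0 : ℝ) / N) ^ 2)) :=
  have h := isAdapted_exnerSeba hN le_rfl
  { h with
    holds := fun g d hd => (holds_kirchhoff_iff _ _).2 (h.holds g d hd)
    eq_zero_of_holds := fun B hB => h.eq_zero_of_holds B ((holds_kirchhoff_iff _ _).1 hB) }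

theorem isMultiplier_const (r : ℝ) : IsMultiplier fun _ => r :=
  ⟨measurable_const, |r|, fun _ => le_rfl⟩

theorem mulOp_const_zero : (isMultiplier_const 0).mulOp = 0 := by
  ext1 f
  rw [IsMultiplier.mulOp_eq_iff]
  filter_upwards [Lp.coeFn_zero ℂ 2 μ₊] with x h
  rw [zero_apply, h]
  simp

theorem mulOp_const_one : (isMultiplier_const 1).mulOp = 1 := by
  ext1 f
  rw [IsMultiplier.mulOp_eq_iff]
  exact Eventually.of_forall fun x => by simp

theorem edgeTransform_const : edgeTransform (isMultiplier_const 0) (isMultiplier_const 1) = sinT := by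
  rw [edgeTransform, mulOp_const_zero, mulOp_const_one, zero_mul, one_mul, zero_add]

theorem isAdapted_dirichlet {N : ℕ} (hN : 1 ≤ N) :
    IsAdapted N .dirichlet (fun _ => 0) (fun _ => 1) where
  one_le := hN
  cos := isMultiplier_const 0
  sin := isMultiplier_const 1
  adjoint_mul := by
    rw [edgeTransform_const, IsFourierKernel.adjoint_transform,
      IsFourierKernel.transform_mul_transform]
  mul_adjoint := by
    rw [edgeTransform_const, IsFourierKernel.adjoint_transform,
      IsFourierKernel.transform_mul_transform]
  holds g d hd := fun j => by simp
  eq_zero_of_holds B hB := funext hB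

/-! ### Diagonalization of the Laplacian -/

theorem IsMultiplier.mulOp_comm {m n : ℝ → ℝ} (hm : IsMultiplier m) (hn : IsMultiplier n) (f : ℋ) :
    hm.mulOp (hn.mulOp f) = hn.mulOp (hm.mulOp f) := by
  rw [mulOp_eq_iff]
  filter_upwards [hm.coeFn_mulOp f, hn.coeFn_mulOp f, hn.coeFn_mulOp (hm.mulOp f)] with x h1 h2 h3
  rw [h3, h1, h2]
  ring

theorem isMultiplier_one_sub_resolvent : IsMultiplier fun ω => ω ^ 2 * (1 + ω ^ 2)⁻¹ :=
  ⟨by fun_prop, 1, fun ω => by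
    rw [abs_of_nonneg (by positivity)]
    exact mul_inv_le_one_of_le₀ (by linarith) (by positivity)⟩

/-- Multiplication by `1/(1+ω²)`. -/
abbrev resOp : ℋ →L[ℂ] ℋ := isMultiplier_resolvent.mulOp

/-- Multiplication by `ω/(1+ω²)`. -/
abbrev freqResOp : ℋ →L[ℂ] ℋ := isMultiplier_id_mul_resolvent.mulOp

/-- Multiplication by `ω²/(1+ω²)`. -/
abbrev coresOp : ℋ →L[ℂ] ℋ := isMultiplier_one_sub_resolvent.mulOp

theorem resOp_add_coresOp (z : ℋ) : resOp z + coresOp z = z := by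
  refine Lp.ext ?_
  filter_upwards [Lp.coeFn_add (resOp z) (coresOp z), isMultiplier_resolvent.coeFn_mulOp z,
    isMultiplier_one_sub_resolvent.coeFn_mulOp z] with x h1 h2 h3
  rw [h1, Pi.add_apply, h2, h3, ← add_mul, ← Complex.ofReal_add]
  have : (1 + x ^ 2)⁻¹ + x ^ 2 * (1 + x ^ 2)⁻¹ = 1 := by
    have : 1 + x ^ 2 ≠ 0 := by positivity
    field_simp
  rw [this]; simp

theorem freqResOp_ae_eq (z : ℋ) :
    (freqResOp z : ℝ → ℂ) =ᵐ[μ₊] fun ω => (ω : ℂ) * (resOp z : ℝ → ℂ) ω := by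
  filter_upwards [isMultiplier_id_mul_resolvent.coeFn_mulOp z,
    isMultiplier_resolvent.coeFn_mulOp z] with x h1 h2
  rw [h1, h2]; push_cast; ring

theorem coresOp_ae_eq (z : ℋ) :
    (coresOp z : ℝ → ℂ) =ᵐ[μ₊] fun ω => (ω : ℂ) * (freqResOp z : ℝ → ℂ) ω := by
  filter_upwards [isMultiplier_one_sub_resolvent.coeFn_mulOp z,
    isMultiplier_id_mul_resolvent.coeFn_mulOp z] with x h1 h2
  rw [h1, h2]; push_cast; ring

/-! ### Second derivatives of cosine and sine transforms on a single edge -/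

/-- `f` lies in `H²(0,∞)` and `-f'' = F`; see `IsRepresentedBy`. -/
structure IsEdgeRepresentedBy (f F : ℋ) (h h' : ℝ → ℂ) : Prop where
  ae_eq : (f : ℝ → ℂ) =ᵐ[μ₊] h
  hasDeriv : ∀ x, 0 ≤ x → HasDerivWithinAt h (h' x) (Ici 0) x
  deriv_eq : ∀ x, 0 ≤ x → h' x = h' 0 - ∫ t in (0 : ℝ)..x, (F : ℝ → ℂ) t

theorem intervalIntegral_congr_ae_halfLine {f g : ℝ → ℂ} (h : f =ᵐ[μ₊] g) {x : ℝ} (hx : 0 ≤ x) :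
    ∫ t in (0 : ℝ)..x, f t = ∫ t in (0 : ℝ)..x, g t := by
  rw [intervalIntegral.integral_of_le hx, intervalIntegral.integral_of_le hx]
  exact integral_congr_ae (ae_restrict_of_ae_restrict_of_subset Ioc_subset_Ioi_self h)

theorem IsEdgeRepresentedBy.add {f F k K : ℋ} {h h' p p' : ℝ → ℂ}
    (h1 : IsEdgeRepresentedBy f F h h') (h2 : IsEdgeRepresentedBy k K p p') :
    IsEdgeRepresentedBy (f + k) (F + K) (h + p) (h' + p') where
  ae_eq := (Lp.coeFn_add f k).trans (h1.ae_eq.add h2.ae_eq)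
  hasDeriv x hx := (h1.hasDeriv x hx).add (h2.hasDeriv x hx)
  deriv_eq x hx := by
    rw [intervalIntegral_congr_ae_halfLine (Lp.coeFn_add F K) hx]
    simp only [Pi.add_apply]
    rw [intervalIntegral.integral_add (intervalIntegrable_coe _ hx)
      (intervalIntegrable_coe _ hx), h1.deriv_eq x hx, h2.deriv_eq x hx]
    ring

theorem IsEdgeRepresentedBy.neg {f F : ℋ} {h h' : ℝ → ℂ}
    (h1 : IsEdgeRepresentedBy f F h h') : IsEdgeRepresentedBy (-f) (-F) (-h) (-h') where
  ae_eq := (Lp.coeFn_neg f).trans h1.ae_eq.neg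
  hasDeriv x hx := (h1.hasDeriv x hx).neg
  deriv_eq x hx := by
    rw [intervalIntegral_congr_ae_halfLine (Lp.coeFn_neg F) hx]
    simp only [Pi.neg_apply, intervalIntegral.integral_neg, h1.deriv_eq x hx]
    ring

theorem integrable_resOp (z : ℋ) : Integrable (resOp z : ℝ → ℂ) μ₊ :=
  integrable_of_mul_self (freqResOp_ae_eq z)

theorem integrable_freqResOp (z : ℋ) : Integrable (freqResOp z : ℝ → ℂ) μ₊ :=
  integrable_of_mul_self (coresOp_ae_eq z)

theorem kernelTransform_sin_zero (f : ℝ → ℂ) : kernelTransform Real.sin f 0 = 0 := by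
  simp [kernelTransform]

theorem kernelTransform_cos_zero (f : ℝ → ℂ) :
    kernelTransform Real.cos f 0 = (√(2 / Real.pi) : ℝ) * ∫ x in Ioi (0 : ℝ), f x := by
  simp [kernelTransform]

/-- The first derivative is classical because `ω z/(1+ω²)` is integrable. The second is taken in
integrated form because `ω² z/(1+ω²)` is only square-integrable. -/
theorem isEdgeRepresentedBy_cos (z : ℋ) :
    IsEdgeRepresentedBy (cosT (resOp z)) (cosT (coresOp z))
      (kernelTransform Real.cos (resOp z)) (-kernelTransform Real.sin (freqResOp z)) where
  ae_eq := isFourierKernel_cos.transform_ae_eq (integrable_resOp z)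
  hasDeriv x _ := (hasDerivAt_cosTransform (integrable_resOp z) (integrable_freqResOp z)
    (freqResOp_ae_eq z) x).hasDerivWithinAt
  deriv_eq x hx := by
    rw [integral_cosT (coresOp_ae_eq z) hx]
    simp [kernelTransform_sin_zero]

theorem isEdgeRepresentedBy_sin (z : ℋ) :
    IsEdgeRepresentedBy (sinT (resOp z)) (sinT (coresOp z))
      (kernelTransform Real.sin (resOp z)) (kernelTransform Real.cos (freqResOp z)) where
  ae_eq := isFourierKernel_sin.transform_ae_eq (integrable_resOp z)
  hasDeriv x _ := (hasDerivAt_sinTransform (integrable_resOp z) (integrable_freqResOp z)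
    (freqResOp_ae_eq z) x).hasDerivWithinAt
  deriv_eq x hx := by
    rw [integral_sinT (coresOp_ae_eq z) hx]
    ring

/-- The derivative at `0` of the sine transform of `z/(1+ω²)`. -/
def sinDerivZero : ℋ →ₗ[ℂ] ℂ where
  toFun z := kernelTransform Real.cos (freqResOp z) 0
  map_add' f g := by
    rw [map_add, kernelTransform_cos_zero, kernelTransform_cos_zero, kernelTransform_cos_zero,
      integral_congr_ae (Lp.coeFn_add _ _)]
    simp only [Pi.add_apply]
    rw [integral_add (integrable_freqResOp f) (integrable_freqResOp g), mul_add]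
  map_smul' a f := by
    rw [map_smul, kernelTransform_cos_zero, kernelTransform_cos_zero,
      integral_congr_ae (Lp.coeFn_smul _ _)]
    simp only [Pi.smul_apply, smul_eq_mul, RingHom.id_apply]
    rw [integral_const_mul, mul_left_comm]

namespace IsAdapted

variable {N : ℕ} {bc : VertexCondition} {c s : ℝ → ℝ}

/-- The expansion in generalized eigenfunctions of the Laplacian. -/
def expansion (h : IsAdapted N bc c s) : HilbertSpace N →L[ℂ] HilbertSpace N :=
  starOp N sinT (edgeTransform h.cos h.sin)

theorem adjoint_expansion (h : IsAdapted N bc c s) :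
    ContinuousLinearMap.adjoint h.expansion =
      starOp N sinT (ContinuousLinearMap.adjoint (edgeTransform h.cos h.sin)) := by
  rw [expansion, adjoint_starOp h.one_le, IsFourierKernel.adjoint_transform]

theorem adjoint_mul_expansion (h : IsAdapted N bc c s) :
    ContinuousLinearMap.adjoint h.expansion * h.expansion = 1 := by
  rw [adjoint_expansion, expansion, starOp_mul h.one_le, h.adjoint_mul,
    IsFourierKernel.transform_mul_transform, starOp_one]

theorem expansion_mul_adjoint (h : IsAdapted N bc c s) :
    h.expansion * ContinuousLinearMap.adjoint h.expansion = 1 := by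
  rw [adjoint_expansion, expansion, starOp_mul h.one_le, h.mul_adjoint,
    IsFourierKernel.transform_mul_transform, starOp_one]

theorem adjoint_expansion_apply (h : IsAdapted N bc c s) (u : HilbertSpace N) :
    ContinuousLinearMap.adjoint h.expansion (h.expansion u) = u :=
  congrArg (fun T : HilbertSpace N →L[ℂ] HilbertSpace N => T u) h.adjoint_mul_expansion

theorem expansion_adjoint_apply (h : IsAdapted N bc c s) (u : HilbertSpace N) :
    h.expansion (ContinuousLinearMap.adjoint h.expansion u) = u :=
  congrArg (fun T : HilbertSpace N →L[ℂ] HilbertSpace N => T u) h.expansion_mul_adjoint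

/-- On each edge the inverse transform is a combination of cosine and sine transforms, for which
`-d²/dx²` is multiplication by `ω²`. At the vertex the sine terms vanish, so all edges share one
value; the derivatives differ only by amounts that come from the mean-zero part. -/
theorem mem_laplacianGraph_of_res (h : IsAdapted N bc c s) (Z : HilbertSpace N) :
    (ContinuousLinearMap.adjoint h.expansion (starOp N resOp resOp Z),
      ContinuousLinearMap.adjoint h.expansion (starOp N coresOp coresOp Z))
      ∈ laplacianGraph N bc := by
  have key : ∀ j,
      IsEdgeRepresentedBy
        (sinT (resOp (Z j)) + (cosT (resOp (h.cos.mulOp (edgeMean N Z))) +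
          sinT (resOp (h.sin.mulOp (edgeMean N Z))) + -sinT (resOp (edgeMean N Z))))
        (sinT (coresOp (Z j)) + (cosT (coresOp (h.cos.mulOp (edgeMean N Z))) +
          sinT (coresOp (h.sin.mulOp (edgeMean N Z))) + -sinT (coresOp (edgeMean N Z)))) _ _ :=
    fun j => (isEdgeRepresentedBy_sin (Z j)).add
      (((isEdgeRepresentedBy_cos (h.cos.mulOp (edgeMean N Z))).add
        (isEdgeRepresentedBy_sin (h.sin.mulOp (edgeMean N Z)))).add
        (isEdgeRepresentedBy_sin (edgeMean N Z)).neg)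
  have hap : ∀ {m : ℝ → ℝ} (hm : IsMultiplier m) (j : Fin N),
      ContinuousLinearMap.adjoint h.expansion (starOp N hm.mulOp hm.mulOp Z) j =
        sinT (hm.mulOp (Z j)) + (cosT (hm.mulOp (h.cos.mulOp (edgeMean N Z))) +
          sinT (hm.mulOp (h.sin.mulOp (edgeMean N Z))) + -sinT (hm.mulOp (edgeMean N Z))) := by
    intro m hm j
    rw [adjoint_expansion, starOp_apply, starOp_self_apply, edgeMean_starOp h.one_le,
      adjoint_edgeTransform, sub_eq_add_neg]
    change _ + ((cosT (h.cos.mulOp (hm.mulOp _)) + sinT (h.sin.mulOp (hm.mulOp _))) + _) = _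
    rw [IsMultiplier.mulOp_comm h.cos hm, IsMultiplier.mulOp_comm h.sin hm]
  refine ⟨_, _, ⟨fun j => ?_, fun j => (key j).hasDeriv, fun j => ?_⟩, ?_⟩
  · rw [hap]
    exact (key j).ae_eq
  · rw [hap]
    exact (key j).deriv_eq
  · have hN : (N : ℂ) ≠ 0 := by
      have := h.one_le
      exact_mod_cast (by omega : N ≠ 0)
    -- `sinDerivZero` is linear, so its values at the edges and at their mean differ by amounts that
    -- sum to zero.
    have hd : ∑ j, (sinDerivZero (Z j) - sinDerivZero (edgeMean N Z)) = 0 := by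
      rw [Finset.sum_sub_distrib, ← map_sum, Finset.sum_const, Finset.card_univ, Fintype.card_fin,
        edgeMean_apply, map_smul, nsmul_eq_mul, smul_eq_mul, mul_inv_cancel_left₀ hN, sub_self]
    have := h.holds (fun ω => (√(2 / Real.pi) : ℝ) * (resOp (edgeMean N Z) : ℝ → ℂ) ω) _ hd
    convert this using 2 with j j
    · simp only [Pi.add_apply, Pi.neg_apply, kernelTransform_sin_zero, kernelTransform_cos_zero]
      rw [zero_add, add_zero, neg_zero, add_zero, ← integral_const_mul]
      refine integral_congr_ae ?_
      filter_upwards [h.cos.coeFn_mulOp (resOp (edgeMean N Z))] with ω h1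
      rw [IsMultiplier.mulOp_comm isMultiplier_resolvent h.cos, h1]
      ring
    · simp only [Pi.add_apply, Pi.neg_apply, kernelTransform_sin_zero]
      rw [neg_zero, zero_add]
      change sinDerivZero (Z j) + (kernelTransform Real.cos (freqResOp (h.sin.mulOp (edgeMean N Z))) 0
        + -sinDerivZero (edgeMean N Z)) = _
      have e : kernelTransform Real.cos (freqResOp (h.sin.mulOp (edgeMean N Z))) 0
          = ∫ ω in Ioi (0 : ℝ), ((ω * s ω : ℝ) : ℂ) *
            ((√(2 / Real.pi) : ℝ) * (resOp (edgeMean N Z) : ℝ → ℂ) ω) := by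
        rw [kernelTransform_cos_zero, ← integral_const_mul]
        refine integral_congr_ae ?_
        filter_upwards [h.sin.coeFn_mulOp (freqResOp (edgeMean N Z)),
          freqResOp_ae_eq (edgeMean N Z)] with ω h1 h2
        rw [IsMultiplier.mulOp_comm isMultiplier_id_mul_resolvent h.sin, h1, h2]
        push_cast
        ring
      rw [e]
      ring

/-- On every edge `z'' = z`. Square-integrability kills the growing exponential, so `z_j'(0) =
-z_j(0)`, and `eq_zero_of_holds` then kills the decaying one. -/
theorem _root_.StarGraph.eq_zero_of_neg_mem_laplacianGraph (h : IsAdapted N bc c s)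
    {z : HilbertSpace N} (hz : (z, -z) ∈ laplacianGraph N bc) : z = 0 := by
  obtain ⟨g, g', hg, hbc⟩ := hz
  have hcont : ∀ j, ContinuousOn (g j) (Ici 0) :=
    fun j x hx => (hg.hasDeriv j x hx).continuousWithinAt
  have hd' : ∀ j, ∀ x, 0 ≤ x → HasDerivWithinAt (g' j) (g j x) (Ici 0) x := by
    intro j
    -- Extending by a constant to the left makes the integrand continuous on the whole line, so that
    -- the primitive is differentiable at `0` too.
    set k : ℝ → ℂ := fun x => g j (max x 0) with hk
    have hkc : Continuous k := by
      refine (hcont j).comp_continuous (by fun_prop) fun x => le_max_right x 0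
    have hkg : ∀ x, 0 ≤ x → k x = g j x := fun x hx => by simp only [hk, max_eq_left hx]
    have e : ∀ x, 0 ≤ x → g' j x = g' j 0 + ∫ t in (0 : ℝ)..x, k t := by
      intro x hx
      rw [hg.deriv_eq j x hx, sub_eq_add_neg, ← intervalIntegral.integral_neg]
      congr 1
      refine intervalIntegral_congr_ae_halfLine ?_ hx
      filter_upwards [hg.ae_eq j, Lp.coeFn_neg (z j), ae_restrict_mem measurableSet_Ioi]
        with t h1 h2 h3
      change -((-z j : ℋ) : ℝ → ℂ) t = _
      rw [h2, Pi.neg_apply, neg_neg, hkg t (le_of_lt h3), ← h1]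
    intro x hx
    have h1 : HasDerivAt (fun x => g' j 0 + ∫ t in (0 : ℝ)..x, k t) (k x) x :=
      (intervalIntegral.integral_hasDerivAt_right (hkc.intervalIntegrable _ _)
        (hkc.stronglyMeasurableAtFilter _ _) hkc.continuousAt).const_add _
    rw [← hkg x hx]
    exact h1.hasDerivWithinAt.congr e (e x hx)
  have hplus : ∀ j, ∀ x, 0 ≤ x → g' j x + g j x = (g' j 0 + g j 0) * Real.exp (1 * x) := by
    intro j x hx
    refine eq_mul_exp_of_hasDerivWithinAt (F := g' j + g j) (fun y hy => ?_) hx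
    refine ((hd' j y hy).add (hg.hasDeriv j y hy)).congr_deriv ?_
    simp only [Pi.add_apply, Complex.ofReal_one]
    ring
  have hminus : ∀ j, ∀ x, 0 ≤ x → g' j x - g j x = (g' j 0 - g j 0) * Real.exp (-1 * x) := by
    intro j x hx
    refine eq_mul_exp_of_hasDerivWithinAt (F := g' j - g j) (fun y hy => ?_) hx
    refine ((hd' j y hy).sub (hg.hasDeriv j y hy)).congr_deriv ?_
    simp only [Pi.sub_apply, Complex.ofReal_neg, Complex.ofReal_one]
    ring
  have hsum : ∀ j, g' j 0 + g j 0 = 0 := by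
    intro j
    have hexp : MemLp (fun x : ℝ => (g' j 0 - g j 0) * ((Real.exp (-1 * x) : ℝ) : ℂ)) 2 μ₊ := by
      refine MemLp.const_mul ?_ _
      rw [memLp_two_iff_integrable_sq_norm (Continuous.aestronglyMeasurable (by fun_prop))]
      refine (integrableOn_exp_mul_Ioi (a := -2) (by norm_num) 0).congr
        (Eventually.of_forall fun x => ?_)
      beta_reduce
      rw [Complex.norm_real, Real.norm_of_nonneg (Real.exp_pos _).le, sq, ← Real.exp_add]
      ring_nf
    -- Since `g' + g = 2 g + (g' - g)`, the growing exponential is a sum of two square-integrable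
    -- functions.
    refine eq_zero_of_memLp_mul_exp zero_le_one (((((Lp.memLp (z j)).const_mul 2).add hexp)).ae_eq ?_)
    filter_upwards [hg.ae_eq j, ae_restrict_mem measurableSet_Ioi] with x h1 h2
    have hx : 0 ≤ x := le_of_lt h2
    rw [Pi.add_apply, ← hminus j x hx, ← hplus j x hx, h1]
    ring
  have hB : (fun j => g j 0) = 0 := by
    refine h.eq_zero_of_holds _ ?_
    convert hbc using 2 with j
    rw [Pi.neg_apply]
    linear_combination -hsum j
  ext1 j
  refine Lp.ext ?_
  filter_upwards [hg.ae_eq j, ae_restrict_mem measurableSet_Ioi, Lp.coeFn_zero ℂ 2 μ₊] with x h1 h2 h3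
  have hx : 0 ≤ x := le_of_lt h2
  have hp := hplus j x hx
  have hm := hminus j x hx
  have h0 := congrFun hB j
  have h0' := hsum j
  simp only [Pi.zero_apply] at h0
  rw [h0, add_zero] at h0'
  rw [h0, h0'] at hp hm
  change (z j : ℝ → ℂ) x = ((0 : ℋ) : ℝ → ℂ) x
  rw [h1, h3, Pi.zero_apply]
  linear_combination (hp - hm) / 2

/-- Here `Z` is the transform of `u + w`, that is, of `(H + 1) u`. The pair built from `Z` lies in
the graph and has the same sum as `(u, w)`, so the difference of the two has the form `(z, -z)` and
vanishes. -/
theorem mem_laplacianGraph_iff (h : IsAdapted N bc c s) {u w : HilbertSpace N} :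
    (u, w) ∈ laplacianGraph N bc ↔ ∃ Z : HilbertSpace N,
      h.expansion u = starOp N resOp resOp Z ∧ h.expansion w = starOp N coresOp coresOp Z := by
  have e1 := h.adjoint_expansion_apply
  have e2 : ∀ Z : HilbertSpace N, starOp N resOp resOp Z + starOp N coresOp coresOp Z = Z := by
    intro Z
    ext1 j
    rw [PiLp.add_apply, starOp_self_apply, starOp_self_apply, resOp_add_coresOp]
  constructor
  · intro huw
    refine ⟨h.expansion (u + w), ?_⟩
    set Z := h.expansion (u + w) with hZ
    have hv := h.mem_laplacianGraph_of_res Z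
    set v := ContinuousLinearMap.adjoint h.expansion (starOp N resOp resOp Z) with hv1
    set y := ContinuousLinearMap.adjoint h.expansion (starOp N coresOp coresOp Z) with hy1
    have hvy : v + y = u + w := by
      rw [hv1, hy1, ← map_add, e2, hZ, e1]
    have hsub := (laplacianGraph N bc).sub_mem huw hv
    have hneg : w - y = -(u - v) := by
      have : w = v + y - u := by rw [hvy]; abel
      rw [this]; abel
    rw [Prod.mk_sub_mk, hneg] at hsub
    have huv : u - v = 0 := eq_zero_of_neg_mem_laplacianGraph h hsub
    have huv' : u = v := sub_eq_zero.1 huv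
    have hwy : w = y := sub_eq_zero.1 (by rw [hneg, huv, neg_zero])
    rw [huv', hwy]
    exact ⟨h.expansion_adjoint_apply _, h.expansion_adjoint_apply _⟩
  · rintro ⟨Z, h1, h2⟩
    have := h.mem_laplacianGraph_of_res Z
    rwa [← h1, ← h2, e1, e1] at this

end IsAdapted
/-! ### The spectral measure of multiplication by `ω²` -/

theorem isMultiplier_freqIndicator {A : Set ℝ} (hA : MeasurableSet A) :
    IsMultiplier (((fun ω : ℝ => ω ^ 2) ⁻¹' A).indicator fun _ => 1) :=
  ⟨measurable_const.indicator (hA.preimage (by fun_prop)), 1, fun ω => by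
    by_cases h : ω ∈ (fun ω : ℝ => ω ^ 2) ⁻¹' A <;> simp [h]⟩

/-- Multiplication by the indicator function of `ω² ∈ A`. -/
def freqProj {A : Set ℝ} (hA : MeasurableSet A) : ℋ →L[ℂ] ℋ := (isMultiplier_freqIndicator hA).mulOp

theorem coeFn_freqProj {A : Set ℝ} (hA : MeasurableSet A) (g : ℋ) :
    (freqProj hA g : ℝ → ℂ) =ᵐ[μ₊] ((fun ω : ℝ => ω ^ 2) ⁻¹' A).indicator (g : ℝ → ℂ) := by
  filter_upwards [(isMultiplier_freqIndicator hA).coeFn_mulOp g] with ω h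
  change ((isMultiplier_freqIndicator hA).mulOp g : ℝ → ℂ) ω = _
  rw [h]
  by_cases h : ω ∈ (fun ω : ℝ => ω ^ 2) ⁻¹' A <;> simp [h]

theorem adjoint_freqProj {A : Set ℝ} (hA : MeasurableSet A) :
    ContinuousLinearMap.adjoint (freqProj hA) = freqProj hA :=
  (isMultiplier_freqIndicator hA).adjoint_mulOp

theorem freqProj_univ : freqProj MeasurableSet.univ = 1 := by
  ext1 g
  refine Lp.ext ?_
  filter_upwards [coeFn_freqProj MeasurableSet.univ g] with ω h
  rw [h]; simp

theorem freqProj_inter {A B : Set ℝ} (hA : MeasurableSet A) (hB : MeasurableSet B) :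
    freqProj (hA.inter hB) = freqProj hA * freqProj hB := by
  ext1 g
  refine Lp.ext ?_
  change (freqProj (hA.inter hB) g : ℝ → ℂ) =ᵐ[μ₊] (freqProj hA (freqProj hB g) : ℝ → ℂ)
  filter_upwards [coeFn_freqProj (hA.inter hB) g, coeFn_freqProj hA (freqProj hB g),
    coeFn_freqProj hB g] with ω h1 h2 h3
  rw [h1, h2, preimage_inter, ← indicator_indicator]
  by_cases h : ω ∈ (fun ω : ℝ => ω ^ 2) ⁻¹' A
  · rw [indicator_of_mem h, indicator_of_mem h, h3]
  · rw [indicator_of_notMem h, indicator_of_notMem h]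

theorem freqProj_union {A B : Set ℝ} (hA : MeasurableSet A) (hB : MeasurableSet B)
    (hAB : Disjoint A B) (g : ℋ) :
    freqProj (hA.union hB) g = freqProj hA g + freqProj hB g := by
  refine Lp.ext ?_
  filter_upwards [coeFn_freqProj (hA.union hB) g, coeFn_freqProj hA g, coeFn_freqProj hB g,
    Lp.coeFn_add (freqProj hA g) (freqProj hB g)] with ω h1 h2 h3 h4
  rw [h4, Pi.add_apply, h1, h2, h3, preimage_union,
    indicator_union_of_disjoint (hAB.preimage _)]

/-- The distribution of `ω²` with respect to the density `|g(ω)|²`. -/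
def freqMeasure (g : ℋ) : Measure ℝ :=
  ((μ₊).withDensity fun ω => ‖(g : ℝ → ℂ) ω‖ₑ ^ 2).map fun ω => ω ^ 2

theorem aemeasurable_enorm_sq (g : ℋ) : AEMeasurable (fun ω => ‖(g : ℝ → ℂ) ω‖ₑ ^ 2) μ₊ :=
  (Lp.aestronglyMeasurable g).enorm.pow_const 2

theorem enorm_sq_eq_lintegral (g : ℋ) : ‖g‖ₑ ^ 2 = ∫⁻ ω in Ioi (0 : ℝ), ‖(g : ℝ → ℂ) ω‖ₑ ^ 2 := by
  rw [Lp.enorm_def, eLpNorm_sq_eq_lintegral]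

theorem enorm_freqProj_sq {A : Set ℝ} (hA : MeasurableSet A) (g : ℋ) :
    ‖freqProj hA g‖ₑ ^ 2 = freqMeasure g A := by
  have hA' : MeasurableSet ((fun ω : ℝ => ω ^ 2) ⁻¹' A) := hA.preimage (by fun_prop)
  rw [enorm_sq_eq_lintegral, freqMeasure, Measure.map_apply (by fun_prop) hA,
    withDensity_apply _ hA', ← lintegral_indicator hA']
  refine lintegral_congr_ae ?_
  filter_upwards [coeFn_freqProj hA g] with ω h
  rw [h]
  by_cases h : ω ∈ (fun ω : ℝ => ω ^ 2) ⁻¹' A <;> simp only [h, indicator_of_mem,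
    indicator_of_notMem, not_false_eq_true, enorm_zero, zero_pow, ne_eq, OfNat.ofNat_ne_zero]

instance isFiniteMeasure_freqMeasure (g : ℋ) : IsFiniteMeasure (freqMeasure g) := by
  refine ⟨?_⟩
  rw [← enorm_freqProj_sq MeasurableSet.univ]
  exact ENNReal.pow_lt_top enorm_lt_top

/-- Finite partial sums are the projections to finite unions. The squared norm of the remainder is
the finite measure `freqMeasure g` of the sets left over, which decrease to the empty set. -/
theorem hasSum_freqProj {A : ℕ → Set ℝ} (hA : ∀ n, MeasurableSet (A n))
    (hd : Pairwise (Function.onFun Disjoint A)) (g : ℋ) :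
    HasSum (fun n => freqProj (hA n) g) (freqProj (MeasurableSet.iUnion hA) g) := by
  have hU : ∀ F : Finset ℕ, MeasurableSet (⋃ n ∈ F, A n) := fun F =>
    F.measurableSet_biUnion fun n _ => hA n
  have hfin : ∀ F : Finset ℕ, ∑ n ∈ F, freqProj (hA n) g = freqProj (hU F) g := by
    intro F
    induction F using Finset.induction_on with
    | empty =>
      refine Lp.ext ?_
      filter_upwards [coeFn_freqProj (hU ∅) g, Lp.coeFn_zero ℂ 2 μ₊] with ω h1 h2
      rw [Finset.sum_empty, h1, h2]
      simp
    | insert a F ha ih =>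
      have hdj : Disjoint (A a) (⋃ n ∈ F, A n) := by
        rw [disjoint_iUnion₂_right]
        intro n hn
        exact hd (fun h => ha (h ▸ hn))
      rw [Finset.sum_insert ha, ih, ← freqProj_union (hA a) (hU F) hdj]
      congr 1
      simp only [Finset.set_biUnion_insert]
  have hD : ∀ F : Finset ℕ, MeasurableSet ((⋃ n, A n) \ ⋃ n ∈ F, A n) := fun F =>
    (MeasurableSet.iUnion hA).diff (hU F)
  have hnorm : ∀ F : Finset ℕ, ‖∑ n ∈ F, freqProj (hA n) g - freqProj (MeasurableSet.iUnion hA) g‖ₑ ^ 2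
      = freqMeasure g ((⋃ n, A n) \ ⋃ n ∈ F, A n) := by
    intro F
    rw [hfin, ← enorm_freqProj_sq (hD F)]
    have hsub : (⋃ n ∈ F, A n) ⊆ ⋃ n, A n := iUnion₂_subset fun n _ => subset_iUnion A n
    have e : freqProj (MeasurableSet.iUnion hA) g = freqProj (hU F) g + freqProj (hD F) g := by
      rw [← freqProj_union (hU F) (hD F) disjoint_sdiff_right]
      congr 1
      simp only [union_sdiff_cancel hsub]
    rw [e, sub_add_cancel_left, enorm_neg]
  have hlim : Tendsto (fun F : Finset ℕ => freqMeasure g ((⋃ n, A n) \ ⋃ n ∈ F, A n)) atTop (𝓝 0) := by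
    have h := tendsto_measure_iInter_atTop (μ := freqMeasure g)
      (s := fun F : Finset ℕ => (⋃ n, A n) \ ⋃ n ∈ F, A n) (fun F => (hD F).nullMeasurableSet)
      (fun F G hFG => sdiff_subset_sdiff_right (biUnion_subset_biUnion_left hFG))
      ⟨∅, measure_ne_top _ _⟩
    have e : ⋂ F : Finset ℕ, ((⋃ n, A n) \ ⋃ n ∈ F, A n) = ∅ := by
      refine eq_empty_of_forall_notMem fun x hx => ?_
      rw [mem_iInter] at hx
      obtain ⟨n, hn⟩ := mem_iUnion.1 (hx ∅).1
      exact (hx {n}).2 (by simpa using hn)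
    rw [e, measure_empty] at h
    exact h
  simp only [← hnorm] at hlim
  rw [HasSum, tendsto_iff_norm_sub_tendsto_zero]
  have h2 := (ENNReal.tendsto_toReal ENNReal.zero_ne_top).comp hlim
  have h3 := (Real.continuous_sqrt.tendsto _).comp h2
  simpa [Function.comp_def] using h3

theorem hasSum_starOp_freqProj {N : ℕ} {A : ℕ → Set ℝ} (hA : ∀ n, MeasurableSet (A n))
    (hd : Pairwise (Function.onFun Disjoint A)) (g : HilbertSpace N) :
    HasSum (fun n => starOp N (freqProj (hA n)) (freqProj (hA n)) g)
      (starOp N (freqProj (MeasurableSet.iUnion hA)) (freqProj (MeasurableSet.iUnion hA)) g) := by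
  rw [← (PiLp.continuousLinearEquiv 2 ℂ (fun _ : Fin N => ℋ)).hasSum']
  rw [Pi.hasSum]
  intro j
  simp only [PiLp.coe_continuousLinearEquiv, starOp_self_apply]
  exact hasSum_freqProj hA hd (g j)

namespace IsAdapted

variable {N : ℕ} {bc : VertexCondition} {c s : ℝ → ℝ}

open scoped Classical in
/-- The spectral projections of the Laplacian. -/
def specProj (h : IsAdapted N bc c s) (A : Set ℝ) : HilbertSpace N →L[ℂ] HilbertSpace N :=
  if hA : MeasurableSet A then
    ContinuousLinearMap.adjoint h.expansion * starOp N (freqProj hA) (freqProj hA) * h.expansion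
  -- The value on non-measurable sets is immaterial: the axioms of `ProjValuedMeasure` do not
  -- involve it.
  else 0

theorem specProj_eq (h : IsAdapted N bc c s) {A : Set ℝ} (hA : MeasurableSet A) :
    h.specProj A =
      ContinuousLinearMap.adjoint h.expansion * starOp N (freqProj hA) (freqProj hA) * h.expansion :=
  dif_pos hA

/-- The spectral resolution of the Laplacian. -/
def specMeasure (h : IsAdapted N bc c s) : ProjValuedMeasure (HilbertSpace N) where
  proj := h.specProj
  isStarProjection A hA := by
    rw [specProj_eq h hA]
    constructor
    · rw [IsIdempotentElem]
      have e := h.expansion_mul_adjoint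
      calc _ = ContinuousLinearMap.adjoint h.expansion * starOp N (freqProj hA) (freqProj hA) *
            (h.expansion * ContinuousLinearMap.adjoint h.expansion) *
            starOp N (freqProj hA) (freqProj hA) * h.expansion := by simp only [mul_assoc]
        _ = _ := by
            rw [e, mul_one, mul_assoc (ContinuousLinearMap.adjoint h.expansion),
              starOp_mul h.one_le, ← freqProj_inter]
            simp only [inter_self]
    · rw [IsSelfAdjoint]
      simp only [star_mul, ContinuousLinearMap.star_eq_adjoint, ContinuousLinearMap.adjoint_adjoint,
        adjoint_starOp h.one_le, adjoint_freqProj, mul_assoc]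
  proj_univ := by
    rw [specProj_eq h MeasurableSet.univ, freqProj_univ, starOp_one, mul_one,
      h.adjoint_mul_expansion]
  proj_inter A B hA hB := by
    rw [specProj_eq h hA, specProj_eq h hB, specProj_eq h (hA.inter hB), freqProj_inter hA hB,
      ← starOp_mul h.one_le]
    have e := h.expansion_mul_adjoint
    calc _ = ContinuousLinearMap.adjoint h.expansion * starOp N (freqProj hA) (freqProj hA) *
            1 * starOp N (freqProj hB) (freqProj hB) * h.expansion := by simp only [mul_assoc, one_mul]
      _ = _ := by rw [← e]; simp only [mul_assoc]
  hasSum_iUnion A hA hd u := by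
    rw [specProj_eq h (MeasurableSet.iUnion hA)]
    simp only [specProj_eq h (hA _)]
    exact (hasSum_starOp_freqProj hA hd (h.expansion u)).mapL
      (ContinuousLinearMap.adjoint h.expansion)

theorem norm_adjoint_expansion (h : IsAdapted N bc c s) (g : HilbertSpace N) :
    ‖ContinuousLinearMap.adjoint h.expansion g‖ = ‖g‖ := by
  refine (ContinuousLinearMap.norm_map_iff_adjoint_comp_self _).2 ?_ g
  rw [ContinuousLinearMap.adjoint_adjoint]
  exact h.expansion_mul_adjoint

theorem inner_expansion (h : IsAdapted N bc c s) (u v : HilbertSpace N) :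
    inner ℂ (h.expansion u) (h.expansion v) = inner ℂ u v := by
  rw [← ContinuousLinearMap.adjoint_inner_right, h.adjoint_expansion_apply]

theorem scalarMeasure_eq (h : IsAdapted N bc c s) (u : HilbertSpace N) :
    h.specMeasure.scalarMeasure u = ∑ j, freqMeasure (h.expansion u j) := by
  ext A hA
  rw [ProjValuedMeasure.scalarMeasure_apply _ _ hA, Measure.finsetSum_apply]
  change ENNReal.ofReal (‖h.specProj A u‖ ^ 2) = _
  rw [specProj_eq h hA]
  change ENNReal.ofReal (‖ContinuousLinearMap.adjoint h.expansion
    (starOp N (freqProj hA) (freqProj hA) (h.expansion u))‖ ^ 2) = _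
  rw [norm_adjoint_expansion, PiLp.norm_sq_eq_of_L2,
    ENNReal.ofReal_sum_of_nonneg fun _ _ => by positivity]
  refine Finset.sum_congr rfl fun j _ => ?_
  rw [starOp_self_apply, ← enorm_freqProj_sq hA, ENNReal.ofReal_pow (norm_nonneg _), ofReal_norm]

end IsAdapted

/-! ### Moments of the spectral measure -/

theorem lintegral_sq_freqMeasure (g : ℋ) :
    ∫⁻ lam, ENNReal.ofReal (lam ^ 2) ∂(freqMeasure g)
      = ∫⁻ ω in Ioi (0 : ℝ), ‖((ω ^ 2 : ℝ) : ℂ) * (g : ℝ → ℂ) ω‖ₑ ^ 2 := by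
  rw [freqMeasure, lintegral_map (by fun_prop) (by fun_prop),
    lintegral_withDensity_eq_lintegral_mul₀ (aemeasurable_enorm_sq g) (by fun_prop)]
  refine lintegral_congr fun ω => ?_
  rw [Pi.mul_apply, enorm_mul, mul_pow, mul_comm]
  congr 1
  rw [← ofReal_norm, Complex.norm_real, ← ENNReal.ofReal_pow (norm_nonneg _), Real.norm_eq_abs,
    sq_abs]

/-- Finiteness of the second moment means that `ω² g` is square-integrable, and then `z = g + ω² g`.
-/
theorem lintegral_sq_freqMeasure_lt_top_iff (g : ℋ) :
    ∫⁻ lam, ENNReal.ofReal (lam ^ 2) ∂(freqMeasure g) < ⊤ ↔ ∃ z, g = resOp z := by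
  have hm : AEStronglyMeasurable (fun ω : ℝ => ((ω ^ 2 : ℝ) : ℂ) * (g : ℝ → ℂ) ω) μ₊ :=
    (Continuous.aestronglyMeasurable (by fun_prop)).mul (Lp.aestronglyMeasurable g)
  rw [lintegral_sq_freqMeasure, ← memLp_two_iff_lintegral hm]
  constructor
  · intro hg
    refine ⟨g + hg.toLp, ?_⟩
    symm
    rw [IsMultiplier.mulOp_eq_iff]
    filter_upwards [Lp.coeFn_add g hg.toLp, hg.coeFn_toLp] with ω h1 h2
    rw [h1, Pi.add_apply, h2]
    have : (1 : ℂ) + (ω : ℂ) ^ 2 ≠ 0 := by exact_mod_cast (by positivity : 1 + ω ^ 2 ≠ 0)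
    push_cast
    field_simp
  · rintro ⟨z, rfl⟩
    refine (Lp.memLp (coresOp z)).ae_eq ?_
    filter_upwards [coresOp_ae_eq z, freqResOp_ae_eq z] with ω h1 h2
    rw [h1, h2]
    push_cast
    ring

theorem integrable_sq_mul_norm_sq (z : ℋ) :
    Integrable (fun ω : ℝ => ω ^ 2 * ‖(resOp z : ℝ → ℂ) ω‖ ^ 2) μ₊ := by
  refine ((memLp_two_iff_integrable_sq_norm (Lp.aestronglyMeasurable _)).1
    (Lp.memLp (freqResOp z))).congr ?_
  filter_upwards [freqResOp_ae_eq z] with ω h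
  rw [h, norm_mul, mul_pow, Complex.norm_real, Real.norm_eq_abs, sq_abs]

theorem enorm_sq_lt_top (g : ℋ) : ∀ᵐ ω ∂μ₊, ‖(g : ℝ → ℂ) ω‖ₑ ^ 2 < ⊤ :=
  Eventually.of_forall fun _ => ENNReal.pow_lt_top enorm_lt_top

theorem integrable_freqMeasure (z : ℋ) : Integrable (fun lam => lam) (freqMeasure (resOp z)) := by
  rw [freqMeasure, integrable_map_measure (by fun_prop) (by fun_prop),
    integrable_withDensity_iff_integrable_smul₀' (aemeasurable_enorm_sq _) (enorm_sq_lt_top _)]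
  refine (integrable_sq_mul_norm_sq z).congr (Eventually.of_forall fun ω => ?_)
  simp [mul_comm]

theorem inner_resOp_coresOp (z : ℋ) :
    inner ℂ (resOp z) (coresOp z) = ((∫ lam, lam ∂(freqMeasure (resOp z)) : ℝ) : ℂ) := by
  rw [freqMeasure, integral_map (by fun_prop) (by fun_prop),
    integral_withDensity_eq_integral_toReal_smul₀ (aemeasurable_enorm_sq _) (enorm_sq_lt_top _),
    L2.inner_def, ← integral_complex_ofReal]
  refine integral_congr_ae ?_
  filter_upwards [coresOp_ae_eq z, freqResOp_ae_eq z] with ω h1 h2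
  rw [h1, h2, RCLike.inner_apply]
  simp only [ENNReal.toReal_pow, toReal_enorm, smul_eq_mul, Complex.ofReal_mul,
    Complex.ofReal_pow]
  rw [← Complex.mul_conj']
  ring

/-- Under the unitary `expansion`, the scalar measure of `u` is the distribution of `ω²` under the
squared modulus of its transform, so domain and quadratic form are those of multiplication by `ω²`,
edge by edge. -/
theorem IsAdapted.isSpectralResolution {N : ℕ} {bc : VertexCondition} {c s : ℝ → ℝ}
    (h : IsAdapted N bc c s) : h.specMeasure.IsSpectralResolution (laplacian N bc) where
  mem_domain_iff u := by
    rw [h.scalarMeasure_eq, lintegral_finsetSum_measure, ENNReal.sum_lt_top]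
    simp only [Finset.mem_univ, true_implies, lintegral_sq_freqMeasure_lt_top_iff]
    rw [LinearPMap.mem_domain_iff]
    simp only [laplacian_graph, h.mem_laplacianGraph_iff]
    constructor
    · rintro ⟨w, Z, h1, -⟩ j
      exact ⟨Z j, by rw [h1, starOp_self_apply]⟩
    · intro hz
      choose z hz using hz
      set Z : HilbertSpace N := WithLp.toLp 2 z
      refine ⟨ContinuousLinearMap.adjoint h.expansion (starOp N coresOp coresOp Z), Z, ?_, ?_⟩
      · ext1 j
        rw [hz j, starOp_self_apply]
      · exact h.expansion_adjoint_apply _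
  inner_apply u := by
    have hg : ((u : HilbertSpace N), laplacian N bc u) ∈ (laplacian N bc).graph :=
      LinearPMap.mem_graph _ u
    rw [laplacian_graph, h.mem_laplacianGraph_iff] at hg
    obtain ⟨Z, h1, h2⟩ := hg
    have h1' : ∀ j, h.expansion (u : HilbertSpace N) j = resOp (Z j) := fun j => by
      rw [h1, starOp_self_apply]
    rw [h.scalarMeasure_eq, integral_finsetSum_measure fun j _ => by
      rw [h1']; exact integrable_freqMeasure _, ← h.inner_expansion, PiLp.inner_apply,
      Complex.ofReal_sum]
    refine Finset.sum_congr rfl fun j _ => ?_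
    rw [h1', h2, starOp_self_apply, inner_resOp_coresOp]

/-! ### Integral kernels of the spectral projections -/

/-- The generalized eigenfunction `c(ω) cos(ωx) + s(ω) sin(ωx)`. -/
def edgeWave (c s : ℝ → ℝ) (ω x : ℝ) : ℝ := c ω * Real.cos (ω * x) + s ω * Real.sin (ω * x)

theorem integrable_of_ae_eq_zero {f : ℋ} {R : ℝ}
    (hf : ∀ᵐ y ∂μ₊, R < y → (f : ℝ → ℂ) y = 0) : Integrable (f : ℝ → ℂ) μ₊ := by
  have h1 : IntegrableOn (f : ℝ → ℂ) (Ioc 0 R) μ₊ := by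
    have : IsFiniteMeasure ((μ₊).restrict (Ioc 0 R)) :=
      ⟨by rw [Measure.restrict_apply_univ]; exact measure_Ioc_lt_top⟩
    exact ((Lp.memLp f).mono_measure Measure.restrict_le_self).integrable (by norm_num)
  refine ((integrable_indicator_iff measurableSet_Ioc).2 h1).congr ?_
  filter_upwards [hf, ae_restrict_mem measurableSet_Ioi] with y h2 h3
  by_cases hy : y ∈ Ioc 0 R
  · rw [indicator_of_mem hy]
  · rw [indicator_of_notMem hy, h2]
    by_contra hc
    exact hy ⟨h3, not_lt.1 hc⟩

theorem IsMultiplier.integrable_mulOp {m : ℝ → ℝ} (hm : IsMultiplier m) {f : ℋ}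
    (hf : Integrable (f : ℝ → ℂ) μ₊) : Integrable (hm.mulOp f : ℝ → ℂ) μ₊ := by
  refine Integrable.congr ?_ (hm.coeFn_mulOp f).symm
  obtain ⟨h1, C, hC⟩ := hm
  refine hf.bdd_mul (c := C) (Complex.measurable_ofReal.comp h1).aestronglyMeasurable ?_
  exact Eventually.of_forall fun x => by simpa using hC x

theorem edgeTransform_ae_eq {c s : ℝ → ℝ} (hc : IsMultiplier c) (hs : IsMultiplier s) {f : ℋ}
    (hf : Integrable (f : ℝ → ℂ) μ₊) :
    (edgeTransform hc hs f : ℝ → ℂ) =ᵐ[μ₊] fun ω =>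
      (√(2 / Real.pi) : ℝ) * ∫ y in Ioi (0 : ℝ), (edgeWave c s ω y : ℂ) * (f : ℝ → ℂ) y := by
  change ((hc.mulOp (cosT f) + hs.mulOp (sinT f) : ℋ) : ℝ → ℂ) =ᵐ[μ₊] _
  filter_upwards [Lp.coeFn_add (hc.mulOp (cosT f)) (hs.mulOp (sinT f)), hc.coeFn_mulOp (cosT f),
    hs.coeFn_mulOp (sinT f), isFourierKernel_cos.transform_ae_eq hf,
    isFourierKernel_sin.transform_ae_eq hf] with ω h1 h2 h3 h4 h5
  rw [h1, Pi.add_apply, h2, h3, h4, h5, kernelTransform, kernelTransform, mul_left_comm,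
    mul_left_comm (s ω : ℂ), ← mul_add, ← integral_const_mul, ← integral_const_mul,
    ← integral_add ((isFourierKernel_cos.integrable_mul hf ω).const_mul _)
      ((isFourierKernel_sin.integrable_mul hf ω).const_mul _)]
  congr 1
  refine integral_congr_ae (Eventually.of_forall fun y => ?_)
  simp only [edgeWave]
  push_cast
  ring

theorem adjoint_edgeTransform_ae_eq {c s : ℝ → ℝ} (hc : IsMultiplier c) (hs : IsMultiplier s)
    {G : ℋ} (hG : Integrable (G : ℝ → ℂ) μ₊) :
    (ContinuousLinearMap.adjoint (edgeTransform hc hs) G : ℝ → ℂ) =ᵐ[μ₊] fun x =>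
      (√(2 / Real.pi) : ℝ) * ∫ ω in Ioi (0 : ℝ), (edgeWave c s ω x : ℂ) * (G : ℝ → ℂ) ω := by
  rw [adjoint_edgeTransform]
  change ((cosT (hc.mulOp G) + sinT (hs.mulOp G) : ℋ) : ℝ → ℂ) =ᵐ[μ₊] _
  have ic := hc.integrable_mulOp hG
  have is := hs.integrable_mulOp hG
  filter_upwards [Lp.coeFn_add (cosT (hc.mulOp G)) (sinT (hs.mulOp G)),
    isFourierKernel_cos.transform_ae_eq ic, isFourierKernel_sin.transform_ae_eq is] with x h1 h2 h3
  rw [h1, Pi.add_apply, h2, h3, kernelTransform, kernelTransform, ← mul_add,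
    ← integral_add (isFourierKernel_cos.integrable_mul ic x)
      (isFourierKernel_sin.integrable_mul is x)]
  congr 1
  refine integral_congr_ae ?_
  filter_upwards [hc.coeFn_mulOp G, hs.coeFn_mulOp G] with ω h4 h5
  rw [h4, h5, edgeWave, mul_comm x ω]
  push_cast
  ring

theorem sq_mem_Icc_iff {Λ ω : ℝ} (hω : 0 < ω) :
    ω ^ 2 ∈ Icc 0 Λ ↔ ω ∈ Ioc 0 (√Λ) := by
  rw [mem_Icc, mem_Ioc, Real.le_sqrt' hω]
  exact ⟨fun h => ⟨hω, h.2⟩, fun h => ⟨sq_nonneg ω, h.2⟩⟩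

/-- The integral kernel of the projection to the frequencies in `[0, r]`. -/
def edgeKernel (c s : ℝ → ℝ) (r x y : ℝ) : ℝ :=
  ∫ ω in (0 : ℝ)..r, 2 / Real.pi * (edgeWave c s ω x * edgeWave c s ω y)

theorem exists_edgeWave_le {c s : ℝ → ℝ} (hc : IsMultiplier c) (hs : IsMultiplier s) :
    ∃ B, ∀ ω x, |edgeWave c s ω x| ≤ B := by
  obtain ⟨-, C, hC⟩ := hc
  obtain ⟨-, D, hD⟩ := hs
  refine ⟨C + D, fun ω x => (abs_add_le _ _).trans (add_le_add ?_ ?_)⟩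
  · rw [abs_mul]
    exact (mul_le_of_le_one_right (abs_nonneg _) (Real.abs_cos_le_one _)).trans (hC ω)
  · rw [abs_mul]
    exact (mul_le_of_le_one_right (abs_nonneg _) (Real.abs_sin_le_one _)).trans (hD ω)

theorem integrable_edgeWave_prod {c s : ℝ → ℝ} (hc : IsMultiplier c) (hs : IsMultiplier s)
    {f : ℋ} (hf : Integrable (f : ℝ → ℂ) μ₊) (r x : ℝ) :
    Integrable (fun p : ℝ × ℝ =>
        ((2 / Real.pi * (edgeWave c s p.1 x * edgeWave c s p.1 p.2) : ℝ) : ℂ) * (f : ℝ → ℂ) p.2)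
      ((volume.restrict (Ioc 0 r)).prod μ₊) := by
  obtain ⟨B, hB⟩ := exists_edgeWave_le hc hs
  have h1 : Integrable (fun p : ℝ × ℝ => (1 : ℂ) * (f : ℝ → ℂ) p.2)
      ((volume.restrict (Ioc 0 r)).prod μ₊) :=
    (integrable_const (μ := volume.restrict (Ioc 0 r)) (1 : ℂ)).mul_prod hf
  simp only [one_mul] at h1
  refine h1.bdd_mul (c := |2 / Real.pi| * (B * B)) ?_ (Eventually.of_forall fun p => ?_)
  · have := hc.1
    have := hs.1
    refine (Complex.measurable_ofReal.comp ?_).aestronglyMeasurable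
    unfold edgeWave
    fun_prop
  · rw [Complex.norm_real, Real.norm_eq_abs, abs_mul, abs_mul]
    exact mul_le_mul_of_nonneg_left (mul_le_mul (hB _ _) (hB _ _) (abs_nonneg _)
      ((abs_nonneg _).trans (hB p.1 x))) (abs_nonneg _)

theorem integral_edgeWave_mul {c s : ℝ → ℝ} (f : ℋ) {r : ℝ} (hr : 0 ≤ r) (x y : ℝ) :
    ∫ ω in Ioc 0 r, ((2 / Real.pi * (edgeWave c s ω x * edgeWave c s ω y) : ℝ) : ℂ) *
      (f : ℝ → ℂ) y = (edgeKernel c s r x y : ℂ) * (f : ℝ → ℂ) y := by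
  rw [integral_mul_const, edgeKernel, intervalIntegral.integral_of_le hr, integral_complex_ofReal]

theorem integrable_edgeKernel_mul {c s : ℝ → ℝ} (hc : IsMultiplier c) (hs : IsMultiplier s)
    {f : ℋ} (hf : Integrable (f : ℝ → ℂ) μ₊) {r : ℝ} (hr : 0 ≤ r) (x : ℝ) :
    Integrable (fun y => (edgeKernel c s r x y : ℂ) * (f : ℝ → ℂ) y) μ₊ := by
  have := (integrable_edgeWave_prod hc hs hf r x).integral_prod_right
  simpa only [integral_edgeWave_mul f hr] using this

/-- The frequency cut-off makes the transform integrable, so both the transform and its inverse are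
honest integrals. Fubini on `(0,√Λ] × (0,∞)` exchanges them, and the two normalizations multiply to
`2/π`. -/
theorem edgeProjection_ae_eq {c s : ℝ → ℝ} (hc : IsMultiplier c) (hs : IsMultiplier s) {f : ℋ}
    (hf : Integrable (f : ℝ → ℂ) μ₊) (Λ : ℝ) :
    (ContinuousLinearMap.adjoint (edgeTransform hc hs)
      (freqProj (measurableSet_Icc (a := 0) (b := Λ)) (edgeTransform hc hs f)) : ℝ → ℂ)
      =ᵐ[μ₊] fun x => ∫ y in Ioi (0 : ℝ), (edgeKernel c s (√Λ) x y : ℂ) * (f : ℝ → ℂ) y := by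
  set G := freqProj (measurableSet_Icc (a := 0) (b := Λ)) (edgeTransform hc hs f) with hGdef
  have hG : (G : ℝ → ℂ) =ᵐ[μ₊] (Ioc 0 (√Λ)).indicator fun ω =>
      (√(2 / Real.pi) : ℝ) * ∫ y in Ioi (0 : ℝ), (edgeWave c s ω y : ℂ) * (f : ℝ → ℂ) y := by
    filter_upwards [coeFn_freqProj (measurableSet_Icc (a := 0) (b := Λ)) (edgeTransform hc hs f),
      edgeTransform_ae_eq hc hs hf, ae_restrict_mem measurableSet_Ioi] with ω h1 h2 h3
    rw [h1]
    by_cases h : ω ∈ Ioc 0 (√Λ)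
    · rw [indicator_of_mem h, indicator_of_mem (show ω ∈ (fun ω : ℝ => ω ^ 2) ⁻¹' Icc 0 Λ from (sq_mem_Icc_iff h3).2 h), h2]
    · rw [indicator_of_notMem h,
        indicator_of_notMem (show ω ∉ (fun ω : ℝ => ω ^ 2) ⁻¹' Icc 0 Λ from fun h' => h ((sq_mem_Icc_iff h3).1 h'))]
  have hGi : Integrable (G : ℝ → ℂ) μ₊ := by
    refine integrable_of_ae_eq_zero (R := √Λ) ?_
    filter_upwards [hG] with ω h1 h2
    rw [h1, indicator_of_notMem fun h => not_le.2 h2 h.2]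
  filter_upwards [adjoint_edgeTransform_ae_eq hc hs hGi] with x hx
  rw [hx]
  have hswap := integral_integral_swap (f := fun ω y : ℝ =>
    ((2 / Real.pi * (edgeWave c s ω x * edgeWave c s ω y) : ℝ) : ℂ) * (f : ℝ → ℂ) y)
    (integrable_edgeWave_prod hc hs hf (√Λ) x)
  simp only [integral_edgeWave_mul f (Real.sqrt_nonneg Λ)] at hswap
  rw [← hswap, ← integral_const_mul]
  have e : (fun ω => ((√(2 / Real.pi) : ℝ) : ℂ) * ((edgeWave c s ω x : ℂ) * (G : ℝ → ℂ) ω))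
      =ᵐ[μ₊] (Ioc 0 (√Λ)).indicator fun ω => ∫ y in Ioi (0 : ℝ),
        ((2 / Real.pi * (edgeWave c s ω x * edgeWave c s ω y) : ℝ) : ℂ) * (f : ℝ → ℂ) y := by
    filter_upwards [hG] with ω h1
    rw [h1]
    by_cases h : ω ∈ Ioc 0 (√Λ)
    · rw [indicator_of_mem h, indicator_of_mem h, ← integral_const_mul, ← integral_const_mul,
        ← integral_const_mul]
      refine integral_congr_ae (Eventually.of_forall fun y => ?_)
      have hpi : ((√(2 / Real.pi) : ℝ) : ℂ) * ((√(2 / Real.pi) : ℝ) : ℂ) = ((2 / Real.pi : ℝ) : ℂ) := by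
        rw [← Complex.ofReal_mul, Real.mul_self_sqrt (by positivity)]
      beta_reduce
      rw [Complex.ofReal_mul, ← hpi]
      push_cast
      ring
    · rw [indicator_of_notMem h, indicator_of_notMem h, mul_zero, mul_zero]
  rw [integral_congr_ae e, integral_indicator measurableSet_Ioc,
    Measure.restrict_restrict measurableSet_Ioc, inter_eq_left.2 Ioc_subset_Ioi_self]

/-! ### Existence of spectral densities -/

/-- The spectral density of the half-line with the Dirichlet condition. -/
def dirichletDensity (ω x y : ℝ) : ℝ := 2 / Real.pi * (Real.sin (ω * x) * Real.sin (ω * y))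

/-- The matrix-valued density that is `τ` on functions that are equal on all edges and the
Dirichlet density on functions with mean zero. -/
def densityMatrix (N : ℕ) (τ : ℝ → ℝ → ℝ → ℝ) (ω x y : ℝ) : Matrix (Fin N) (Fin N) ℂ :=
  Matrix.of fun j l => (((if j = l then dirichletDensity ω x y else 0)
    + (N : ℝ)⁻¹ * (τ ω x y - dirichletDensity ω x y) : ℝ) : ℂ)

theorem edgeWave_zero_one (ω x : ℝ) : edgeWave (fun _ => 0) (fun _ => 1) ω x = Real.sin (ω * x) := by
  simp [edgeWave]

theorem continuous_dirichletDensity :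
    Continuous fun p : ℝ × ℝ × ℝ => dirichletDensity p.1 p.2.1 p.2.2 := by
  unfold dirichletDensity
  fun_prop

theorem edgeMean_ae_eq {N : ℕ} (f : HilbertSpace N) :
    (edgeMean N f : ℝ → ℂ) =ᵐ[μ₊] fun x => (N : ℂ)⁻¹ * ∑ l, (f l : ℝ → ℂ) x := by
  rw [edgeMean_apply]
  filter_upwards [Lp.coeFn_smul (N : ℂ)⁻¹ (∑ l, f l), Lp.coeFn_finsetSum Finset.univ fun l => f l]
    with x h1 h2
  rw [h1, Pi.smul_apply, h2, Finset.sum_apply, smul_eq_mul]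

theorem IsAdapted.specProj_apply {N : ℕ} {bc : VertexCondition} {c s : ℝ → ℝ}
    (h : IsAdapted N bc c s) {A : Set ℝ} (hA : MeasurableSet A) (f : HilbertSpace N) (j : Fin N) :
    h.specProj A f j = sinT (freqProj hA (sinT (f j))) +
      (ContinuousLinearMap.adjoint (edgeTransform h.cos h.sin)
        (freqProj hA (edgeTransform h.cos h.sin (edgeMean N f)))
        - sinT (freqProj hA (sinT (edgeMean N f)))) := by
  rw [h.specProj_eq hA, h.adjoint_expansion, starOp_mul h.one_le, IsAdapted.expansion,
    starOp_mul h.one_le, starOp_apply]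
  rfl

theorem sinProjection_ae_eq {f : ℋ} (hf : Integrable (f : ℝ → ℂ) μ₊) (Λ : ℝ) :
    (sinT (freqProj (measurableSet_Icc (a := 0) (b := Λ)) (sinT f)) : ℝ → ℂ) =ᵐ[μ₊]
      fun x => ∫ y in Ioi (0 : ℝ),
        (edgeKernel (fun _ => 0) (fun _ => 1) (√Λ) x y : ℂ) * (f : ℝ → ℂ) y := by
  have := edgeProjection_ae_eq (isMultiplier_const 0) (isMultiplier_const 1) hf Λ
  rwa [edgeTransform_const, IsFourierKernel.adjoint_transform] at this

/-- Agreement of `τ` with the waves is required only for `ω > 0`: in the Kirchhoff case the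
multiplier `ω / √(ω²)` takes the default value `0` at `ω = 0`, whereas the continuous density does
not vanish there. -/
theorem integral_densityMatrix {N : ℕ} {c s : ℝ → ℝ} {τ : ℝ → ℝ → ℝ → ℝ}
    (hτ : ContinuousOn (fun p : ℝ × ℝ × ℝ => τ p.1 p.2.1 p.2.2) (Ici 0 ×ˢ Ici 0 ×ˢ Ici 0))
    (hcs : ∀ ω x y, 0 < ω → τ ω x y = 2 / Real.pi * (edgeWave c s ω x * edgeWave c s ω y))
    {r x y : ℝ} (hr : 0 ≤ r) (hx : 0 ≤ x) (hy : 0 ≤ y) (j l : Fin N) :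
    ∫ ω in (0 : ℝ)..r, densityMatrix N τ ω x y j l =
      ((if j = l then edgeKernel (fun _ => 0) (fun _ => 1) r x y else 0 : ℝ) : ℂ) +
        (N : ℂ)⁻¹ * ((edgeKernel c s r x y : ℂ) -
          (edgeKernel (fun _ => 0) (fun _ => 1) r x y : ℂ)) := by
  have iτ : IntervalIntegrable (fun ω => τ ω x y) volume 0 r := by
    refine ContinuousOn.intervalIntegrable ?_
    rw [uIcc_of_le hr]
    exact hτ.comp (f := fun ω : ℝ => (ω, x, y)) (by fun_prop) fun ω hω => ⟨hω.1, hx, hy⟩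
  have iD : IntervalIntegrable (fun ω => dirichletDensity ω x y) volume 0 r := by
    refine Continuous.intervalIntegrable ?_ _ _
    exact continuous_dirichletDensity.comp (f := fun ω : ℝ => (ω, x, y)) (by fun_prop)
  have eτ : ∫ ω in (0 : ℝ)..r, τ ω x y = edgeKernel c s r x y := by
    rw [edgeKernel, intervalIntegral.integral_of_le hr, intervalIntegral.integral_of_le hr]
    exact setIntegral_congr_fun measurableSet_Ioc fun ω hω => hcs ω x y hω.1
  have eD : ∫ ω in (0 : ℝ)..r, dirichletDensity ω x y
      = edgeKernel (fun _ => 0) (fun _ => 1) r x y := by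
    simp only [edgeKernel, edgeWave_zero_one, dirichletDensity]
  simp only [densityMatrix, Matrix.of_apply]
  rw [intervalIntegral.integral_ofReal, intervalIntegral.integral_add _
    ((iτ.sub iD).const_mul _), intervalIntegral.integral_const_mul,
    intervalIntegral.integral_sub iτ iD, eτ, eD]
  · push_cast
    congr 1
    split_ifs with hjl
    · rw [eD]
    · simp
  · split_ifs
    · exact iD
    · exact intervalIntegrable_const

/-- Expanding the edge mean in the form `S f_j + (T - S) (mean f)` of the projection gives the
diagonal Dirichlet entry plus `1/N` times the difference of the two densities in every entry. -/
theorem IsAdapted.isSpectralDensity {N : ℕ} {bc : VertexCondition} {c s : ℝ → ℝ}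
    (h : IsAdapted N bc c s) {τ : ℝ → ℝ → ℝ → ℝ}
    (hτ : ContinuousOn (fun p : ℝ × ℝ × ℝ => τ p.1 p.2.1 p.2.2) (Ici 0 ×ˢ Ici 0 ×ˢ Ici 0))
    (hcs : ∀ ω x y, 0 < ω → τ ω x y = 2 / Real.pi * (edgeWave c s ω x * edgeWave c s ω y)) :
    IsSpectralDensity N bc (densityMatrix N τ) where
  continuousOn j l := by
    have hD := continuous_dirichletDensity.continuousOn (s := Ici (0 : ℝ) ×ˢ Ici (0 : ℝ) ×ˢ Ici (0 : ℝ))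
    have h2 := continuousOn_const (c := (N : ℝ)⁻¹).mul (hτ.sub hD)
    simp only [densityMatrix, Matrix.of_apply]
    refine Complex.continuous_ofReal.comp_continuousOn (ContinuousOn.add ?_ h2)
    split_ifs
    · exact hD
    · exact continuousOn_const
  kernel := by
    refine ⟨h.specMeasure, h.isSpectralResolution, fun Λ _ f R hf j => ?_⟩
    have hfi : ∀ l, Integrable (f l : ℝ → ℂ) μ₊ := fun l => integrable_of_ae_eq_zero (hf l)
    have hmi : Integrable (edgeMean N f : ℝ → ℂ) μ₊ := by
      refine Integrable.congr ?_ (edgeMean_ae_eq f).symm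
      exact (integrable_finsetSum _ fun l _ => hfi l).const_mul _
    change ∀ᵐ x ∂μ₊, (h.specProj (Icc 0 Λ) f j : ℝ → ℂ) x = _
    rw [h.specProj_apply measurableSet_Icc]
    set u₁ := sinT (freqProj (measurableSet_Icc (a := 0) (b := Λ)) (sinT (f j)))
    set u₂ := ContinuousLinearMap.adjoint (edgeTransform h.cos h.sin)
      (freqProj (measurableSet_Icc (a := 0) (b := Λ)) (edgeTransform h.cos h.sin (edgeMean N f)))
    set u₃ := sinT (freqProj (measurableSet_Icc (a := 0) (b := Λ)) (sinT (edgeMean N f)))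
    filter_upwards [Lp.coeFn_add u₁ (u₂ - u₃), Lp.coeFn_sub u₂ u₃, sinProjection_ae_eq (hfi j) Λ,
      edgeProjection_ae_eq h.cos h.sin hmi Λ, sinProjection_ae_eq hmi Λ,
      ae_restrict_mem measurableSet_Ioi] with x h1 h2 h3 h4 h5 h6
    rw [h1, Pi.add_apply, h2, Pi.sub_apply, h3, h4, h5]
    set r := √Λ
    have hr : 0 ≤ r := Real.sqrt_nonneg Λ
    set D := fun y => (edgeKernel (fun _ => 0) (fun _ => 1) r x y : ℂ)
    set K := fun y => (edgeKernel c s r x y : ℂ)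
    have iD : ∀ l, Integrable (fun y => D y * (f l : ℝ → ℂ) y) μ₊ := fun l =>
      integrable_edgeKernel_mul (isMultiplier_const 0) (isMultiplier_const 1) (hfi l) hr x
    have iK : ∀ l, Integrable (fun y => K y * (f l : ℝ → ℂ) y) μ₊ := fun l =>
      integrable_edgeKernel_mul h.cos h.sin (hfi l) hr x
    have hmean : ∀ M : ℝ → ℂ, (∀ l, Integrable (fun y => M y * (f l : ℝ → ℂ) y) μ₊) →
        ∫ y in Ioi (0 : ℝ), M y * (edgeMean N f : ℝ → ℂ) y =
          ∑ l, (N : ℂ)⁻¹ * ∫ y in Ioi (0 : ℝ), M y * (f l : ℝ → ℂ) y := by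
      intro M hM
      rw [← Finset.mul_sum, ← integral_finsetSum _ fun l _ => hM l, ← integral_const_mul]
      refine integral_congr_ae ?_
      filter_upwards [edgeMean_ae_eq f] with y hy
      rw [hy, ← Finset.mul_sum]
      ring
    rw [hmean D iD, hmean K iK, ← Finset.sum_sub_distrib]
    have hl : ∀ l, ∫ y in Ioi (0 : ℝ), (Matrix.of fun j l => ∫ ω in (0 : ℝ)..r,
        densityMatrix N τ ω x y j l) j l * (f l : ℝ → ℂ) y =
        (if j = l then ∫ y in Ioi (0 : ℝ), D y * (f l : ℝ → ℂ) y else 0) +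
        ((N : ℂ)⁻¹ * (∫ y in Ioi (0 : ℝ), K y * (f l : ℝ → ℂ) y) -
          (N : ℂ)⁻¹ * ∫ y in Ioi (0 : ℝ), D y * (f l : ℝ → ℂ) y) := by
      intro l
      have e : ∀ y ∈ Ioi (0 : ℝ), (Matrix.of fun j l => ∫ ω in (0 : ℝ)..r,
          densityMatrix N τ ω x y j l) j l * (f l : ℝ → ℂ) y =
          (if j = l then 1 else 0) * (D y * (f l : ℝ → ℂ) y) +
          ((N : ℂ)⁻¹ * (K y * (f l : ℝ → ℂ) y) - (N : ℂ)⁻¹ * (D y * (f l : ℝ → ℂ) y)) := by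
        intro y hy
        rw [Matrix.of_apply, integral_densityMatrix hτ hcs hr (le_of_lt h6) (le_of_lt hy)]
        split_ifs
        · ring
        · push_cast; ring
      have i2 : Integrable (fun y => (N : ℂ)⁻¹ * (K y * (f l : ℝ → ℂ) y) -
          (N : ℂ)⁻¹ * (D y * (f l : ℝ → ℂ) y)) μ₊ := ((iK l).const_mul _).sub ((iD l).const_mul _)
      rw [setIntegral_congr_fun measurableSet_Ioi e, integral_add ((iD l).const_mul _) i2, integral_sub ((iK l).const_mul _)
        ((iD l).const_mul _), integral_const_mul, integral_const_mul, integral_const_mul]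
      split_ifs <;> ring
    simp only [hl, Finset.sum_add_distrib, Finset.sum_ite_eq, Finset.mem_univ, if_true]
    rfl

/-! ### The densities for the three vertex conditions -/

/-- The spectral density of the half-line with the condition `u'(0) = a u(0)`. -/
def robinDensity (a ω x y : ℝ) : ℝ :=
  2 / Real.pi * ((ω * Real.cos (ω * x) + a * Real.sin (ω * x)) *
    (ω * Real.cos (ω * y) + a * Real.sin (ω * y)) / (ω ^ 2 + a ^ 2))

/-- The spectral density of the half-line with the Neumann condition. -/
def neumannDensity (ω x y : ℝ) : ℝ := 2 / Real.pi * (Real.cos (ω * x) * Real.cos (ω * y))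

theorem robinDensity_eq (a : ℝ) {ω : ℝ} (x y : ℝ) :
    robinDensity a ω x y = 2 / Real.pi *
      (edgeWave (fun ω => ω / √(ω ^ 2 + a ^ 2)) (fun ω => a / √(ω ^ 2 + a ^ 2)) ω x *
        edgeWave (fun ω => ω / √(ω ^ 2 + a ^ 2)) (fun ω => a / √(ω ^ 2 + a ^ 2)) ω y) := by
  rw [robinDensity, edgeWave, edgeWave]
  congr 1
  rw [div_mul_eq_mul_div, div_mul_eq_mul_div, div_mul_eq_mul_div, div_mul_eq_mul_div, ← add_div,
    ← add_div, div_mul_div_comm, Real.mul_self_sqrt (by positivity)]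

theorem isSpectralDensity_exnerSeba {N : ℕ} (hN : 1 ≤ N) {α : ℝ} (hα : 0 < α) :
    IsSpectralDensity N (.exnerSeba α) (densityMatrix N (robinDensity (α / N))) := by
  refine (isAdapted_exnerSeba hN hα.le).isSpectralDensity ?_ fun ω x y _ => robinDensity_eq _ x y
  have hN' : (0 : ℝ) < N := by exact_mod_cast hN
  have : ∀ p : ℝ × ℝ × ℝ, p.1 ^ 2 + (α / N) ^ 2 ≠ 0 := fun p => by positivity
  unfold robinDensity
  refine Continuous.continuousOn ?_
  fun_prop (disch := assumption)

theorem isSpectralDensity_kirchhoff {N : ℕ} (hN : 1 ≤ N) :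
    IsSpectralDensity N .kirchhoff (densityMatrix N neumannDensity) := by
  refine (isAdapted_kirchhoff hN).isSpectralDensity ?_ fun ω x y hω => ?_
  · unfold neumannDensity
    fun_prop
  · rw [← robinDensity_eq, robinDensity, neumannDensity]
    simp only [zero_div, zero_mul, add_zero, ne_eq, OfNat.ofNat_ne_zero, not_false_eq_true, zero_pow]
    field_simp

theorem isSpectralDensity_dirichlet {N : ℕ} (hN : 1 ≤ N) :
    IsSpectralDensity N .dirichlet (densityMatrix N dirichletDensity) :=
  (isAdapted_dirichlet hN).isSpectralDensity continuous_dirichletDensity.continuousOn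
    fun ω x y _ => by simp only [edgeWave_zero_one, dirichletDensity]

end StarGraph

/-! ### Uniqueness of the spectral resolution -/

namespace ProjValuedMeasure

variable {E : Type*} [NormedAddCommGroup E] [InnerProductSpace ℂ E] [CompleteSpace E]

theorem inner_proj_left (P : ProjValuedMeasure E) {A : Set ℝ} (hA : MeasurableSet A) (u v : E) :
    inner ℂ (P.proj A u) v = inner ℂ u (P.proj A v) := by
  have h1 : ContinuousLinearMap.adjoint (P.proj A) = P.proj A := (P.isStarProjection A hA).isSelfAdjoint
  rw [← ContinuousLinearMap.adjoint_inner_right, h1]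

theorem proj_proj (P : ProjValuedMeasure E) {A B : Set ℝ} (hA : MeasurableSet A)
    (hB : MeasurableSet B) (u : E) : P.proj A (P.proj B u) = P.proj (A ∩ B) u := by
  rw [P.proj_inter A B hA hB]
  rfl

theorem norm_proj_le (P : ProjValuedMeasure E) {A : Set ℝ} (hA : MeasurableSet A) (u : E) :
    ‖P.proj A u‖ ≤ ‖u‖ := by
  have h1 := P.norm_sq_proj u hA
  have h2 : (inner ℂ u (P.proj A u)).re ≤ ‖u‖ * ‖P.proj A u‖ :=
    (Complex.re_le_norm _).trans (norm_inner_le_norm _ _)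
  rcases (norm_nonneg (P.proj A u)).eq_or_lt with h | h
  · rw [← h]; exact norm_nonneg u
  · nlinarith

instance isFiniteMeasure_scalarMeasure (P : ProjValuedMeasure E) (u : E) :
    IsFiniteMeasure (P.scalarMeasure u) :=
  ⟨by rw [P.scalarMeasure_apply u MeasurableSet.univ]; exact ENNReal.ofReal_lt_top⟩

theorem scalarMeasure_eq_zero_iff (P : ProjValuedMeasure E) (u : E) {A : Set ℝ}
    (hA : MeasurableSet A) : P.scalarMeasure u A = 0 ↔ P.proj A u = 0 := by
  rw [P.scalarMeasure_apply u hA, ENNReal.ofReal_eq_zero]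
  constructor
  · intro h
    have : ‖P.proj A u‖ ^ 2 = 0 := le_antisymm h (by positivity)
    simpa using this
  · intro h
    simp [h]

theorem scalarMeasure_real_univ (P : ProjValuedMeasure E) (u : E) :
    (P.scalarMeasure u).real univ = ‖u‖ ^ 2 := by
  rw [Measure.real, P.scalarMeasure_apply u MeasurableSet.univ, P.proj_univ,
    ENNReal.toReal_ofReal (by positivity)]
  rfl

theorem proj_eq_self_iff (P : ProjValuedMeasure E) (u : E) {A : Set ℝ} (hA : MeasurableSet A) :
    P.proj A u = u ↔ P.proj Aᶜ u = 0 := by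
  constructor
  · intro h
    rw [← h, P.proj_proj hA.compl hA, compl_inter_self, P.proj_empty]
    rfl
  · intro h
    have h1 := (P.scalarMeasure_eq_zero_iff u hA.compl).2 h
    have h2 : P.scalarMeasure u A = P.scalarMeasure u univ := by
      rw [← measure_add_measure_compl hA, h1, add_zero]
    rw [P.scalarMeasure_apply u hA, P.scalarMeasure_apply u MeasurableSet.univ, P.proj_univ,
      ENNReal.ofReal_eq_ofReal_iff (by positivity) (by positivity)] at h2
    have h3 : ‖u - P.proj A u‖ ^ 2 = 0 := by
      rw [norm_sub_sq (𝕜 := ℂ), RCLike.re_eq_complex_re, ← P.norm_sq_proj u hA, h2]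
      change ‖u‖ ^ 2 - 2 * ‖u‖ ^ 2 + ‖u‖ ^ 2 = 0
      ring
    have h4 : u - P.proj A u = 0 := by simpa using h3
    exact (sub_eq_zero.1 h4).symm

theorem proj_eq_self_of_subset (P : ProjValuedMeasure E) {u : E} {A B : Set ℝ}
    (hA : MeasurableSet A) (hB : MeasurableSet B) (hAB : A ⊆ B) (h : P.proj A u = u) :
    P.proj B u = u := by
  rw [← h, P.proj_proj hB hA, inter_eq_right.2 hAB]

/-- The cross term vanishes because `P.proj B u` and `P.proj B v` lie in the ranges of projections
to disjoint sets. -/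
theorem scalarMeasure_add (P : ProjValuedMeasure E) {u v : E} {A : Set ℝ} (hA : MeasurableSet A)
    (hu : P.proj A u = u) (hv : P.proj Aᶜ v = v) :
    P.scalarMeasure (u + v) = P.scalarMeasure u + P.scalarMeasure v := by
  ext B hB
  rw [Measure.add_apply, P.scalarMeasure_apply _ hB, P.scalarMeasure_apply _ hB,
    P.scalarMeasure_apply _ hB, ← ENNReal.ofReal_add (by positivity) (by positivity), map_add,
    norm_add_sq (𝕜 := ℂ)]
  have : inner ℂ (P.proj B u) (P.proj B v) = 0 := by
    rw [← hu, ← hv, P.proj_proj hB hA, P.proj_proj hB hA.compl,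
      P.inner_proj_left (hB.inter hA), P.proj_proj (hB.inter hA) (hB.inter hA.compl)]
    have e : B ∩ A ∩ (B ∩ Aᶜ) = ∅ := by
      ext x; simp only [mem_inter_iff, mem_compl_iff, mem_empty_iff_false]; tauto
    rw [e, P.proj_empty]
    simp
  rw [this]
  simp

/-! ### Localization of the operator to spectral subspaces, and comparison of two resolutions -/

namespace IsSpectralResolution

variable {P Q : ProjValuedMeasure E} {H : E →ₗ.[ℂ] E}

/-- The quadratic form is real. Polarization with `u + v` and `u + i v` yields the two components of
the identity. -/
theorem inner_symm (hP : P.IsSpectralResolution H) (u v : H.domain) :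
    inner ℂ (H u) (v : E) = inner ℂ (u : E) (H v) := by
  have him : ∀ w : H.domain, (inner ℂ (w : E) (H w)).im = 0 := fun w => by
    rw [hP.inner_apply w, Complex.ofReal_im]
  have h1 := him (u + v)
  have h2 := him (u + Complex.I • v)
  simp only [LinearPMap.map_add, LinearPMap.map_smul, Submodule.coe_add, Submodule.coe_smul,
    inner_add_left, inner_add_right, inner_smul_left, inner_smul_right, Complex.add_im, Complex.add_re, him,
    Complex.conj_I, Complex.mul_im, Complex.mul_re, Complex.neg_re, Complex.neg_im, Complex.I_re,
    Complex.I_im] at h1 h2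
  rw [← inner_conj_symm]
  apply Complex.ext
  · rw [Complex.conj_re]; linarith
  · rw [Complex.conj_im]; linarith

theorem mem_domain_of_proj_eq (hP : P.IsSpectralResolution H) {u : E} {m r : ℝ}
    (hu : P.proj (Icc (m - r) (m + r)) u = u) : u ∈ H.domain := by
  rw [hP.mem_domain_iff]
  have h0 := (P.scalarMeasure_eq_zero_iff u measurableSet_Icc.compl).2
    ((P.proj_eq_self_iff u measurableSet_Icc).1 hu)
  have hb : ∀ᵐ lam ∂(P.scalarMeasure u), ENNReal.ofReal (lam ^ 2) ≤
      ENNReal.ofReal ((|m| + |r|) ^ 2) := by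
    have : ∀ᵐ lam ∂(P.scalarMeasure u), lam ∈ Icc (m - r) (m + r) := by
      rw [ae_iff]; exact h0
    filter_upwards [this] with lam hl
    refine ENNReal.ofReal_le_ofReal (sq_le_sq.2 ?_)
    rw [abs_of_nonneg (a := |m| + |r|) (by positivity)]
    refine abs_le.2 ⟨?_, ?_⟩
    · linarith [hl.1, neg_abs_le m, le_abs_self r]
    · linarith [hl.2, le_abs_self m, le_abs_self r]
  refine (lintegral_mono_ae hb).trans_lt ?_
  rw [lintegral_const]
  exact ENNReal.mul_lt_top ENNReal.ofReal_lt_top (measure_lt_top _ _)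

theorem integrable_id (hP : P.IsSpectralResolution H) (u : H.domain) :
    Integrable (fun lam => lam) (P.scalarMeasure (u : E)) := by
  have h := (hP.mem_domain_iff u).1 u.2
  have h1 : MemLp (fun lam : ℝ => (lam : ℂ)) 2 (P.scalarMeasure (u : E)) := by
    rw [StarGraph.memLp_two_iff_lintegral (Continuous.aestronglyMeasurable (by fun_prop))]
    refine lt_of_eq_of_lt (lintegral_congr fun lam => ?_) h
    rw [← ofReal_norm, Complex.norm_real, ← ENNReal.ofReal_pow (norm_nonneg _), Real.norm_eq_abs,
      sq_abs]
  simpa using (h1.integrable (by norm_num)).re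

/-- The scalar measures of `u` and `v` add up, hence so do the values of the quadratic form; what is
left of its expansion is twice this real part. -/
theorem re_inner_eq_zero (hP : P.IsSpectralResolution H) {u v : H.domain} {A : Set ℝ}
    (hA : MeasurableSet A) (hu : P.proj A (u : E) = u) (hv : P.proj Aᶜ (v : E) = v) :
    (inner ℂ (v : E) (H u)).re = 0 := by
  have h := congrArg Complex.re (hP.inner_apply (u + v))
  rw [Submodule.coe_add, P.scalarMeasure_add hA hu hv,
    integral_add_measure (hP.integrable_id u) (hP.integrable_id v), LinearPMap.map_add,
    inner_add_left, inner_add_right, inner_add_right, hP.inner_apply u, hP.inner_apply v] at h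
  simp only [Complex.add_re, Complex.ofReal_re] at h
  have h2 : (inner ℂ (u : E) (H v)).re = (inner ℂ (v : E) (H u)).re := by
    rw [← hP.inner_symm u v, ← inner_conj_symm, Complex.conj_re]
  linarith

theorem inner_eq_zero (hP : P.IsSpectralResolution H) {u v : H.domain} {A : Set ℝ}
    (hA : MeasurableSet A) (hu : P.proj A (u : E) = u) (hv : P.proj Aᶜ (v : E) = v) :
    inner ℂ (v : E) (H u) = 0 := by
  have h1 := hP.re_inner_eq_zero hA hu hv
  have h2 := hP.re_inner_eq_zero (v := Complex.I • v) hA hu (by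
    rw [Submodule.coe_smul, map_smul, hv])
  rw [Submodule.coe_smul, inner_smul_left, Complex.conj_I] at h2
  apply Complex.ext
  · exact h1
  · simpa using h2

/-- By `inner_eq_zero`, `H u` is orthogonal to the vectors of the domain that live on `Aᶜ`. Vectors
on the bounded pieces of `Aᶜ` lie in the domain, and countably many such pieces exhaust `Aᶜ`. -/
theorem proj_apply_eq (hP : P.IsSpectralResolution H) {u : H.domain} {A : Set ℝ}
    (hA : MeasurableSet A) (hu : P.proj A (u : E) = u) : P.proj A (H u) = H u := by
  rw [P.proj_eq_self_iff _ hA, ← P.scalarMeasure_eq_zero_iff _ hA.compl]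
  have hn : ∀ n : ℕ, P.scalarMeasure (H u) (Aᶜ ∩ Icc (0 - (n : ℝ)) (0 + n)) = 0 := by
    intro n
    have hm : MeasurableSet (Aᶜ ∩ Icc (0 - (n : ℝ)) (0 + n)) := hA.compl.inter measurableSet_Icc
    rw [P.scalarMeasure_eq_zero_iff _ hm]
    refine ext_inner_left ℂ fun w => ?_
    rw [← P.inner_proj_left hm, inner_zero_right]
    have hd : P.proj (Aᶜ ∩ Icc (0 - (n : ℝ)) (0 + n)) w ∈ H.domain := by
      refine hP.mem_domain_of_proj_eq (m := 0) (r := n) ?_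
      rw [P.proj_proj measurableSet_Icc hm, inter_eq_right.2 inter_subset_right]
    refine hP.inner_eq_zero (v := ⟨_, hd⟩) hA hu ?_
    rw [P.proj_proj hA.compl hm, inter_eq_right.2 inter_subset_left]
  have hU : Aᶜ = ⋃ n : ℕ, Aᶜ ∩ Icc (0 - (n : ℝ)) (0 + n) := by
    rw [← inter_iUnion, eq_comm, inter_eq_left]
    intro x _
    obtain ⟨n, hn⟩ := exists_nat_ge |x|
    exact mem_iUnion.2 ⟨n, by have := abs_le.1 hn; constructor <;> linarith⟩
  rw [hU, measure_iUnion_null_iff]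
  exact hn

theorem abs_re_inner_sub_le (hP : P.IsSpectralResolution H) {u : H.domain} {m r : ℝ}
    (hu : P.proj (Icc (m - r) (m + r)) (u : E) = u) :
    |(inner ℂ (u : E) (H u - (m : ℂ) • (u : E))).re| ≤ r * ‖(u : E)‖ ^ 2 := by
  have h0 := (P.scalarMeasure_eq_zero_iff (u : E) measurableSet_Icc.compl).2
    ((P.proj_eq_self_iff (u : E) measurableSet_Icc).1 hu)
  have hae : ∀ᵐ lam ∂(P.scalarMeasure (u : E)), lam ∈ Icc (m - r) (m + r) := by
    rw [ae_iff]; exact h0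
  have e : (inner ℂ (u : E) (H u - (m : ℂ) • (u : E))).re
      = ∫ lam, (lam - m) ∂(P.scalarMeasure (u : E)) := by
    rw [integral_sub (hP.integrable_id u) (integrable_const m), integral_const,
      P.scalarMeasure_real_univ, inner_sub_right, hP.inner_apply, inner_smul_right,
      inner_self_eq_norm_sq_to_K, Complex.sub_re, Complex.ofReal_re, smul_eq_mul]
    congr 1
    have : (m : ℂ) * ((‖(u : E)‖ : ℝ) : ℂ) ^ 2 = ((m * ‖(u : E)‖ ^ 2 : ℝ) : ℂ) := by push_cast; rfl
    exact (congrArg Complex.re this).trans (by rw [Complex.ofReal_re, mul_comm])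
  rw [e, ← P.scalarMeasure_real_univ, ← Real.norm_eq_abs]
  refine norm_integral_le_of_norm_le_const ?_
  filter_upwards [hae] with lam hl
  rw [Real.norm_eq_abs, abs_le]
  constructor <;> linarith [hl.1, hl.2]

theorem re_inner_sub_symm (hP : P.IsSpectralResolution H) (u v : H.domain) (m : ℝ) :
    (inner ℂ (u : E) (H v - (m : ℂ) • (v : E))).re
      = (inner ℂ (v : E) (H u - (m : ℂ) • (u : E))).re := by
  rw [inner_sub_right, inner_sub_right, ← hP.inner_symm u v, inner_smul_right, inner_smul_right,
    ← inner_conj_symm (H u) (v : E), ← inner_conj_symm (u : E) (v : E), Complex.sub_re,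
    Complex.sub_re, Complex.conj_re, Complex.re_ofReal_mul, Complex.re_ofReal_mul, Complex.conj_re]

/-- A bound for a symmetric quadratic form becomes a norm bound by polarization: apply the form
bound to `u ± y` with `y = r⁻¹ (H - m) u`, which again lives on the interval, and combine by the
parallelogram law. -/
theorem norm_sub_le (hP : P.IsSpectralResolution H) {u : H.domain} {m r : ℝ} (hr : 0 < r)
    (hu : P.proj (Icc (m - r) (m + r)) (u : E) = u) :
    ‖H u - (m : ℂ) • (u : E)‖ ≤ r * ‖(u : E)‖ := by
  set t := H u - (m : ℂ) • (u : E) with ht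
  have htp : P.proj (Icc (m - r) (m + r)) t = t := by
    rw [ht, map_sub, map_smul, hP.proj_apply_eq measurableSet_Icc hu, hu]
  -- With the factor `r⁻¹`, the inequality `4 r⁻¹ ‖t‖² ≤ 2 r (‖u‖² + r⁻² ‖t‖²)` obtained below is
  -- exactly `‖t‖² ≤ r² ‖u‖²`.
  set y : E := ((r⁻¹ : ℝ) : ℂ) • t with hy
  have hyp : P.proj (Icc (m - r) (m + r)) y = y := by rw [hy, map_smul, htp]
  have hyd : y ∈ H.domain := hP.mem_domain_of_proj_eq hyp
  set Y : H.domain := ⟨y, hyd⟩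
  have h1 := hP.abs_re_inner_sub_le (u := u + Y) (m := m) (r := r)
    (by rw [Submodule.coe_add, map_add, hu]; exact congrArg _ hyp)
  have h2 := hP.abs_re_inner_sub_le (u := u - Y) (m := m) (r := r)
    (by rw [Submodule.coe_sub, map_sub, hu]; exact congrArg _ hyp)
  have hs : (inner ℂ (u : E) (H Y - (m : ℂ) • y)).re = (inner ℂ y t).re := hP.re_inner_sub_symm u Y m
  have hyt : (inner ℂ y t).re = r⁻¹ * ‖t‖ ^ 2 := by
    rw [hy, inner_smul_left, Complex.conj_ofReal, Complex.re_ofReal_mul,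
      inner_self_eq_norm_sq_to_K]
    congr 1
    exact congrArg Complex.re (by push_cast; rfl : ((‖t‖ : ℝ) : ℂ) ^ 2 = ((‖t‖ ^ 2 : ℝ) : ℂ))
  have hny : ‖y‖ ^ 2 = r⁻¹ ^ 2 * ‖t‖ ^ 2 := by
    rw [hy, norm_smul, Complex.norm_real, mul_pow, Real.norm_eq_abs, sq_abs]
  have hp : ‖(u : E) + y‖ ^ 2 + ‖(u : E) - y‖ ^ 2 = 2 * (‖(u : E)‖ ^ 2 + ‖y‖ ^ 2) := by
    have := parallelogram_law_with_norm ℂ (u : E) y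
    nlinarith [this]
  have e1 : (inner ℂ ((u + Y : H.domain) : E) (H (u + Y) - (m : ℂ) • ((u + Y : H.domain) : E))).re
      - (inner ℂ ((u - Y : H.domain) : E) (H (u - Y) - (m : ℂ) • ((u - Y : H.domain) : E))).re
      = 4 * (inner ℂ y t).re := by
    have a1 : H (u + Y) - (m : ℂ) • ((u + Y : H.domain) : E) = t + (H Y - (m : ℂ) • y) := by
      rw [LinearPMap.map_add, Submodule.coe_add, smul_add, ht]
      change _ = H u - (m : ℂ) • (u : E) + (H Y - (m : ℂ) • (Y : E))
      abel
    have a2 : H (u - Y) - (m : ℂ) • ((u - Y : H.domain) : E) = t - (H Y - (m : ℂ) • y) := by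
      rw [LinearPMap.map_sub, Submodule.coe_sub, smul_sub, ht]
      change _ = H u - (m : ℂ) • (u : E) - (H Y - (m : ℂ) • (Y : E))
      abel
    rw [a1, a2, Submodule.coe_add, Submodule.coe_sub]
    change (inner ℂ ((u : E) + y) _).re - (inner ℂ ((u : E) - y) _).re = _
    simp only [inner_add_left, inner_add_right, inner_sub_left, inner_sub_right (𝕜 := ℂ) _ t,
      Complex.add_re, Complex.sub_re, hs]
    ring
  have h1' := (abs_le.1 h1).2
  have h2' := (abs_le.1 h2).1
  have hc1 : ‖((u + Y : H.domain) : E)‖ ^ 2 = ‖(u : E) + y‖ ^ 2 := rfl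
  have hc2 : ‖((u - Y : H.domain) : E)‖ ^ 2 = ‖(u : E) - y‖ ^ 2 := rfl
  rw [hc1] at h1'
  rw [hc2] at h2'
  have h3 : 4 * (r⁻¹ * ‖t‖ ^ 2) ≤ r * (2 * (‖(u : E)‖ ^ 2 + r⁻¹ ^ 2 * ‖t‖ ^ 2)) := by
    rw [← hny, ← hp, ← hyt, ← e1]
    linarith
  have h4 : ‖t‖ ^ 2 ≤ (r * ‖(u : E)‖) ^ 2 := by
    have := mul_le_mul_of_nonneg_left h3 hr.le
    field_simp at this
    nlinarith [this]
  exact (pow_le_pow_iff_left₀ (norm_nonneg _) (by positivity) two_ne_zero).1 h4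

/-- Symmetry of `H` gives `(m' - m) ⟨u, v⟩ = ⟨(H - m) u, v⟩ - ⟨u, (H - m') v⟩`. The new vectors stay
in the same ranges and are bounded by `r ‖u‖` and `r' ‖v‖`. So the norm `K` of the product satisfies
`K ≤ K (r + r') / |m - m'|` with a quotient below `1`, and `K = 0`. -/
theorem proj_mul_proj_eq_zero (hP : P.IsSpectralResolution H) (hQ : Q.IsSpectralResolution H)
    {A B : Set ℝ} (hA : MeasurableSet A) (hB : MeasurableSet B) {m r m' r' : ℝ} (hr : 0 < r)
    (hr' : 0 < r') (hAI : A ⊆ Icc (m - r) (m + r)) (hBI : B ⊆ Icc (m' - r') (m' + r'))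
    (h : r + r' < |m - m'|) : P.proj A * Q.proj B = 0 := by
  set K := ‖P.proj A * Q.proj B‖ with hK
  have hd : 0 < |m - m'| := by linarith
  have hbound : ∀ u v : E, P.proj A u = u → Q.proj B v = v →
      ‖inner ℂ u v‖ ≤ K * (‖u‖ * ‖v‖) := by
    intro u v hu hv
    have e : inner ℂ u v = inner ℂ u ((P.proj A * Q.proj B) v) := by
      change _ = inner ℂ u (P.proj A (Q.proj B v))
      rw [hv, ← P.inner_proj_left hA, hu]
    rw [e]
    refine (norm_inner_le_norm _ _).trans ?_
    have := (P.proj A * Q.proj B).le_opNorm v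
    nlinarith [mul_le_mul_of_nonneg_left this (norm_nonneg u)]
  have hy : ∀ y : E, ‖(P.proj A * Q.proj B) y‖ ≤ (K * (r + r') / |m - m'|) * ‖y‖ := by
    intro y
    set v := Q.proj B y with hv
    set u := P.proj A v with hu
    change ‖u‖ ≤ _
    have hup : P.proj A u = u := by rw [hu, P.proj_proj hA hA, inter_self]
    have hvp : Q.proj B v = v := by rw [hv, Q.proj_proj hB hB, inter_self]
    have hup' := P.proj_eq_self_of_subset hA measurableSet_Icc hAI hup
    have hvp' := Q.proj_eq_self_of_subset hB measurableSet_Icc hBI hvp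
    set U : H.domain := ⟨u, hP.mem_domain_of_proj_eq hup'⟩
    set V : H.domain := ⟨v, hQ.mem_domain_of_proj_eq hvp'⟩
    have n1 : ‖H U - (m : ℂ) • u‖ ≤ r * ‖u‖ := hP.norm_sub_le (u := U) hr hup'
    have n2 : ‖H V - (m' : ℂ) • v‖ ≤ r' * ‖v‖ := hQ.norm_sub_le (u := V) hr' hvp'
    have p1 : P.proj A (H U - (m : ℂ) • u) = H U - (m : ℂ) • u := by
      rw [map_sub, map_smul, hP.proj_apply_eq (u := U) hA hup, hup]
    have p2 : Q.proj B (H V - (m' : ℂ) • v) = H V - (m' : ℂ) • v := by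
      rw [map_sub, map_smul, hQ.proj_apply_eq (u := V) hB hvp, hvp]
    have b1 := hbound _ _ p1 hvp
    have b2 := hbound _ _ hup p2
    have hsym : inner ℂ (H U) v = inner ℂ u (H V) := hP.inner_symm U V
    have e : ((m' - m : ℝ) : ℂ) * inner ℂ u v =
        inner ℂ (H U - (m : ℂ) • u) v - inner ℂ u (H V - (m' : ℂ) • v) := by
      rw [inner_sub_left, inner_sub_right, inner_smul_left, inner_smul_right, hsym,
        Complex.conj_ofReal]
      push_cast
      ring
    -- Here `u` is the projection of `v`, so the pairing recovers the full norm of `u`.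
    have huv : ‖inner ℂ u v‖ = ‖u‖ ^ 2 := by
      have : inner ℂ u v = inner ℂ u u := by
        conv_lhs => rw [← hup, P.inner_proj_left hA]
      rw [this, inner_self_eq_norm_sq_to_K, norm_pow]
      simp
    have e' := congrArg norm e
    rw [norm_mul, Complex.norm_real, Real.norm_eq_abs, abs_sub_comm, huv] at e'
    have hK0 : 0 ≤ K := norm_nonneg _
    have hvy : ‖v‖ ≤ ‖y‖ := Q.norm_proj_le hB y
    have h1 : |m - m'| * ‖u‖ ^ 2 ≤ K * (r + r') * ‖u‖ * ‖v‖ := by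
      rw [e']
      refine (_root_.norm_sub_le _ _).trans ?_
      have c1 := mul_le_mul_of_nonneg_left (mul_le_mul_of_nonneg_right n1 (norm_nonneg v)) hK0
      have c2 := mul_le_mul_of_nonneg_left (mul_le_mul_of_nonneg_left n2 (norm_nonneg u)) hK0
      linarith
    have h2 : |m - m'| * ‖u‖ ≤ K * (r + r') * ‖y‖ := by
      rcases (norm_nonneg u).eq_or_lt with h0 | h0
      · rw [← h0, mul_zero]; positivity
      · have h3 : ‖u‖ * (|m - m'| * ‖u‖) ≤ ‖u‖ * (K * (r + r') * ‖v‖) := by linarith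
        refine (le_of_mul_le_mul_left h3 h0).trans ?_
        exact mul_le_mul_of_nonneg_left hvy (by positivity)
    rw [div_mul_eq_mul_div, le_div_iff₀ hd]
    linarith
  have hle : K ≤ K * (r + r') / |m - m'| :=
    ContinuousLinearMap.opNorm_le_bound _ (by positivity) hy
  rw [le_div_iff₀ hd] at hle
  have hK0 : K = 0 := by
    have : 0 ≤ K := norm_nonneg _
    nlinarith
  exact norm_eq_zero.1 hK0

theorem proj_Icc_mul_proj_Icc (hP : P.IsSpectralResolution H) (hQ : Q.IsSpectralResolution H)
    {a b p q : ℝ} (hab : a ≤ b) (hpq : p ≤ q) (h : b < p ∨ q < a) :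
    Q.proj (Icc p q) * P.proj (Icc a b) = 0 := by
  -- The distance of the midpoints is the sum of the half-lengths plus the gap. A quarter of the gap
  -- on each side keeps the enlarged intervals apart and gives positive radii even to single points.
  obtain ⟨ε, hε, hgap⟩ : ∃ ε > 0, (b - a) / 2 + (q - p) / 2 + 2 * ε < |(p + q) / 2 - (a + b) / 2| := by
    rcases h with h | h
    · refine ⟨(p - b) / 4, by linarith, ?_⟩
      rw [abs_of_pos (by linarith)]
      linarith
    · refine ⟨(a - q) / 4, by linarith, ?_⟩
      rw [abs_of_neg (by linarith)]
      linarith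
  refine hQ.proj_mul_proj_eq_zero hP measurableSet_Icc measurableSet_Icc
    (m := (p + q) / 2) (r := (q - p) / 2 + ε) (m' := (a + b) / 2) (r' := (b - a) / 2 + ε)
    (by linarith) (by linarith) (Icc_subset_Icc (by linarith) (by linarith))
    (Icc_subset_Icc (by linarith) (by linarith)) (by linarith)

/-- The complement of `[a,b]` is covered by countably many compact intervals disjoint from `[a,b]`,
and the `Q`-projection to each of them annihilates the range of `P([a,b])`. -/
theorem proj_Icc_mul_self (hP : P.IsSpectralResolution H) (hQ : Q.IsSpectralResolution H)
    {a b : ℝ} (hab : a ≤ b) : Q.proj (Icc a b) * P.proj (Icc a b) = P.proj (Icc a b) := by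
  ext1 x
  change Q.proj (Icc a b) (P.proj (Icc a b) x) = P.proj (Icc a b) x
  rw [Q.proj_eq_self_iff _ measurableSet_Icc,
    ← Q.scalarMeasure_eq_zero_iff _ measurableSet_Icc.compl]
  set w := P.proj (Icc a b) x
  have hz : ∀ p q, p ≤ q → (b < p ∨ q < a) → Q.scalarMeasure w (Icc p q) = 0 := fun p q hpq h => by
    rw [Q.scalarMeasure_eq_zero_iff _ measurableSet_Icc]
    exact congrArg (fun T : E →L[ℂ] E => T x) (hP.proj_Icc_mul_proj_Icc hQ hab hpq h)
  have hsub : (Icc a b)ᶜ ⊆ (⋃ n : ℕ, Icc (b + 1 / (n + 1)) (b + 1 + n)) ∪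
      ⋃ n : ℕ, Icc (a - 1 - n) (a - 1 / (n + 1)) := by
    intro t ht
    rw [mem_compl_iff, mem_Icc, not_and_or, not_le, not_le] at ht
    rcases ht with ht | ht
    · refine Or.inr (mem_iUnion.2 ?_)
      obtain ⟨n, hn⟩ := exists_nat_one_div_lt (sub_pos.2 ht)
      obtain ⟨k, hk⟩ := exists_nat_ge (a - t)
      refine ⟨max n k, ?_, ?_⟩
      · have : (k : ℝ) ≤ (max n k : ℕ) := by exact_mod_cast le_max_right n k
        linarith
      · have h1 : (n : ℝ) ≤ (max n k : ℕ) := by exact_mod_cast le_max_left n k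
        have : (1 : ℝ) / ((max n k : ℕ) + 1) ≤ 1 / (n + 1) := by gcongr
        linarith
    · refine Or.inl (mem_iUnion.2 ?_)
      obtain ⟨n, hn⟩ := exists_nat_one_div_lt (sub_pos.2 ht)
      obtain ⟨k, hk⟩ := exists_nat_ge (t - b)
      refine ⟨max n k, ?_, ?_⟩
      · have h1 : (n : ℝ) ≤ (max n k : ℕ) := by exact_mod_cast le_max_left n k
        have : (1 : ℝ) / ((max n k : ℕ) + 1) ≤ 1 / (n + 1) := by gcongr
        linarith
      · have : (k : ℝ) ≤ (max n k : ℕ) := by exact_mod_cast le_max_right n k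
        linarith
  refine measure_mono_null hsub (measure_union_null (measure_iUnion_null fun n => ?_)
    (measure_iUnion_null fun n => ?_))
  · have h0 : (0 : ℝ) < 1 / ((n : ℝ) + 1) := by positivity
    have h1 : (1 : ℝ) / ((n : ℝ) + 1) ≤ 1 := by
      rw [div_le_one (by positivity)]; linarith [n.cast_nonneg (α := ℝ)]
    exact hz _ _ (by linarith [n.cast_nonneg (α := ℝ)]) (Or.inl (by linarith))
  · have h0 : (0 : ℝ) < 1 / ((n : ℝ) + 1) := by positivity
    have h1 : (1 : ℝ) / ((n : ℝ) + 1) ≤ 1 := by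
      rw [div_le_one (by positivity)]; linarith [n.cast_nonneg (α := ℝ)]
    exact hz _ _ (by linarith [n.cast_nonneg (α := ℝ)]) (Or.inr (by linarith))

/-- The spectral projections of an operator to compact intervals are unique. -/
theorem proj_Icc_eq (hP : P.IsSpectralResolution H) (hQ : Q.IsSpectralResolution H)
    {a b : ℝ} (hab : a ≤ b) : P.proj (Icc a b) = Q.proj (Icc a b) := by
  have h1 := hP.proj_Icc_mul_self hQ hab
  have h2 := hQ.proj_Icc_mul_self hP hab
  have h3 := congrArg star h1
  rw [star_mul, (P.isStarProjection _ measurableSet_Icc).isSelfAdjoint.star_eq,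
    (Q.isStarProjection _ measurableSet_Icc).isSelfAdjoint.star_eq] at h3
  rw [← h3, h2]

end IsSpectralResolution

end ProjValuedMeasure

/-! ### Uniqueness of the spectral density -/

namespace StarGraph

theorem eqOn_zero_of_intervalIntegral_eq_zero {g : ℝ → ℂ} (hg : ContinuousOn g (Ici 0))
    (h : ∀ b, 0 ≤ b → ∫ y in (0 : ℝ)..b, g y = 0) : EqOn g 0 (Ici 0) := by
  have hc : Continuous fun y => g (max y 0) :=
    hg.comp_continuous (by fun_prop) fun y => le_max_right y 0
  have h0 : ∀ b, 0 ≤ b → ∫ y in (0 : ℝ)..b, g (max y 0) = 0 := fun b hb => by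
    rw [← h b hb]
    refine intervalIntegral.integral_congr fun y hy => ?_
    rw [uIcc_of_le hb] at hy
    simp only [max_eq_left hy.1]
  have h1 : EqOn g 0 (Ioi 0) := fun b hb => by
    have d1 := hc.integral_hasStrictDerivAt 0 b |>.hasDerivAt
    have d2 : HasDerivAt (fun u => ∫ y in (0 : ℝ)..u, g (max y 0)) 0 b := by
      refine (hasDerivAt_const b (0 : ℂ)).congr_of_eventuallyEq ?_
      filter_upwards [Ioi_mem_nhds hb] with u hu using h0 u (le_of_lt hu)
    have := d1.unique d2
    rwa [max_eq_left (le_of_lt hb)] at this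
  exact h1.of_subset_closure hg continuousOn_const Ioi_subset_Ici_self (by simp)

/-- Composing each variable with `max · 0` extends the integrand continuously to the whole space. -/
theorem continuousOn_intervalIntegral {F : ℝ → ℝ → ℝ → ℂ}
    (hF : ContinuousOn (fun p : ℝ × ℝ × ℝ => F p.1 p.2.1 p.2.2) (Ici 0 ×ˢ Ici 0 ×ˢ Ici 0))
    {r : ℝ} (hr : 0 ≤ r) :
    ContinuousOn (fun p : ℝ × ℝ => ∫ ω in (0 : ℝ)..r, F ω p.1 p.2) (Ici 0 ×ˢ Ici 0) := by
  have hc : Continuous fun q : (ℝ × ℝ) × ℝ => F (max q.2 0) (max q.1.1 0) (max q.1.2 0) :=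
    hF.comp_continuous (f := fun q : (ℝ × ℝ) × ℝ => (max q.2 0, max q.1.1 0, max q.1.2 0))
      (by fun_prop) fun q =>
        ⟨le_max_right q.2 0, le_max_right q.1.1 0, le_max_right q.1.2 0⟩
  refine (intervalIntegral.continuous_parametric_intervalIntegral_of_continuous' (μ := volume)
    (f := fun p : ℝ × ℝ => fun ω : ℝ => F (max ω 0) (max p.1 0) (max p.2 0))
    hc 0 r).continuousOn.congr fun p hp => ?_
  refine intervalIntegral.integral_congr fun ω hω => ?_
  rw [uIcc_of_le hr] at hω
  simp only [max_eq_left hω.1, max_eq_left (mem_Ici.1 hp.1), max_eq_left (mem_Ici.1 hp.2)]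

/-- A continuous integral kernel is determined by the operator. -/
theorem HasIntegralKernel.unique {N : ℕ} {T : HilbertSpace N →L[ℂ] HilbertSpace N}
    {K K' : ℝ → ℝ → Matrix (Fin N) (Fin N) ℂ} (hK : HasIntegralKernel T K)
    (hK' : HasIntegralKernel T K')
    (hc : ∀ j l, ContinuousOn (fun p : ℝ × ℝ => K p.1 p.2 j l) (Ici 0 ×ˢ Ici 0))
    (hc' : ∀ j l, ContinuousOn (fun p : ℝ × ℝ => K' p.1 p.2 j l) (Ici 0 ×ˢ Ici 0))
    (j l : Fin N) {x y : ℝ} (hx : 0 ≤ x) (hy : 0 ≤ y) : K x y j l = K' x y j l := by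
  -- Testing with the indicator of `(0,b]` on the edge `l` gives equality for almost every `x`,
  -- hence for all `x ≥ 0` by continuity.
  have key : ∀ b, 0 ≤ b → EqOn (fun x => ∫ y in (0 : ℝ)..b, K x y j l)
      (fun x => ∫ y in (0 : ℝ)..b, K' x y j l) (Ici 0) := by
    intro b hb
    have hcont : ∀ M : ℝ → ℝ → Matrix (Fin N) (Fin N) ℂ,
        (∀ j l, ContinuousOn (fun p : ℝ × ℝ => M p.1 p.2 j l) (Ici 0 ×ˢ Ici 0)) →
        ContinuousOn (fun x => ∫ y in (0 : ℝ)..b, M x y j l) (Ici 0) := by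
      intro M hM
      have h1 := continuousOn_intervalIntegral (F := fun ω x _ => M x ω j l)
        ((hM j l).comp (t := Ici 0 ×ˢ Ici 0) (f := fun p : ℝ × ℝ × ℝ => (p.2.1, p.1))
          (by fun_prop) fun p hp => ⟨hp.2.1, hp.1⟩) hb
      exact h1.comp (f := fun x : ℝ => (x, x)) (by fun_prop) fun x hx => ⟨hx, hx⟩
    have hint : ∀ M : ℝ → ℝ → Matrix (Fin N) (Fin N) ℂ, ∀ x,
        (∑ l', ∫ y in Ioi (0 : ℝ), M x y j l' *
          ((WithLp.toLp 2 (fun l' : Fin N => if l' = l then box b else 0) : HilbertSpace N) l'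
            : ℝ → ℂ) y) = ∫ y in (0 : ℝ)..b, M x y j l := by
      intro M x
      rw [Finset.sum_eq_single l]
      · rw [intervalIntegral.integral_of_le hb]
        simp only [if_true]
        have e : (fun y => M x y j l * (box b : ℝ → ℂ) y)
            =ᵐ[μ₊] (Ioc 0 b).indicator fun y => M x y j l := by
          filter_upwards [coeFn_box b] with y hy
          rw [hy]
          by_cases h : y ∈ Ioc 0 b <;> simp [h]
        rw [integral_congr_ae e, integral_indicator measurableSet_Ioc,
          Measure.restrict_restrict measurableSet_Ioc, inter_eq_left.2 Ioc_subset_Ioi_self]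
      · intro l' _ hl'
        simp only [if_neg hl']
        rw [← integral_zero ℝ ℂ (μ := μ₊)]
        refine integral_congr_ae ?_
        filter_upwards [Lp.coeFn_zero ℂ 2 μ₊] with y hy
        rw [hy]
        simp
      · simp
    have hsupp : ∀ l', ∀ᵐ y ∂μ₊, b < y →
        ((WithLp.toLp 2 (fun l' : Fin N => if l' = l then box b else 0) : HilbertSpace N) l'
            : ℝ → ℂ) y = 0 := by
      intro l'
      by_cases h : l' = l
      · simp only [if_pos h]
        filter_upwards [coeFn_box b] with y hy hby
        rw [hy]
        exact indicator_of_notMem (fun h => absurd h.2 (not_le.2 hby)) _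
      · simp only [if_neg h]
        filter_upwards [Lp.coeFn_zero ℂ 2 μ₊] with y hy _
        rw [hy]
        rfl
    have h1 := hK _ b hsupp j
    have h2 := hK' _ b hsupp j
    simp only [hint] at h1 h2
    have h12 : (fun x => ∫ y in (0 : ℝ)..b, K x y j l)
        =ᵐ[μ₊] fun x => ∫ y in (0 : ℝ)..b, K' x y j l := by
      filter_upwards [h1, h2] with x e1 e2 using e1.symm.trans e2
    have h3 := Measure.eqOn_open_of_ae_eq h12 isOpen_Ioi
      ((hcont K hc).mono Ioi_subset_Ici_self) ((hcont K' hc').mono Ioi_subset_Ici_self)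
    exact h3.of_subset_closure (hcont K hc) (hcont K' hc') Ioi_subset_Ici_self (by simp)
  have hslice : ∀ M : ℝ → ℝ → Matrix (Fin N) (Fin N) ℂ,
      (∀ j l, ContinuousOn (fun p : ℝ × ℝ => M p.1 p.2 j l) (Ici 0 ×ˢ Ici 0)) →
      ContinuousOn (fun y => M x y j l) (Ici 0) := fun M hM =>
    (hM j l).comp (f := fun y : ℝ => (x, y)) (by fun_prop) fun y hy => ⟨hx, hy⟩
  refine sub_eq_zero.1 (eqOn_zero_of_intervalIntegral_eq_zero
    (g := fun y => K x y j l - K' x y j l) ((hslice K hc).sub (hslice K' hc')) ?_ hy)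
  intro b hb
  have hii : ∀ M : ℝ → ℝ → Matrix (Fin N) (Fin N) ℂ,
      (∀ j l, ContinuousOn (fun p : ℝ × ℝ => M p.1 p.2 j l) (Ici 0 ×ˢ Ici 0)) →
      IntervalIntegrable (fun y => M x y j l) volume 0 b := fun M hM =>
    ((hslice M hM).mono (by rw [uIcc_of_le hb]; exact Icc_subset_Ici_self)).intervalIntegrable
  rw [intervalIntegral.integral_sub (hii K hc) (hii K' hc'), sub_eq_zero]
  exact key b hb hx

/-- The spectral density is unique. -/
theorem IsSpectralDensity.unique {N : ℕ} {bc : VertexCondition}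
    {σ τ : ℝ → ℝ → ℝ → Matrix (Fin N) (Fin N) ℂ} (hσ : IsSpectralDensity N bc σ)
    (hτ : IsSpectralDensity N bc τ) (j l : Fin N) {ω x y : ℝ} (hω : 0 ≤ ω) (hx : 0 ≤ x)
    (hy : 0 ≤ y) : σ ω x y j l = τ ω x y j l := by
  obtain ⟨P, hP, hPk⟩ := hσ.kernel
  obtain ⟨Q, hQ, hQk⟩ := hτ.kernel
  have hslice : ∀ ρ : ℝ → ℝ → ℝ → Matrix (Fin N) (Fin N) ℂ, IsSpectralDensity N bc ρ →
      ContinuousOn (fun ω => ρ ω x y j l) (Ici 0) := fun ρ hρ =>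
    (hρ.continuousOn j l).comp (f := fun ω : ℝ => (ω, x, y)) (by fun_prop)
      fun ω hω => ⟨hω, hx, hy⟩
  refine sub_eq_zero.1 (eqOn_zero_of_intervalIntegral_eq_zero
    (g := fun ω => σ ω x y j l - τ ω x y j l) ((hslice σ hσ).sub (hslice τ hτ)) ?_ hω)
  intro r hr
  have hii : ∀ ρ : ℝ → ℝ → ℝ → Matrix (Fin N) (Fin N) ℂ, IsSpectralDensity N bc ρ →
      IntervalIntegrable (fun ω => ρ ω x y j l) volume 0 r := fun ρ hρ =>
    ((hslice ρ hρ).mono (by rw [uIcc_of_le hr]; exact Icc_subset_Ici_self)).intervalIntegrable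
  rw [intervalIntegral.integral_sub (hii σ hσ) (hii τ hτ), sub_eq_zero]
  -- With `Λ = r²` the upper limit `√Λ` of the frequency integral is `r`.
  have h1 := hPk (r ^ 2) (by positivity)
  have h2 := hQk (r ^ 2) (by positivity)
  rw [← hP.proj_Icc_eq hQ (by positivity)] at h2
  rw [Real.sqrt_sq hr] at h1 h2
  exact h1.unique h2 (fun j l => continuousOn_intervalIntegral
    (F := fun ω x y => σ ω x y j l) (hσ.continuousOn j l) hr)
    (fun j l => continuousOn_intervalIntegral
    (F := fun ω x y => τ ω x y j l) (hτ.continuousOn j l) hr) j l hx hy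

/-! ### The diagonal of the spectral density -/

theorem densityMatrix_robinDensity_diag {N : ℕ} (hN : 1 ≤ N) {α : ℝ} (hα : 0 < α) (j : Fin N)
    (ω x : ℝ) : densityMatrix N (robinDensity (α / N)) ω x x j j =
      ((1 / Real.pi + 1 / Real.pi * (2 / N - 1) * Real.cos (2 * ω * x)
          + (2 * α / Real.pi) / (α ^ 2 + (N : ℝ) ^ 2 * ω ^ 2)
            * (ω * Real.sin (2 * ω * x) - α / N * Real.cos (2 * ω * x)) : ℝ) : ℂ) := by
  have hN0 : (N : ℝ) ≠ 0 := by positivity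
  have hd : α ^ 2 + (N : ℝ) ^ 2 * ω ^ 2 ≠ 0 := by positivity
  have hd' : ω ^ 2 + (α / N) ^ 2 = (α ^ 2 + (N : ℝ) ^ 2 * ω ^ 2) / N ^ 2 := by
    field_simp
    ring
  have hs : Real.sin (ω * x) ^ 2 = 1 - Real.cos (ω * x) ^ 2 := by
    rw [← Real.sin_sq_add_cos_sq (ω * x)]; ring
  simp only [densityMatrix, Matrix.of_apply, if_true, robinDensity, dirichletDensity, mul_assoc 2 ω x,
    Real.cos_two_mul, Real.sin_two_mul, hd']
  congr 1
  field_simp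
  ring_nf
  simp only [hs]
  ring

theorem densityMatrix_neumannDensity_diag {N : ℕ} (hN : 1 ≤ N) (j : Fin N) (ω x : ℝ) :
    densityMatrix N neumannDensity ω x x j j =
      ((1 / Real.pi + 1 / Real.pi * (2 / N - 1) * Real.cos (2 * ω * x) : ℝ) : ℂ) := by
  have hN0 : (N : ℝ) ≠ 0 := by positivity
  have hs : Real.sin (ω * x) ^ 2 = 1 - Real.cos (ω * x) ^ 2 := by
    rw [← Real.sin_sq_add_cos_sq (ω * x)]; ring
  simp only [densityMatrix, Matrix.of_apply, if_true, neumannDensity, dirichletDensity,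
    mul_assoc 2 ω x, Real.cos_two_mul]
  congr 1
  field_simp
  ring_nf
  simp only [hs]
  ring

theorem densityMatrix_dirichletDensity_diag {N : ℕ} (j : Fin N) (ω x : ℝ) :
    densityMatrix N dirichletDensity ω x x j j =
      ((1 / Real.pi * (1 - Real.cos (2 * ω * x)) : ℝ) : ℂ) := by
  have hs : Real.sin (ω * x) ^ 2 = 1 - Real.cos (ω * x) ^ 2 := by
    rw [← Real.sin_sq_add_cos_sq (ω * x)]; ring
  simp only [densityMatrix, Matrix.of_apply, if_true, dirichletDensity, mul_assoc 2 ω x,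
    Real.cos_two_mul, sub_self, mul_zero, add_zero, ← sq, hs]
  congr 1
  ring

/-- Dividing numerator and denominator of the correction by `α²` shows that it tends to `-2c/(πN)`,
which cancels the `2/N` of the Kirchhoff term. -/
theorem tendsto_exnerSeba_correction {N : ℕ} (hN : 1 ≤ N) (ω s c : ℝ) :
    Tendsto (fun α : ℝ => 1 / Real.pi + 1 / Real.pi * (2 / N - 1) * c
          + (2 * α / Real.pi) / (α ^ 2 + (N : ℝ) ^ 2 * ω ^ 2) * (ω * s - α / N * c)) atTop
      (𝓝 (1 / Real.pi * (1 - c))) := by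
  have hN0 : (N : ℝ) ≠ 0 := by positivity
  have hi : Tendsto (fun α : ℝ => α⁻¹) atTop (𝓝 0) := tendsto_inv_atTop_zero
  have h1 : Tendsto (fun α : ℝ => 1 / Real.pi + 1 / Real.pi * (2 / N - 1) * c
      + 2 / Real.pi / (1 + (N : ℝ) ^ 2 * ω ^ 2 * α⁻¹ ^ 2) * (ω * s * α⁻¹ - c / N)) atTop
      (𝓝 (1 / Real.pi + 1 / Real.pi * (2 / N - 1) * c
      + 2 / Real.pi / (1 + (N : ℝ) ^ 2 * ω ^ 2 * 0 ^ 2) * (ω * s * 0 - c / N))) :=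
    tendsto_const_nhds.add (((tendsto_const_nhds (x := 2 / Real.pi)).div
      (tendsto_const_nhds.add ((hi.pow 2).const_mul _)) (by norm_num)).mul
        ((hi.const_mul _).sub tendsto_const_nhds))
  have e : 1 / Real.pi + 1 / Real.pi * (2 / N - 1) * c
      + 2 / Real.pi / (1 + (N : ℝ) ^ 2 * ω ^ 2 * 0 ^ 2) * (ω * s * 0 - c / N)
      = 1 / Real.pi * (1 - c) := by
    field_simp
    ring
  rw [e] at h1
  refine h1.congr' ?_
  filter_upwards [eventually_gt_atTop 0] with α hα
  have hd : α ^ 2 + (N : ℝ) ^ 2 * ω ^ 2 ≠ 0 := by positivity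
  have hd' : 1 + (N : ℝ) ^ 2 * ω ^ 2 * α⁻¹ ^ 2 = (α ^ 2 + (N : ℝ) ^ 2 * ω ^ 2) / α ^ 2 := by
    field_simp
  rw [hd']
  field_simp

end StarGraph

end

/-! ### Existence, the diagonal formulas and the Dirichlet limit -/

theorem mainTheorem5 (N : ℕ) (hN : 1 ≤ N) :
    -- the spectral densities exist
    (∀ α : ℝ, 0 < α → ∃ σ, StarGraph.IsSpectralDensity N (.exnerSeba α) σ) ∧
    (∃ σ, StarGraph.IsSpectralDensity N .kirchhoff σ) ∧
    (∃ σ, StarGraph.IsSpectralDensity N .dirichlet σ) ∧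
    -- diagonal values for the Exner-Šeba condition
    (∀ α : ℝ, 0 < α → ∀ σ, StarGraph.IsSpectralDensity N (.exnerSeba α) σ →
      ∀ (j : Fin N) (ω x : ℝ), 0 ≤ ω → 0 ≤ x →
        σ ω x x j j = ((1 / Real.pi + 1 / Real.pi * (2 / N - 1) * Real.cos (2 * ω * x)
          + (2 * α / Real.pi) / (α ^ 2 + (N : ℝ) ^ 2 * ω ^ 2)
            * (ω * Real.sin (2 * ω * x) - α / N * Real.cos (2 * ω * x)) : ℝ) : ℂ)) ∧
    -- the first two terms are the diagonal values for the Kirchhoff condition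
    (∀ σ, StarGraph.IsSpectralDensity N .kirchhoff σ →
      ∀ (j : Fin N) (ω x : ℝ), 0 ≤ ω → 0 ≤ x →
        σ ω x x j j =
          ((1 / Real.pi + 1 / Real.pi * (2 / N - 1) * Real.cos (2 * ω * x) : ℝ) : ℂ)) ∧
    -- diagonal values for the Dirichlet condition
    (∀ σ, StarGraph.IsSpectralDensity N .dirichlet σ →
      ∀ (j : Fin N) (ω x : ℝ), 0 ≤ ω → 0 ≤ x →
        σ ω x x j j = ((1 / Real.pi * (1 - Real.cos (2 * ω * x)) : ℝ) : ℂ)) ∧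
    -- the Dirichlet values are the limit of the Exner-Šeba values as `α → +∞`
    (∀ (σS : ℝ → ℝ → ℝ → ℝ → Matrix (Fin N) (Fin N) ℂ)
        (σD : ℝ → ℝ → ℝ → Matrix (Fin N) (Fin N) ℂ),
      (∀ α : ℝ, 0 < α → StarGraph.IsSpectralDensity N (.exnerSeba α) (σS α)) →
      StarGraph.IsSpectralDensity N .dirichlet σD →
      ∀ (j : Fin N) (ω x : ℝ), 0 ≤ ω → 0 ≤ x →
        Tendsto (fun α : ℝ => σS α ω x x j j) atTop (𝓝 (σD ω x x j j))) := by
  refine ⟨fun α hα => ⟨_, StarGraph.isSpectralDensity_exnerSeba hN hα⟩,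
    ⟨_, StarGraph.isSpectralDensity_kirchhoff hN⟩, ⟨_, StarGraph.isSpectralDensity_dirichlet hN⟩,
    fun α hα σ hσ j ω x hω hx => ?_, fun σ hσ j ω x hω hx => ?_, fun σ hσ j ω x hω hx => ?_,
    fun σS σD hS hD j ω x hω hx => ?_⟩
  · rw [hσ.unique (StarGraph.isSpectralDensity_exnerSeba hN hα) j j hω hx hx,
      StarGraph.densityMatrix_robinDensity_diag hN hα]
  · rw [hσ.unique (StarGraph.isSpectralDensity_kirchhoff hN) j j hω hx hx,
      StarGraph.densityMatrix_neumannDensity_diag hN]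
  · rw [hσ.unique (StarGraph.isSpectralDensity_dirichlet hN) j j hω hx hx,
      StarGraph.densityMatrix_dirichletDensity_diag]
  · rw [hD.unique (StarGraph.isSpectralDensity_dirichlet hN) j j hω hx hx,
      StarGraph.densityMatrix_dirichletDensity_diag]
    refine ((Complex.continuous_ofReal.tendsto _).comp
      (StarGraph.tendsto_exnerSeba_correction hN ω (Real.sin (2 * ω * x)) _)).congr' ?_
    filter_upwards [eventually_gt_atTop 0] with α hα
    rw [(hS α hα).unique (StarGraph.isSpectralDensity_exnerSeba hN hα) j j hω hx hx,
      StarGraph.densityMatrix_robinDensity_diag hN hα]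
    rfl
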